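/- Let $K$ be a field and $q,s\in K^\times$; put $[2]=q+q^{-1}$, $[0]_s=1$ and $[k]_s=q^{k-1}s+q^{-(k-1)}s^{-1}$ for $k\ge 1$. Let $n\ge 0$ and assume $[k]_s\ne 0$ for $1\le k\le n$ (for example $K=\mathbb{C}(q,s)$ with $q,s$ indeterminates). The Temperley–Lieb algebra $\mathcal{TL}^B_m$ of type $B$ is the unital $K$-algebra generated by $e_0,\dots,e_{m-1}$ with the relations $e_0^2=-[1]_s e_0$, $e_i^2=-[2]e_i$ for $i\ge 1$, $e_1e_0e_1=(qs^{-1}+q^{-1}s)e_1$, $e_ie_je_i=e_i$ for $i,j\ge1$, $|i-j|=1$, and $e_ie_j=e_je_i$ for $|i-j|>1$. An $m$-strand diagram of type $B$ is a planar (non-crossing) pairing of $m$ bottom and $m$ top points, regarded as a pairing of $2m$ points on a line after folding the top line down to the right; each arc carries at most one dot, and only outer-most arcs (of the folded diagram) may carry a dot. Elements of $\mathcal{TL}^B_m$ are expanded in these diagrams: $1$ is the diagram of $m$ vertical strands, $e_0$ is $1$ with a dot on the left-most strand, $e_i$ ($i\ge1$) has a cup and a cap at the points $i,i+1$, and in a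 product $e_iD$ the diagram $e_i$ is put on top of $D$, where a closed loop without dot is replaced by the factor $-[2]$, a closed loop with one dot by $qs^{-1}+q^{-1}s$, and two dots on an arc by $-[1]_s$ times one dot. The type $B$ projections are given by $Q^{(0)}=1$ and $$Q^{(m+1)}=Q^{(m)}+\frac{[m]_s}{[m+1]_s}\,Q^{(m)}e_mQ^{(m)} .$$ Let $D$ be an $n$-strand diagram of type $B$, and let $\mu$ be the Dyck path of size $n$ obtained from the folded diagram by forgetting the dots and writing an up step at the left end and a down step at the right end of each arc. A Dyck tile is a set of unit boxes (squares rotated by $45^\circ$) whose centers are the lattice points of a translated Dyck path; its size $m$ is the size of that path (so it has $2m+1$ boxes), and $h(d)$ is the minimal height of the centers of the boxes of a tile $d$, where the paths start at height $0$. Let $\mathcal{D}(\mu)$ be the set of cover-inclusive Dyck tilings of the region above $\mu$ and below $U^nR^n$, i.e. tilings by Dyck tiles such that the translate of each tile by $(0,-2)$ is strictly below $\mu$ or contained in another tile. For an arc (cap) $c$ of the folded diagram joining the points $i<j$ (numbered $1,\dots,2n$) let $l(c)=(j-i+1)/2$; a box is above $c$ if the abscissa of its center lies in $[i-1,j]$.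 Then the coefficient of $D$ in $Q^{(n)}$ is $$\mathrm{Coeff}^{(n)}_B(D)=Z^B(\mu):=\Big(\frac{1}{[1]_s}\Big)^{N(\bullet)}\;\sideset{}{'}\sum_{T\in\mathcal{D}(\mu)}\;\prod_{d\in T}\frac{[h(d)]_s}{[h(d)+1]_s},$$ where $N(\bullet)$ is the number of dots of $D$ and the restricted sum is over those tilings $T$ for which there are no dotted cap $c$ and no tile of $T$ such that the part of the tile above $c$ is a Dyck tile of size $l(c)$. -/

import Mathlib

/-- The quantity `[n]_s`: `1` for `n = 0` and `q ^ (n - 1) * s + q ^ (-(n - 1)) * s ^ (-1)`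
for `n ≥ 1`. -/
def qIntS {K : Type*} [Field K] (q s : K) : ℕ → K
  | 0 => 1
  | n + 1 => q ^ n * s + (q ^ n)⁻¹ * s⁻¹

/-- An `n`-strand Temperley--Lieb diagram of type `B`, folded down to the right: the `2 * n` marked
points are put on a line, the bottom points `1, …, n` (from left to right) being the positions
`0, …, n - 1` and the top points `1, …, n` the positions `2 * n - 1, …, n`. The strands are a
non-crossing perfect matching of the positions (`partner`); each strand carries at most one dot
(`dot i` says that the strand through `i` is dotted), and only outer-most strands may be dotted. -/
@[ext]
structure TLBDiagram (n : ℕ) where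
  partner : Fin (2 * n) → Fin (2 * n)
  dot : Fin (2 * n) → Bool
  partner_partner : ∀ i, partner (partner i) = i
  partner_ne : ∀ i, partner i ≠ i
  noncrossing : ∀ i j, ¬ (i < j ∧ j < partner i ∧ partner i < partner j)
  dot_partner : ∀ i, dot (partner i) = dot i
  dot_outer : ∀ i, dot i = true →
    ∀ j, ¬ (j < i ∧ j < partner i ∧ i < partner j ∧ partner i < partner j)

namespace TLBDiagram

/-- The identity diagram: `n` vertical strands without dots. -/
def identity (n : ℕ) : TLBDiagram n where
  partner := Fin.rev
  dot := fun _ => false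
  partner_partner := Fin.rev_rev
  partner_ne := by
    intro i h
    have := congrArg Fin.val h
    simp only [Fin.val_rev] at this
    omega
  noncrossing := by
    intro i j h
    simp only [Fin.lt_def, Fin.val_rev] at h
    omega
  dot_partner := fun _ => rfl
  dot_outer := by simp

/-- The matching after a cap-cup pair at the adjacent positions `x`, `y` has been stacked onto a
diagram with matching `p`: `x` and `y` are joined by a new strand and their old partners are joined to each other. -/
def joinPartner {m : ℕ} (x y : Fin m) (p : Fin m → Fin m) (k : Fin m) : Fin m :=
  if k = x then y else if k = y then x
  else if k = p x then p y
  else if k = p y then p x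
  else p k

/-- The dots after a cap-cup pair at the adjacent positions `x`, `y` has been stacked onto a
diagram with matching `p` and dots `d`: the new strand has no dot, the glued strand has one if one of its parts had one. -/
def joinDot {m : ℕ} (x y : Fin m) (p : Fin m → Fin m) (d : Fin m → Bool) (k : Fin m) : Bool :=
  if k = x ∨ k = y then false
  else if k = p x ∨ k = p y then d x || d y
  else d k

set_option linter.unusedSimpArgs false in
set_option maxHeartbeats 2000000 in
theorem joinPartner_noncrossing {n : ℕ} (x y : Fin (2 * n)) (hxy : x.val + 1 = y.val)
    (D : TLBDiagram n) (i j : Fin (2 * n)) :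
    ¬ (i < j ∧ j < joinPartner x y D.partner i ∧
      joinPartner x y D.partner i < joinPartner x y D.partner j) := by
  have h1 := D.partner_partner
  have h2 := D.partner_ne
  have h3 := D.noncrossing
  have hlt : x < y := by rw [Fin.lt_def]; omega
  have hadj : ∀ k : Fin (2 * n), k < x ∨ k = x ∨ k = y ∨ y < k := by
    intro k; simp only [Fin.lt_def, Fin.ext_iff]; omega
  have key : ∀ i z, ¬ (i < z ∧ z < D.partner i ∧ D.partner i < D.partner z) ∧
      ¬ (i < D.partner z ∧ D.partner z < D.partner i ∧ D.partner i < z) ∧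
      ¬ (z < i ∧ i < D.partner z ∧ D.partner z < D.partner i) ∧
      ¬ (D.partner z < i ∧ i < z ∧ z < D.partner i) ∧
      ¬ (D.partner i < z ∧ z < i ∧ i < D.partner z) ∧
      ¬ (D.partner i < D.partner z ∧ D.partner z < i ∧ i < z) ∧
      ¬ (z < D.partner i ∧ D.partner i < D.partner z ∧ D.partner z < i) ∧
      ¬ (D.partner z < D.partner i ∧ D.partner i < z ∧ z < i) := by
    intro i z
    have k1 := h3 i (D.partner z)
    have k2 := h3 (D.partner z) i
    have k3 := h3 (D.partner i) z
    have k4 := h3 (D.partner i) (D.partner z)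
    have k5 := h3 z (D.partner i)
    have k6 := h3 (D.partner z) (D.partner i)
    rw [h1] at k1 k2 k3 k5
    rw [h1, h1] at k4 k6
    exact ⟨h3 i z, k1, h3 z i, k2, k3, k4, k5, k6⟩
  unfold joinPartner
  intro hij
  have := hadj i
  have := hadj j
  have := hadj (D.partner i)
  have := hadj (D.partner j)
  have := hadj (D.partner x)
  have := hadj (D.partner y)
  have := h1 i
  have := h1 j
  have := h1 x
  have := h1 y
  have := h2 i
  have := h2 j
  have := h2 x
  have := h2 y
  have := h3 i j
  have := key i x
  have := key i y
  have := key j x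
  have := key j y
  have := key x y
  clear h1 h2 h3 hadj key
  by_cases hi1 : i = x <;> by_cases hi2 : i = y <;> by_cases hi3 : i = D.partner x <;>
    by_cases hi4 : i = D.partner y <;> by_cases hj1 : j = x <;> by_cases hj2 : j = y <;>
    by_cases hj3 : j = D.partner x <;> by_cases hj4 : j = D.partner y <;>
    simp only [hi1, hi2, hi3, hi4, hj1, hj2, hj3, hj4, if_true, if_false] at hij <;> grind

set_option linter.unusedSimpArgs false in
set_option maxHeartbeats 2000000 in
theorem joinDot_outer {n : ℕ} (x y : Fin (2 * n)) (hxy : x.val + 1 = y.val)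
    (D : TLBDiagram n) (i : Fin (2 * n)) (hdi : joinDot x y D.partner D.dot i = true)
    (j : Fin (2 * n)) :
    ¬ (j < i ∧ j < joinPartner x y D.partner i ∧ i < joinPartner x y D.partner j ∧
      joinPartner x y D.partner i < joinPartner x y D.partner j) := by
  have h1 := D.partner_partner
  have h2 := D.partner_ne
  have h3 := D.noncrossing
  have hlt : x < y := by rw [Fin.lt_def]; omega
  have hadj : ∀ k : Fin (2 * n), k < x ∨ k = x ∨ k = y ∨ y < k := by
    intro k; simp only [Fin.lt_def, Fin.ext_iff]; omega
  have key : ∀ i z, ¬ (i < z ∧ z < D.partner i ∧ D.partner i < D.partner z) ∧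
      ¬ (i < D.partner z ∧ D.partner z < D.partner i ∧ D.partner i < z) ∧
      ¬ (z < i ∧ i < D.partner z ∧ D.partner z < D.partner i) ∧
      ¬ (D.partner z < i ∧ i < z ∧ z < D.partner i) ∧
      ¬ (D.partner i < z ∧ z < i ∧ i < D.partner z) ∧
      ¬ (D.partner i < D.partner z ∧ D.partner z < i ∧ i < z) ∧
      ¬ (z < D.partner i ∧ D.partner i < D.partner z ∧ D.partner z < i) ∧
      ¬ (D.partner z < D.partner i ∧ D.partner i < z ∧ z < i) := by
    intro i z
    have k1 := h3 i (D.partner z)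
    have k2 := h3 (D.partner z) i
    have k3 := h3 (D.partner i) z
    have k4 := h3 (D.partner i) (D.partner z)
    have k5 := h3 z (D.partner i)
    have k6 := h3 (D.partner z) (D.partner i)
    rw [h1] at k1 k2 k3 k5
    rw [h1, h1] at k4 k6
    exact ⟨h3 i z, k1, h3 z i, k2, k3, k4, k5, k6⟩
  have d1 := D.dot_partner
  have d2 : ∀ i z, D.dot i = true →
      ¬ (z < i ∧ z < D.partner i ∧ i < D.partner z ∧ D.partner i < D.partner z) ∧
      ¬ (D.partner z < i ∧ D.partner z < D.partner i ∧ i < z ∧ D.partner i < z) := by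
    intro i z hi
    refine ⟨D.dot_outer i hi z, ?_⟩
    have := D.dot_outer i hi (D.partner z); rwa [h1] at this
  have := d1 i
  have := d1 x
  have := d1 y
  have := d2 i j
  have := d2 i x
  have := d2 i y
  have := d2 x j
  have := d2 y j
  have := d2 x y
  have := d2 y x
  clear d1 d2
  unfold joinPartner
  unfold joinDot at hdi
  intro hij
  have := hadj i
  have := hadj j
  have := hadj (D.partner i)
  have := hadj (D.partner j)
  have := hadj (D.partner x)
  have := hadj (D.partner y)
  have := h1 i
  have := h1 j
  have := h1 x
  have := h1 y
  have := h2 i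
  have := h2 j
  have := h2 x
  have := h2 y
  have := h3 i j
  have := key i x
  have := key i y
  have := key j x
  have := key j y
  have := key x y
  clear h1 h2 h3 hadj key
  by_cases hi1 : i = x <;> by_cases hi2 : i = y <;> by_cases hi3 : i = D.partner x <;>
    by_cases hi4 : i = D.partner y <;> by_cases hj1 : j = x <;> by_cases hj2 : j = y <;>
    by_cases hj3 : j = D.partner x <;> by_cases hj4 : j = D.partner y <;>
    simp only [hi1, hi2, hi3, hi4, hj1, hj2, hj3, hj4, if_true, if_false, true_or, or_true,
      or_self, Bool.or_eq_true, Bool.false_eq_true] at hij hdi <;> grind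

/-- The diagram obtained by stacking a cap-cup pair at the adjacent positions `x`, `y = x + 1`
onto `D`, after a closed loop (if any) has been removed and two dots on a strand have been
replaced by one. -/
def join {n : ℕ} (x y : Fin (2 * n)) (hxy : x.val + 1 = y.val) (D : TLBDiagram n) :
    TLBDiagram n where
  partner := joinPartner x y D.partner
  dot := joinDot x y D.partner D.dot
  partner_partner := by
    have h1 := D.partner_partner
    have h2 := D.partner_ne
    have : x ≠ y := by intro h; rw [h] at hxy; omega
    unfold joinPartner
    intro i; grind
  partner_ne := by
    have h1 := D.partner_partner
    have h2 := D.partner_ne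
    have : x ≠ y := by intro h; rw [h] at hxy; omega
    unfold joinPartner
    intro i; grind
  noncrossing := joinPartner_noncrossing x y hxy D
  dot_partner := by
    have h1 := D.partner_partner
    have h2 := D.partner_ne
    have h3 := D.dot_partner
    have : x ≠ y := by intro h; rw [h] at hxy; omega
    unfold joinPartner joinDot
    intro i; grind
  dot_outer := joinDot_outer x y hxy D

/-- The factor that is split off when a cap-cup pair is stacked onto `D` at `x`, `y`: `-[2]` for a
closed loop without dot, `q s⁻¹ + q⁻¹ s` for a closed loop with a dot, and `-[1]_s` for two dots on
the same strand. -/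
def joinScalar {K : Type*} [Field K] (q s : K) {n : ℕ} (x y : Fin (2 * n)) (D : TLBDiagram n) : K :=
  if D.partner x = y then
    if D.dot x = true then q * s⁻¹ + q⁻¹ * s else -(q + q⁻¹)
  else if D.dot x = true ∧ D.dot y = true then -qIntS q s 1 else 1

/-- The diagram obtained by stacking a dot onto the strand of `D` that ends at the last position,
that is, at the left-most top point; two dots on the strand are replaced by one. -/
def addDot {n : ℕ} (x : Fin (2 * n)) (hx : x.val + 1 = 2 * n) (D : TLBDiagram n) :
    TLBDiagram n where
  partner := D.partner
  dot := fun k => if k = x ∨ k = D.partner x then true else D.dot k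
  partner_partner := D.partner_partner
  partner_ne := D.partner_ne
  noncrossing := D.noncrossing
  dot_partner := by
    have h1 := D.partner_partner
    have h3 := D.dot_partner
    intro i; grind
  dot_outer := by
    have h1 := D.partner_partner
    have h3 := D.dot_outer
    intro i hi j hj
    have h4 : ∀ k : Fin (2 * n), k ≤ x := fun k => by rw [Fin.le_def]; omega
    grind

/-- The factor that is split off when a dot is stacked onto `D` at `x`: `-[1]_s` for two dots on
the same strand. -/
def addDotScalar {K : Type*} [Field K] (q s : K) {n : ℕ} (x : Fin (2 * n)) (D : TLBDiagram n) : K :=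
  if D.dot x = true then -qIntS q s 1 else 1

/-- The diagram (without its factor) of the product `e_i D`, where `e_i` is placed on top of `D`.
Here `e_0` is a dot on the left-most strand and `e_i`, `1 ≤ i ≤ n - 1`, is a cap-cup pair at the
points `i`, `i + 1`; the top points `i`, `i + 1` are the positions `2 * n - i`, `2 * n - 1 - i`. -/
def genMul {n : ℕ} (i : Fin n) (D : TLBDiagram n) : TLBDiagram n :=
  if h : i.val = 0 then D.addDot ⟨2 * n - 1, by omega⟩ (by simp only; omega)
  else D.join ⟨2 * n - 1 - i.val, by omega⟩ ⟨2 * n - i.val, by omega⟩ (by simp only; omega)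

/-- The factor of the product `e_i D`, so that `e_i D = genScalar q s i D • genMul i D`. -/
def genScalar {K : Type*} [Field K] (q s : K) {n : ℕ} (i : Fin n) (D : TLBDiagram n) : K :=
  if h : i.val = 0 then D.addDotScalar q s ⟨2 * n - 1, by omega⟩
  else D.joinScalar q s ⟨2 * n - 1 - i.val, by omega⟩ ⟨2 * n - i.val, by omega⟩

section relations

variable {K : Type*} [Field K] (q s : K) {n : ℕ}

theorem join_join_comm (x y z w : Fin (2 * n)) (hxy : x.val + 1 = y.val) (hzw : z.val + 1 = w.val)
    (hyz : y < z) (D : TLBDiagram n) :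
    (D.join x y hxy).join z w hzw = (D.join z w hzw).join x y hxy := by
  have h1 := D.partner_partner
  have h2 := D.partner_ne
  have h3 := D.dot_partner
  have : x < y := by rw [Fin.lt_def]; omega
  have : z < w := by rw [Fin.lt_def]; omega
  have e1 : x ≠ y := by order
  have e2 : x ≠ z := by order
  have e3 : x ≠ w := by order
  have e4 : y ≠ z := by order
  have e5 : y ≠ w := by order
  have e6 : z ≠ w := by order
  apply TLBDiagram.ext <;> funext k
  · simp only [join, joinPartner]
    grind (splits := 40)
  · simp only [join, joinDot, joinPartner]
    grind (splits := 40)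

theorem join_join_comm_scalar (x y z w : Fin (2 * n)) (hxy : x.val + 1 = y.val)
    (hzw : z.val + 1 = w.val) (hyz : y < z) (D : TLBDiagram n) :
    D.joinScalar q s x y * (D.join x y hxy).joinScalar q s z w =
      D.joinScalar q s z w * (D.join z w hzw).joinScalar q s x y := by
  have h1 := D.partner_partner
  have h2 := D.partner_ne
  have h3 := D.dot_partner
  have : x < y := by rw [Fin.lt_def]; omega
  have : z < w := by rw [Fin.lt_def]; omega
  have e1 : x ≠ y := by order
  have e2 : x ≠ z := by order
  have e3 : x ≠ w := by order
  have e4 : y ≠ z := by order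
  have e5 : y ≠ w := by order
  have e6 : z ≠ w := by order
  simp only [join, joinDot, joinScalar, joinPartner]
  generalize q * s⁻¹ + q⁻¹ * s = A
  generalize -(q+q⁻¹) = B
  generalize - qIntS q s 1 = C
  grind (splits := 40)

theorem join_braid (x y z w x' y' : Fin (2 * n)) (hxy : x.val + 1 = y.val) (hzw : z.val + 1 = w.val)
    (hx : x' = x) (hy : y' = y)
    (h : y = z ∨ w = x) (D : TLBDiagram n) (hxy' : x'.val + 1 = y'.val) :
    ((D.join x y hxy).join z w hzw).join x' y' hxy' = D.join x y hxy := by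
  subst hx hy
  have h1 := D.partner_partner
  have h2 := D.partner_ne
  have h3 := D.dot_partner
  have e1 : x' ≠ y' := by rintro rfl; omega
  have e2 : z ≠ w := by rintro rfl; omega
  have e3 : x' ≠ z := by rintro rfl; rcases h with rfl | rfl <;> omega
  have e4 : w ≠ y' := by rintro rfl; rcases h with rfl | rfl <;> omega
  apply TLBDiagram.ext <;> funext k
  · simp only [join, joinPartner]
    grind (splits := 40)
  · simp only [join, joinDot, joinPartner]
    grind (splits := 40)

theorem join_braid_scalar (x y z w : Fin (2 * n)) (hxy : x.val + 1 = y.val)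
    (hzw : z.val + 1 = w.val) (h : y = z ∨ w = x) (D : TLBDiagram n) :
    (D.join x y hxy).joinScalar q s z w *
      ((D.join x y hxy).join z w hzw).joinScalar q s x y = 1 := by
  have h1 := D.partner_partner
  have h2 := D.partner_ne
  have h3 := D.dot_partner
  have e1 : x ≠ y := by rintro rfl; omega
  have e2 : z ≠ w := by rintro rfl; omega
  have e3 : x ≠ z := by rintro rfl; rcases h with rfl | rfl <;> omega
  have e4 : w ≠ y := by rintro rfl; rcases h with rfl | rfl <;> omega
  simp only [join, joinDot, joinScalar, joinPartner]
  generalize q * s⁻¹ + q⁻¹ * s = A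
  generalize -(q+q⁻¹) = B
  generalize - qIntS q s 1 = C
  grind (splits := 40)

theorem join_join_self (x y : Fin (2 * n)) (hxy : x.val + 1 = y.val) (D : TLBDiagram n) :
    (D.join x y hxy).join x y hxy = D.join x y hxy := by
  have h1 := D.partner_partner
  have h2 := D.partner_ne
  have e1 : x ≠ y := by rintro rfl; omega
  apply TLBDiagram.ext <;> funext k
  · simp only [join, joinPartner]
    grind (splits := 40)
  · simp only [join, joinDot, joinPartner]
    grind (splits := 40)

theorem join_join_self_scalar (x y : Fin (2 * n)) (hxy : x.val + 1 = y.val) (D : TLBDiagram n) :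
    (D.join x y hxy).joinScalar q s x y = -(q + q⁻¹) := by
  have e1 : x ≠ y := by rintro rfl; omega
  simp [join, joinDot, joinScalar, joinPartner]

theorem addDot_addDot (x : Fin (2 * n)) (hx : x.val + 1 = 2 * n) (D : TLBDiagram n) :
    (D.addDot x hx).addDot x hx = D.addDot x hx := by
  apply TLBDiagram.ext <;> funext k
  · simp only [addDot]
  · simp only [addDot]
    grind

theorem addDot_addDot_scalar (x : Fin (2 * n)) (hx : x.val + 1 = 2 * n) (D : TLBDiagram n) :
    (D.addDot x hx).addDotScalar q s x = -qIntS q s 1 := by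
  simp [addDot, addDotScalar]

theorem join_addDot_join (x y : Fin (2 * n)) (hxy : x.val + 1 = y.val) (hy : y.val + 1 = 2 * n)
    (D : TLBDiagram n) :
    ((D.join x y hxy).addDot y hy).join x y hxy = D.join x y hxy := by
  have h1 := D.partner_partner
  have h2 := D.partner_ne
  have e1 : x ≠ y := by rintro rfl; omega
  apply TLBDiagram.ext <;> funext k
  · simp only [join, addDot, joinPartner]
    grind (splits := 40)
  · simp only [join, addDot, joinDot, joinPartner]
    grind (splits := 40)

theorem join_addDot_join_scalar (x y : Fin (2 * n)) (hxy : x.val + 1 = y.val)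
    (hy : y.val + 1 = 2 * n) (D : TLBDiagram n) :
    (D.join x y hxy).addDotScalar q s y *
      ((D.join x y hxy).addDot y hy).joinScalar q s x y = q * s⁻¹ + q⁻¹ * s := by
  have e1 : x ≠ y := by rintro rfl; omega
  simp [join, addDot, joinDot, joinScalar, addDotScalar, joinPartner, e1.symm]

theorem addDot_join_comm (x y z : Fin (2 * n)) (hxy : x.val + 1 = y.val) (hz : z.val + 1 = 2 * n)
    (hyz : y < z) (D : TLBDiagram n) :
    (D.join x y hxy).addDot z hz = (D.addDot z hz).join x y hxy := by
  have h1 := D.partner_partner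
  have h2 := D.partner_ne
  have h3 := D.dot_partner
  have e1 : x ≠ y := by rintro rfl; omega
  have e2 : x ≠ z := by rintro rfl; rw [Fin.lt_def] at hyz; omega
  have e3 : y ≠ z := by order
  apply TLBDiagram.ext <;> funext k
  · simp only [join, addDot, joinPartner]
  · simp only [join, addDot, joinDot, joinPartner]
    grind (splits := 40)

theorem addDot_join_comm_scalar (x y z : Fin (2 * n)) (hxy : x.val + 1 = y.val)
    (hz : z.val + 1 = 2 * n) (hyz : y < z) (D : TLBDiagram n) :
    D.joinScalar q s x y * (D.join x y hxy).addDotScalar q s z =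
      D.addDotScalar q s z * (D.addDot z hz).joinScalar q s x y := by
  have h1 := D.partner_partner
  have h2 := D.partner_ne
  have h3 := D.dot_partner
  have e1 : x ≠ y := by rintro rfl; omega
  have e2 : x ≠ z := by rintro rfl; rw [Fin.lt_def] at hyz; omega
  have e3 : y ≠ z := by order
  simp only [join, addDot, joinDot, joinScalar, addDotScalar]
  generalize q * s⁻¹ + q⁻¹ * s = A
  generalize -(q+q⁻¹) = B
  generalize - qIntS q s 1 = C
  grind (splits := 40)

end relations

end TLBDiagram

/-- The defining relations of the Temperley--Lieb algebra of type `B` with generators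
`e_0, …, e_{n-1}`. -/
inductive TLBRel {K : Type*} [Field K] (q s : K) (n : ℕ) :
    FreeAlgebra K (Fin n) → FreeAlgebra K (Fin n) → Prop
  | dot_sq (i : Fin n) (hi : i.val = 0) :
      TLBRel q s n (FreeAlgebra.ι K i * FreeAlgebra.ι K i) (-qIntS q s 1 • FreeAlgebra.ι K i)
  | loop (i : Fin n) (hi : 1 ≤ i.val) :
      TLBRel q s n (FreeAlgebra.ι K i * FreeAlgebra.ι K i) (-(q + q⁻¹) • FreeAlgebra.ι K i)
  | dotted_loop (i j : Fin n) (hi : i.val = 0) (hj : j.val = 1) :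
      TLBRel q s n (FreeAlgebra.ι K j * FreeAlgebra.ι K i * FreeAlgebra.ι K j)
        ((q * s⁻¹ + q⁻¹ * s) • FreeAlgebra.ι K j)
  | braid (i j : Fin n) (hi : 1 ≤ i.val) (hj : 1 ≤ j.val)
      (hij : i.val + 1 = j.val ∨ j.val + 1 = i.val) :
      TLBRel q s n (FreeAlgebra.ι K i * FreeAlgebra.ι K j * FreeAlgebra.ι K i) (FreeAlgebra.ι K i)
  | comm (i j : Fin n) (hij : i.val + 1 < j.val) :
      TLBRel q s n (FreeAlgebra.ι K i * FreeAlgebra.ι K j) (FreeAlgebra.ι K j * FreeAlgebra.ι K i)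

/-- The Temperley--Lieb algebra of type `B` on `n` strands. -/
abbrev TLB {K : Type*} [Field K] (q s : K) (n : ℕ) : Type _ := RingQuot (TLBRel q s n)

namespace TLB

variable {K : Type*} [Field K] (q s : K)

/-- The generator `e_i`, `0 ≤ i ≤ n - 1`. -/
noncomputable def e {n : ℕ} (i : Fin n) : TLB q s n :=
  RingQuot.mkAlgHom K (TLBRel q s n) (FreeAlgebra.ι K i)

/-- The map from the `n`-strand algebra to the `(n + 1)`-strand algebra with `e_i ↦ e_i`. -/
noncomputable def incl (n : ℕ) : TLB q s n →ₐ[K] TLB q s (n + 1) :=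
  RingQuot.liftAlgHom K ⟨FreeAlgebra.lift K fun i => e q s i.castSucc, by
    intro a b h
    have key : ∀ {a b : FreeAlgebra K (Fin (n + 1))}, TLBRel q s (n + 1) a b →
        RingQuot.mkAlgHom K (TLBRel q s (n + 1)) a = RingQuot.mkAlgHom K (TLBRel q s (n + 1)) b :=
      fun h => RingQuot.mkAlgHom_rel K h
    cases h with
    | dot_sq i hi => simpa [e] using key (.dot_sq i.castSucc hi)
    | loop i hi => simpa [e] using key (.loop i.castSucc hi)
    | dotted_loop i j hi hj => simpa [e] using key (.dotted_loop i.castSucc j.castSucc hi hj)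
    | braid i j hi hj hij => simpa [e] using key (.braid i.castSucc j.castSucc hi hj hij)
    | comm i j hij => simpa [e] using key (.comm i.castSucc j.castSucc hij)⟩

/-- The type `B` Jones--Wenzl projection `Q^{(n)}`. -/
noncomputable def Q : (n : ℕ) → TLB q s n
  | 0 => 1
  | n + 1 => incl q s n (Q n) + (qIntS q s n / qIntS q s (n + 1)) •
      (incl q s n (Q n) * e q s (Fin.last n) * incl q s n (Q n))

/-- The operator `D ↦ e_i D` on linear combinations of diagrams. -/
noncomputable def genOp {n : ℕ} (i : Fin n) : Module.End K (TLBDiagram n →₀ K) :=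
  Finsupp.linearCombination K fun D =>
    Finsupp.single (TLBDiagram.genMul i D) (TLBDiagram.genScalar q s i D)

theorem genOp_single {n : ℕ} (i : Fin n) (D : TLBDiagram n) (c : K) :
    genOp q s i (Finsupp.single D c) =
      Finsupp.single (TLBDiagram.genMul i D) (c * TLBDiagram.genScalar q s i D) := by
  simp [genOp]

open TLBDiagram in
theorem genOp_rel {n : ℕ} (a b : FreeAlgebra K (Fin n)) (h : TLBRel q s n a b) :
    FreeAlgebra.lift K (genOp q s) a = FreeAlgebra.lift K (genOp q s) b := by
  cases h with
  | dot_sq i hi =>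
    refine Finsupp.lhom_ext fun D c => ?_
    simp only [map_mul, map_smul, FreeAlgebra.lift_ι_apply, Module.End.mul_apply, genOp_single,
      LinearMap.smul_apply, Finsupp.smul_single, smul_eq_mul, genMul, genScalar, hi, dif_pos,
      addDot_addDot, addDot_addDot_scalar]
    congr 1; ring
  | loop i hi =>
    have hi' : ¬ i.val = 0 := by omega
    refine Finsupp.lhom_ext fun D c => ?_
    simp only [map_mul, map_smul, FreeAlgebra.lift_ι_apply, Module.End.mul_apply, genOp_single,
      LinearMap.smul_apply, Finsupp.smul_single, smul_eq_mul, genMul, genScalar, hi', dif_neg,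
      not_false_eq_true, join_join_self, join_join_self_scalar]
    congr 1; ring
  | dotted_loop i j hi hj =>
    have hj' : ¬ j.val = 0 := by omega
    refine Finsupp.lhom_ext fun D c => ?_
    have E : (⟨2 * n - 1, by omega⟩ : Fin (2 * n)) = ⟨2 * n - j.val, by omega⟩ := by simp [hj]
    simp only [map_mul, map_smul, FreeAlgebra.lift_ι_apply, Module.End.mul_apply, genOp_single,
      LinearMap.smul_apply, Finsupp.smul_single, smul_eq_mul, genMul, genScalar, hi, hj', dif_neg,
      not_false_eq_true, dif_pos, E, join_addDot_join, mul_assoc, join_addDot_join_scalar]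
    congr 1; ring
  | braid i j hi hj hij =>
    have hi' : ¬ i.val = 0 := by omega
    have hj' : ¬ j.val = 0 := by omega
    refine Finsupp.lhom_ext fun D c => ?_
    simp only [map_mul, FreeAlgebra.lift_ι_apply, Module.End.mul_apply, genOp_single,
      genMul, genScalar, hi', hj', dif_neg, not_false_eq_true]
    rw [join_braid _ _ _ _ _ _ _ _ rfl rfl (by simp only [Fin.mk.injEq]; omega), mul_assoc,
      join_braid_scalar _ _ _ _ _ _ _ _ (by simp only [Fin.mk.injEq]; omega), mul_one]
  | comm i j hij =>
    have hj' : ¬ j.val = 0 := by omega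
    refine Finsupp.lhom_ext fun D c => ?_
    by_cases hi : i.val = 0
    · simp only [map_mul, FreeAlgebra.lift_ι_apply, Module.End.mul_apply, genOp_single,
        genMul, genScalar, hi, hj', dif_neg, dif_pos, not_false_eq_true]
      rw [addDot_join_comm _ _ _ _ _ (by rw [Fin.lt_def]; simp only; omega), mul_assoc, mul_assoc,
        addDot_join_comm_scalar _ _ _ _ _ _ _ (by rw [Fin.lt_def]; simp only; omega)]
    · simp only [map_mul, FreeAlgebra.lift_ι_apply, Module.End.mul_apply, genOp_single,
        genMul, genScalar, hi, hj', dif_neg, not_false_eq_true]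
      rw [join_join_comm _ _ _ _ _ _ (by rw [Fin.lt_def]; simp only; omega), mul_assoc, mul_assoc,
        join_join_comm_scalar _ _ _ _ _ _ _ _ (by rw [Fin.lt_def]; simp only; omega)]

/-- The diagrammatic representation: `TLB q s n` acts on linear combinations of diagrams by
stacking from above. -/
noncomputable def diagRep (n : ℕ) : TLB q s n →ₐ[K] Module.End K (TLBDiagram n →₀ K) :=
  RingQuot.liftAlgHom K ⟨FreeAlgebra.lift K (genOp q s), fun a b h => genOp_rel q s a b h⟩

/-- The expansion of `a` as a linear combination of diagrams: the product of `a` and the identity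
diagram. -/
noncomputable def toDiagrams {n : ℕ} (a : TLB q s n) : TLBDiagram n →₀ K :=
  diagRep q s n a (Finsupp.single (TLBDiagram.identity n) 1)

/-- The coefficient of the diagram `D` in `Q^{(n)}`. -/
noncomputable def coeffB {n : ℕ} (D : TLBDiagram n) : K := toDiagrams q s (Q q s n) D

end TLB

namespace TLBDiagram

variable {n : ℕ}

/-- The step at position `i` of the Dyck path of `D`: up at the left end of a strand of the folded
diagram, down at the right end. -/
def step (D : TLBDiagram n) (i : Fin (2 * n)) : DyckStep :=
  if i < D.partner i then DyckStep.U else DyckStep.D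

theorem count_take_step (D : TLBDiagram n) (a : DyckStep) (k : ℕ) :
    ((List.ofFn D.step).take k).count a =
      (Finset.univ.filter fun i : Fin (2 * n) => i.val < k ∧ D.step i = a).card := by
  induction k with
  | zero => simp
  | succ k ih =>
    by_cases hk : k < 2 * n
    · rw [List.take_succ_eq_append_getElem (by simpa using hk), List.count_append, ih,
        List.getElem_ofFn, List.count_singleton]
      by_cases ha : D.step ⟨k, hk⟩ = a
      · have : (Finset.univ.filter fun i : Fin (2 * n) => i.val < k + 1 ∧ D.step i = a) =
            insert ⟨k, hk⟩
              (Finset.univ.filter fun i : Fin (2 * n) => i.val < k ∧ D.step i = a) := by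
          ext i
          simp only [Finset.mem_filter, Finset.mem_univ, true_and, Finset.mem_insert, Fin.ext_iff]
          constructor
          · rintro ⟨h, h'⟩
            by_cases hik : i.val = k
            · exact Or.inl hik
            · exact Or.inr ⟨by omega, h'⟩
          · rintro (h | ⟨h, h'⟩)
            · have : i = ⟨k, hk⟩ := Fin.ext h
              exact ⟨by omega, this ▸ ha⟩
            · exact ⟨by omega, h'⟩
        rw [this, Finset.card_insert_of_notMem (by simp)]
        simp [ha]
      · simp only [beq_iff_eq, ha, if_false, add_zero]
        congr 1
        ext i
        simp only [Finset.mem_filter, Finset.mem_univ, true_and]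
        constructor
        · rintro ⟨h, h'⟩
          exact ⟨by omega, h'⟩
        · rintro ⟨h, h'⟩
          refine ⟨?_, h'⟩
          by_contra hik
          exact ha ((Fin.ext (by simp only; omega) : (⟨k, hk⟩ : Fin (2 * n)) = i) ▸ h')
    · rw [List.take_of_length_le (by simp only [List.length_ofFn]; omega)]
      rw [List.take_of_length_le (by simp only [List.length_ofFn]; omega)] at ih
      rw [ih]
      congr 1
      ext i
      simp only [Finset.mem_filter, Finset.mem_univ, true_and]
      constructor <;> rintro ⟨_, h⟩ <;> exact ⟨by omega, h⟩

theorem step_partner_eq_D (D : TLBDiagram n) (i : Fin (2 * n)) :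
    D.step (D.partner i) = DyckStep.D ↔ D.step i = DyckStep.U := by
  have h1 := D.partner_partner i
  have h2 := D.partner_ne i
  unfold step
  rw [h1]
  rcases lt_or_gt_of_ne h2 with h | h <;> simp [h, not_lt.mpr h.le]

/-- The Dyck path of the folded diagram with its dots removed. -/
def dyckPath (D : TLBDiagram n) : DyckWord where
  toList := List.ofFn D.step
  count_U_eq_count_D := by
    have hU := D.count_take_step DyckStep.U (2 * n)
    have hD := D.count_take_step DyckStep.D (2 * n)
    rw [List.take_of_length_le (by simp)] at hU hD
    rw [hU, hD]
    refine Finset.card_bij (fun i _ => D.partner i) ?_ ?_ ?_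
    · intro i hi
      simp only [Finset.mem_filter, Finset.mem_univ, true_and] at hi ⊢
      exact ⟨by omega, (D.step_partner_eq_D i).2 hi.2⟩
    · intro i _ j _ h
      rw [← D.partner_partner i, h, D.partner_partner]
    · intro i hi
      simp only [Finset.mem_filter, Finset.mem_univ, true_and] at hi
      refine ⟨D.partner i, ?_, D.partner_partner i⟩
      simp only [Finset.mem_filter, Finset.mem_univ, true_and]
      refine ⟨by omega, (D.step_partner_eq_D _).1 ?_⟩
      rw [D.partner_partner]
      exact hi.2
  count_D_le_count_U k := by
    rw [count_take_step, count_take_step]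
    refine Finset.card_le_card_of_injOn D.partner ?_ ?_
    · intro i hi
      simp only [Finset.coe_filter, Finset.mem_univ, true_and, Set.mem_ofPred_eq] at hi ⊢
      have hs : D.step (D.partner i) = DyckStep.U := by
        rw [← D.step_partner_eq_D, D.partner_partner]
        exact hi.2
      refine ⟨?_, hs⟩
      have : D.partner i < D.partner (D.partner i) := by
        by_contra h
        simp [step, h] at hs
      rw [D.partner_partner, Fin.lt_def] at this
      omega
    · intro i _ j _ h
      rw [← D.partner_partner i, h, D.partner_partner]

end TLBDiagram

/-- The height of a Dyck path after `k` steps. -/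
def DyckWord.heightAt (w : DyckWord) (k : ℕ) : ℤ :=
  ((w.toList.take k).count DyckStep.U : ℤ) - ((w.toList.take k).count DyckStep.D : ℤ)

open Classical in
/-- The centres of the unit boxes of the region above the Dyck path `w` (of size `n`) and below the
top path `U^n R^n`, whose height at `x` is `min x (2 * n - x)`. The unit box with centre `(x, y)`,
`x + y` odd, has the corners `(x ± 1, y)` and `(x, y ± 1)`. -/
noncomputable def dyckRegion (n : ℕ) (w : DyckWord) : Finset (ℤ × ℤ) :=
  (Finset.Icc (0 : ℤ) (2 * n) ×ˢ Finset.Icc (0 : ℤ) n).filter fun b =>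
    Odd (b.1 + b.2) ∧ w.heightAt b.1.toNat ≤ b.2 - 1 ∧ b.2 + 1 ≤ min b.1 (2 * n - b.1)

/-- `d`, given by the centres of its unit boxes, is a Dyck tile of size `m`: the centres are the
lattice points of a (translated) Dyck path of size `m`. -/
def IsDyckTile (m : ℕ) (d : Finset (ℤ × ℤ)) : Prop :=
  ∃ (w : DyckWord) (x y : ℤ), w.semilength = m ∧
    d = (Finset.range (2 * m + 1)).image fun k : ℕ => (x + (k : ℤ), y + w.heightAt k)

/-- The height `h(d)` of a tile: the minimal height of the centre of one of its boxes. -/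
noncomputable def tileHeight (d : Finset (ℤ × ℤ)) : ℕ :=
  sInf {h : ℕ | ∃ b ∈ d, b.2 = (h : ℤ)}

/-- The translate of a tile by `(0, -2)`. -/
def tileDown (d : Finset (ℤ × ℤ)) : Finset (ℤ × ℤ) :=
  d.image fun b => (b.1, b.2 - 2)

/-- `T` is a cover-inclusive Dyck tiling of the region above `w` and below `U^n R^n`: its tiles are
Dyck tiles, pairwise disjoint, with the region as their union, and the translate of a tile by
`(0, -2)` lies strictly below `w` or is contained in a tile. -/
structure IsCoverInclusiveDyckTiling (n : ℕ) (w : DyckWord) (T : Finset (Finset (ℤ × ℤ))) :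
    Prop where
  isDyckTile : ∀ d ∈ T, ∃ m, IsDyckTile m d
  disjoint : ∀ d ∈ T, ∀ d' ∈ T, d ≠ d' → Disjoint d d'
  cover : ∀ b, b ∈ dyckRegion n w ↔ ∃ d ∈ T, b ∈ d
  coverInclusive : ∀ d ∈ T,
    (∀ b ∈ tileDown d, b.2 + 1 ≤ w.heightAt b.1.toNat) ∨ ∃ d' ∈ T, tileDown d ⊆ d'

open Classical in
/-- The finite set of all cover-inclusive Dyck tilings above `w` and below `U^n R^n`. -/
noncomputable def dyckTilings (n : ℕ) (w : DyckWord) : Finset (Finset (Finset (ℤ × ℤ))) :=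
  (dyckRegion n w).powerset.powerset.filter (IsCoverInclusiveDyckTiling n w)

namespace TLBDiagram

variable {n : ℕ}

/-- The left ends of the dotted caps of the folded diagram. -/
def dottedCaps (D : TLBDiagram n) : Finset (Fin (2 * n)) :=
  Finset.univ.filter fun i => D.dot i = true ∧ i < D.partner i

/-- The size `l(c) = (j - i + 1) / 2` of the cap `c` with left end `i` and right end `j`. -/
def capSize (D : TLBDiagram n) (i : Fin (2 * n)) : ℕ :=
  ((D.partner i).val - i.val + 1) / 2

/-- The box with centre `b` is above the cap with left end `i` (and right end `D.partner i`); the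
part of the Dyck path that belongs to this cap runs from `x = i` to `x = D.partner i + 1`, as
positions are counted from `0`. -/
def IsAboveCap (D : TLBDiagram n) (i : Fin (2 * n)) (b : ℤ × ℤ) : Prop :=
  (i.val : ℤ) ≤ b.1 ∧ b.1 ≤ ((D.partner i).val : ℤ) + 1

/-- The tiling `T` contributes to the restricted sum: there is no dotted cap `c` and no tile of `T`
whose part above `c` is a Dyck tile of size `l(c)`. -/
def Admissible (D : TLBDiagram n) (T : Finset (Finset (ℤ × ℤ))) : Prop :=
  ∀ i ∈ D.dottedCaps, ∀ d ∈ T, ∀ e : Finset (ℤ × ℤ),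
    (∀ b, b ∈ e ↔ b ∈ d ∧ D.IsAboveCap i b) → ¬ IsDyckTile (D.capSize i) e

open Classical in
/-- The generating function `Z^B` of the Dyck path of `D`, with the restriction coming from the
dotted caps of `D`. -/
noncomputable def ZB {K : Type*} [Field K] (q s : K) (D : TLBDiagram n) : K :=
  (1 / qIntS q s 1) ^ D.dottedCaps.card *
    ∑ T ∈ (dyckTilings n D.dyckPath).filter D.Admissible,
      ∏ d ∈ T, qIntS q s (tileHeight d) / qIntS q s (tileHeight d + 1)

end TLBDiagram

/-!
Both sides of the theorem are generating functions of the same labelings of the arcs of the folded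
diagram, divided by `[1]_s ⋯ [n]_s`.

*Labelings.* Let `ups x` and `downs x` be the numbers of left and right ends of arcs among the first
`x` positions, and `height x = ups x - downs x` the height of the Dyck path. A labeling
(`TLBDiagram.IsLabeling`) attaches a natural number to every arc, weakly decreasing from an arc to
the arcs around it, and bounded by the number of boxes of the region above the ends of the arc. The
labelings in question vanish on dotted arcs, and the weight is the product of
`[b + 1 + 2 f]_s` over the undotted arcs, `b` being the height of the ends of the arc and `f` its
label.

*Tilings.* In a cover-inclusive Dyck tiling every tile is a vertical translate of a part of the Dyck
path that is itself a Dyck path, so all its boxes have the same level `l` above the path, and the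
tiling is known once one knows, for every arc, the number `f` of levels at which the steps under
this arc are joined in a tile (`IsCoverInclusiveDyckTiling.exists_labeling`). Cover-inclusiveness
says that the levels at which an arc is joined are `0, …, f - 1`, and the Dyck condition says that
`f` is monotone. The restriction for a dotted arc says that it is never joined
(`IsLabeling.admissible_tiling`). The weight of the tiling is the product of `[h]_s / [h + 1]_s`
over the left-most boxes of the tiles; the product over the other boxes telescopes along every arc
to `[b + 1]_s / [b + 1 + 2 f]_s`, and the product over the whole region is evaluated by pairing
neighbouring abscissas (`TLBDiagram.prod_region`), which uses that every arc has exactly one end at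
an even position. This gives `TLBDiagram.ZB_eq_labelingSum`.

*Coefficients.* The projections are idempotent, which yields the single clasp expansion
`Q^{(n + 1)} = (1 + ∑ k, [k]_s / [n + 1]_s e_k e_{k + 1} ⋯ e_n) Q^{(n)}`. On diagrams,
`e_k ⋯ e_n` inserts an innermost cap with its left end at the position `2 n + 1 - k` (for `k = 0`, a
dotted one at the right end), so the coefficient of `D` is a weighted sum of coefficients of the
diagrams in which an innermost cap of `D`, not left of the middle, is removed
(`TLB.toDiagrams_Q_succ`). The generating function of the labelings obeys the same recursion
(`TLBDiagram.labelingSum_succ`): for every labeling there is a left-most such cap whose label is as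
large as the diagram to the right permits, its factor is `[k]_s` for the `k` above, and removing it
is a bijection onto the labelings of the smaller diagram. A dotted cap, having label `0`, is full
only at the right end, which matches the term `k = 0`.
-/

/-! ### The projections in an abstract algebra -/

section Clasp

variable {K : Type*} [Field K] (q s : K) {A : Type*} [Ring A] [Algebra K A] (a : ℕ → A)

/-- The elements `a 0, …, a (n - 1)` of an algebra satisfy those relations of the Temperley--Lieb
algebra of type `B` that make the recursively defined projections idempotent. -/
structure SatisfiesTLB (n : ℕ) : Prop where
  dot_sq : 0 < n → a 0 * a 0 = -qIntS q s 1 • a 0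
  loop : ∀ i, 1 ≤ i → i < n → a i * a i = -(q + q⁻¹) • a i
  dotted_loop : 1 < n → a 1 * a 0 * a 1 = (q * s⁻¹ + q⁻¹ * s) • a 1
  braid : ∀ i, 1 ≤ i → i + 1 < n → a (i + 1) * a i * a (i + 1) = a (i + 1)
  comm : ∀ i j, i + 1 < j → j < n → a i * a j = a j * a i

/-- The recursion of the type `B` projections, for an arbitrary sequence `a` in place of the
generators. -/
def clasp : ℕ → A
  | 0 => 1
  | m + 1 => clasp m + (qIntS q s m / qIntS q s (m + 1)) • (clasp m * a m * clasp m)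

/-- The element `1 + ∑ k < m, ([k]_s / [m]_s) a_k a_{k+1} ⋯ a_{m-1}`, given recursively. -/
def spread : ℕ → A
  | 0 => 1
  | m + 1 => 1 + (qIntS q s m / qIntS q s (m + 1)) • (spread m * a m)

variable {q s a} {n : ℕ}

theorem qIntS_one_mul (hq : q ≠ 0) (hs : s ≠ 0) :
    (q + q⁻¹) * qIntS q s 1 = qIntS q s 2 + (q * s⁻¹ + q⁻¹ * s) := by
  simp only [qIntS]
  field_simp
  ring

theorem qIntS_succ_mul (hq : q ≠ 0) (hs : s ≠ 0) (m : ℕ) :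
    (q + q⁻¹) * qIntS q s (m + 2) = qIntS q s (m + 3) + qIntS q s (m + 1) := by
  simp only [qIntS]
  field_simp
  ring

theorem commute_clasp (ha : SatisfiesTLB q s a n) {j : ℕ} (hj : j < n) :
    ∀ m < j, Commute (clasp q s a m) (a j)
  | 0, _ => Commute.one_left _
  | m + 1, h => by
    have h1 := commute_clasp ha hj m (by omega)
    have h2 : Commute (a m) (a j) := ha.comm m j h hj
    exact h1.add_left (((h1.mul_left h2).mul_left h1).smul_left _)

theorem clasp_mul_clasp_succ {m : ℕ} (h : clasp q s a m * clasp q s a m = clasp q s a m) :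
    clasp q s a m * clasp q s a (m + 1) = clasp q s a (m + 1) := by
  simp only [clasp, mul_add, mul_smul_comm, ← mul_assoc, h]

theorem clasp_succ_mul_clasp {m : ℕ} (h : clasp q s a m * clasp q s a m = clasp q s a m) :
    clasp q s a (m + 1) * clasp q s a m = clasp q s a (m + 1) := by
  simp only [clasp, add_mul, smul_mul_assoc, mul_assoc, h]

/-- The partial trace of a projection is a multiple of the previous projection. -/
theorem sandwich_clasp (hq : q ≠ 0) (hs : s ≠ 0) (ha : SatisfiesTLB q s a n) {m : ℕ}
    (hm : m + 1 < n) (hne : qIntS q s (m + 1) ≠ 0)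
    (h : clasp q s a m * clasp q s a m = clasp q s a m) :
    a (m + 1) * clasp q s a (m + 1) * a (m + 1) =
      -(qIntS q s (m + 2) / qIntS q s (m + 1)) • (clasp q s a m * a (m + 1)) := by
  have hc : a (m + 1) * clasp q s a m = clasp q s a m * a (m + 1) :=
    (commute_clasp ha hm m (by omega)).symm
  have h1 : a (m + 1) * clasp q s a (m + 1) * a (m + 1) =
      clasp q s a m * (a (m + 1) * a (m + 1)) +
      (qIntS q s m / qIntS q s (m + 1)) •
        (clasp q s a m * (a (m + 1) * a m * a (m + 1)) * clasp q s a m) := by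
    simp only [clasp, mul_add, add_mul, mul_smul_comm, smul_mul_assoc]
    refine congrArg₂ _ ?_ (congrArg _ ?_)
    · rw [hc, mul_assoc]
    · rw [← mul_assoc, ← mul_assoc, hc]
      simp only [mul_assoc]
      rw [← hc]
  rw [h1, ha.loop _ (by omega) hm]
  rcases m with _ | m
  · rw [ha.dotted_loop hm]
    simp only [clasp, one_mul, mul_one, zero_add, smul_smul, ← add_smul]
    congr 1
    have := qIntS_one_mul hq hs
    have h0 : qIntS q s 0 = 1 := rfl
    generalize q + q⁻¹ = t at *
    generalize q * s⁻¹ + q⁻¹ * s = t' at *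
    simp only [zero_add] at hne ⊢
    rw [h0]
    field_simp
    linear_combination -this
  · rw [ha.braid _ (by omega) hm, mul_assoc (clasp q s a (m + 1)), hc, ← mul_assoc, h]
    simp only [mul_smul_comm, ← add_smul]
    congr 1
    have := qIntS_succ_mul hq hs m
    rw [show m + 1 + 1 = m + 2 by omega, show m + 1 + 2 = m + 3 by omega] at *
    generalize q + q⁻¹ = t at *
    field_simp
    linear_combination -this

theorem clasp_mul_clasp (hq : q ≠ 0) (hs : s ≠ 0) (ha : SatisfiesTLB q s a n)
    (hqs : ∀ k : ℕ, 1 ≤ k → k ≤ n → qIntS q s k ≠ 0) :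
    ∀ m ≤ n, clasp q s a m * clasp q s a m = clasp q s a m
  | 0, _ => mul_one _
  | 1, hm => by
    have h1 := hqs 1 le_rfl hm
    simp only [clasp, mul_add, add_mul, one_mul, mul_one, smul_mul_smul_comm, ha.dot_sq hm,
      smul_smul, zero_add, add_assoc]
    congr 1
    rw [← add_smul, ← add_smul]
    congr 1
    simp only [show qIntS q s 0 = 1 from rfl]
    field_simp
    ring
  | m + 2, hm => by
    have h0 := clasp_mul_clasp hq hs ha hqs m (by omega)
    have h := clasp_mul_clasp hq hs ha hqs (m + 1) (by omega)
    have h1 := hqs (m + 1) (by omega) (by omega)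
    have h2 := hqs (m + 2) (by omega) hm
    have hsw := sandwich_clasp hq hs ha (by omega) h1 h0
    have hP := clasp_succ_mul_clasp h0
    rw [show clasp q s a (m + 2) = clasp q s a (m + 1) + (qIntS q s (m + 1) / qIntS q s (m + 2)) •
      (clasp q s a (m + 1) * a (m + 1) * clasp q s a (m + 1)) from rfl]
    generalize clasp q s a (m + 1) = P at *
    generalize a (m + 1) = b at *
    have h3 : P * b * P * (P * b * P) =
        -(qIntS q s (m + 2) / qIntS q s (m + 1)) • (P * b * P) := by
      calc P * b * P * (P * b * P) = P * (b * (P * P) * b) * P := by simp only [mul_assoc]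
        _ = _ := by rw [h, hsw, mul_smul_comm, smul_mul_assoc, ← mul_assoc, hP]
    have h4 : P * (P * b * P) = P * b * P := by rw [← mul_assoc, ← mul_assoc, h]
    have h5 : P * b * P * P = P * b * P := by rw [mul_assoc, h]
    simp only [mul_add, add_mul, mul_smul_comm, smul_mul_assoc, h, h3, h4, h5, smul_smul,
      smul_add, add_assoc]
    congr 1
    rw [← add_smul, ← add_smul]
    congr 1
    field_simp
    ring

/-- The single clasp expansion: one of the two factors `Q^{(m)}` in the recursion of `Q^{(m + 1)}`
can be replaced by a short sum of products of generators. -/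
theorem clasp_succ_eq_spread_mul (hq : q ≠ 0) (hs : s ≠ 0) (ha : SatisfiesTLB q s a n)
    (hqs : ∀ k : ℕ, 1 ≤ k → k ≤ n → qIntS q s k ≠ 0) :
    ∀ m < n, clasp q s a (m + 1) = spread q s a (m + 1) * clasp q s a m
  | 0, _ => by simp [clasp, spread]
  | m + 1, hm => by
    have h0 := clasp_mul_clasp hq hs ha hqs m (by omega)
    have h1 := clasp_succ_eq_spread_mul hq hs ha hqs m (by omega)
    have hc : clasp q s a m * a (m + 1) = a (m + 1) * clasp q s a m :=
      commute_clasp ha hm m (by omega)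
    have h2 := clasp_mul_clasp_succ h0
    have h3 : clasp q s a (m + 1) * a (m + 1) * clasp q s a (m + 1) =
        spread q s a (m + 1) * a (m + 1) * clasp q s a (m + 1) := by
      conv_lhs => rw [h1]
      rw [mul_assoc (spread q s a (m + 1)), hc, mul_assoc, mul_assoc, ← h1, h2, mul_assoc]
    rw [show clasp q s a (m + 1 + 1) = clasp q s a (m + 1) +
      (qIntS q s (m + 1) / qIntS q s (m + 1 + 1)) •
      (clasp q s a (m + 1) * a (m + 1) * clasp q s a (m + 1)) from rfl, h3]
    rw [show spread q s a (m + 1 + 1) = 1 + (qIntS q s (m + 1) / qIntS q s (m + 1 + 1)) •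
      (spread q s a (m + 1) * a (m + 1)) from rfl, add_mul, one_mul, smul_mul_assoc]

theorem map_Q_eq_clasp : ∀ {m : ℕ} (φ : TLB q s m →ₐ[K] A),
    (∀ i : Fin m, φ (TLB.e q s i) = a i) → φ (TLB.Q q s m) = clasp q s a m
  | 0, φ, _ => by simp [TLB.Q, clasp]
  | m + 1, φ, h => by
    have h1 := map_Q_eq_clasp (φ.comp (TLB.incl q s m)) (fun i => by
      simpa [TLB.incl, TLB.e] using h i.castSucc)
    have h2 := h (Fin.last m)
    simp only [AlgHom.comp_apply, Fin.val_last] at h1 h2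
    simp [TLB.Q, clasp, h1, h2]

end Clasp

namespace TLB

variable {K : Type*} [Field K] (q s : K)

/-- The operators `genOp`, indexed by natural numbers. -/
noncomputable def genSeq (n : ℕ) (i : ℕ) : Module.End K (TLBDiagram n →₀ K) :=
  if h : i < n then genOp q s ⟨i, h⟩ else 0

theorem satisfiesTLB_genSeq (n : ℕ) : SatisfiesTLB q s (genSeq q s n) n := by
  have key {a b : FreeAlgebra K (Fin n)} (h : TLBRel q s n a b) := genOp_rel q s a b h
  constructor
  · intro h
    have := key (.dot_sq ⟨0, h⟩ rfl)
    simp only [map_mul, map_smul, FreeAlgebra.lift_ι_apply] at this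
    simpa only [genSeq, h, dif_pos] using this
  · intro i hi h
    simpa [genSeq, h] using key (.loop ⟨i, h⟩ hi)
  · intro h
    simpa [genSeq, h, show 0 < n by omega] using key (.dotted_loop ⟨0, by omega⟩ ⟨1, h⟩ rfl rfl)
  · intro i hi h
    simpa [genSeq, h, show i < n by omega] using
      key (.braid ⟨i + 1, h⟩ ⟨i, by omega⟩ (by simp) hi (Or.inr rfl))
  · intro i j hij h
    simpa [genSeq, h, show i < n by omega] using key (.comm ⟨i, by omega⟩ ⟨j, h⟩ hij)

theorem toDiagrams_Q (n : ℕ) : toDiagrams q s (Q q s n) =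
    clasp q s (genSeq q s n) n (Finsupp.single (TLBDiagram.identity n) 1) := by
  rw [toDiagrams, map_Q_eq_clasp (a := genSeq q s n)]
  intro i
  simp [diagRep, e, genSeq]

end TLB

/-! ### Insertion of a cap into a folded diagram -/

namespace TLBDiagram

variable {n : ℕ}

/-- The left end of a cap that is inserted in front of the position `x`. -/
def capLeft (x : Fin (2 * n + 1)) : Fin (2 * (n + 1)) := ⟨x, by omega⟩

/-- The right end of a cap that is inserted in front of the position `x`. -/
def capRight (x : Fin (2 * n + 1)) : Fin (2 * (n + 1)) := ⟨x + 1, by omega⟩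

/-- The new position of `i` after a cap has been inserted in front of the position `x`. -/
def skip (x : Fin (2 * n + 1)) (i : Fin (2 * n)) : Fin (2 * (n + 1)) :=
  ⟨if i.val < x.val then i.val else i.val + 2, by split <;> omega⟩

/-- The inverse of `skip x`, defined away from the inserted cap. -/
def unskip (x : Fin (2 * n + 1)) (k : Fin (2 * (n + 1))) (hl : k ≠ capLeft x)
    (hr : k ≠ capRight x) : Fin (2 * n) :=
  ⟨if k.val < x.val then k.val else k.val - 2, by
    simp only [capLeft, capRight, ne_eq, Fin.ext_iff] at hl hr
    split <;> omega⟩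

variable (x : Fin (2 * n + 1))

theorem capLeft_ne_capRight : capLeft x ≠ capRight x := by
  simp [capLeft, capRight]

theorem skip_lt_skip {i j : Fin (2 * n)} : skip x i < skip x j ↔ i < j := by
  simp only [skip, Fin.lt_def]
  split_ifs <;> omega

theorem skip_injective : Function.Injective (skip x) := by
  intro i j h
  simp only [skip, Fin.ext_iff] at h ⊢
  split at h <;> split at h <;> omega

theorem skip_ne_capLeft (i : Fin (2 * n)) : skip x i ≠ capLeft x := by
  simp only [skip, capLeft, ne_eq, Fin.ext_iff]
  split <;> omega

theorem skip_ne_capRight (i : Fin (2 * n)) : skip x i ≠ capRight x := by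
  simp only [skip, capRight, ne_eq, Fin.ext_iff]
  split <;> omega

theorem skip_unskip (k : Fin (2 * (n + 1))) (hl : k ≠ capLeft x) (hr : k ≠ capRight x) :
    skip x (unskip x k hl hr) = k := by
  simp only [capLeft, capRight, ne_eq, Fin.ext_iff] at hl hr
  simp only [skip, unskip, Fin.ext_iff]
  split_ifs <;> omega

theorem unskip_skip (i : Fin (2 * n)) :
    unskip x (skip x i) (skip_ne_capLeft x i) (skip_ne_capRight x i) = i :=
  skip_injective x (skip_unskip x _ _ _)

theorem eq_cap_or_skip (k : Fin (2 * (n + 1))) :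
    k = capLeft x ∨ k = capRight x ∨ ∃ i, k = skip x i := by
  by_cases hl : k = capLeft x
  · exact Or.inl hl
  by_cases hr : k = capRight x
  · exact Or.inr (Or.inl hr)
  exact Or.inr (Or.inr ⟨unskip x k hl hr, (skip_unskip x k hl hr).symm⟩)

theorem skip_lt_capLeft {i : Fin (2 * n)} : skip x i < capLeft x ↔ i.val < x.val := by
  simp only [skip, capLeft, Fin.lt_def]
  split <;> omega

theorem skip_lt_capRight {i : Fin (2 * n)} : skip x i < capRight x ↔ i.val < x.val := by
  simp only [skip, capRight, Fin.lt_def]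
  split <;> omega

theorem capLeft_lt_skip {i : Fin (2 * n)} : capLeft x < skip x i ↔ x.val ≤ i.val := by
  simp only [skip, capLeft, Fin.lt_def]
  split <;> omega

theorem capRight_lt_skip {i : Fin (2 * n)} : capRight x < skip x i ↔ x.val ≤ i.val := by
  simp only [skip, capRight, Fin.lt_def]
  split <;> omega

theorem capLeft_lt_capRight : capLeft x < capRight x := by
  simp [capLeft, capRight, Fin.lt_def]

@[to_additive]
theorem prod_eq_cap_mul_prod_skip {M : Type*} [CommMonoid M] (g : Fin (2 * (n + 1)) → M) :
    ∏ k, g k = g (capLeft x) * g (capRight x) * ∏ i, g (skip x i) := by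
  have h : (Finset.univ : Finset (Fin (2 * (n + 1)))) =
      insert (capLeft x) (insert (capRight x) (Finset.univ.image (skip x))) := by
    ext k
    simp only [Finset.mem_univ, Finset.mem_insert, Finset.mem_image, true_and, true_iff]
    rcases eq_cap_or_skip x k with h | h | ⟨i, h⟩
    · exact Or.inl h
    · exact Or.inr (Or.inl h)
    · exact Or.inr (Or.inr ⟨i, h.symm⟩)
  rw [h, Finset.prod_insert, Finset.prod_insert, Finset.prod_image, mul_assoc]
  · exact fun i _ j _ hij => skip_injective x hij
  · simp [skip_ne_capRight]
  · simp [skip_ne_capLeft, capLeft_ne_capRight]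

/-- The diagram with a cap without dot inserted in front of the position `x` of `D`. -/
def ins (D : TLBDiagram n) : TLBDiagram (n + 1) where
  partner k :=
    if hl : k = capLeft x then capRight x else if hr : k = capRight x then capLeft x
    else skip x (D.partner (unskip x k hl hr))
  dot k :=
    if hl : k = capLeft x then false else if hr : k = capRight x then false
    else D.dot (unskip x k hl hr)
  partner_partner k := by
    rcases eq_cap_or_skip x k with rfl | rfl | ⟨i, rfl⟩ <;>
      simp [(capLeft_ne_capRight x).symm, skip_ne_capLeft, skip_ne_capRight, unskip_skip,
        D.partner_partner]
  partner_ne k := by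
    rcases eq_cap_or_skip x k with rfl | rfl | ⟨i, rfl⟩ <;>
      simp [(capLeft_ne_capRight x).symm, capLeft_ne_capRight, skip_ne_capLeft, skip_ne_capRight,
        unskip_skip, (skip_injective x).eq_iff, D.partner_ne]
  noncrossing k l := by
    have := D.noncrossing
    rcases eq_cap_or_skip x k with rfl | rfl | ⟨i, rfl⟩ <;>
    rcases eq_cap_or_skip x l with rfl | rfl | ⟨j, rfl⟩ <;>
      simp only [dif_pos, (capLeft_ne_capRight x).symm, skip_ne_capLeft,
        skip_ne_capRight, unskip_skip, skip_lt_skip, dif_neg, not_false_eq_true,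
        skip_lt_capLeft, skip_lt_capRight, capLeft_lt_skip, capRight_lt_skip, lt_self_iff_false] <;>
      first
        | exact this _ _
        | omega
        | simp
  dot_partner k := by
    rcases eq_cap_or_skip x k with rfl | rfl | ⟨i, rfl⟩ <;>
      simp [(capLeft_ne_capRight x).symm, skip_ne_capLeft, skip_ne_capRight, unskip_skip,
        D.dot_partner]
  dot_outer k hk l := by
    have := D.dot_outer
    rcases eq_cap_or_skip x k with rfl | rfl | ⟨i, rfl⟩
    · simp at hk
    · simp at hk
    · simp only [dif_neg, not_false_eq_true, skip_ne_capLeft, skip_ne_capRight,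
        unskip_skip] at hk
      have := this i hk
      rcases eq_cap_or_skip x l with rfl | rfl | ⟨j, rfl⟩ <;>
      simp only [dif_pos, (capLeft_ne_capRight x).symm, skip_ne_capLeft,
        skip_ne_capRight, unskip_skip, skip_lt_skip, dif_neg, not_false_eq_true,
        skip_lt_capLeft, skip_lt_capRight, capLeft_lt_skip, capRight_lt_skip] <;>
      first | exact this _ | omega

variable (D : TLBDiagram n)

@[simp] theorem ins_partner_capLeft : (ins x D).partner (capLeft x) = capRight x := by
  simp [ins]

@[simp] theorem ins_partner_capRight : (ins x D).partner (capRight x) = capLeft x := by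
  simp [ins, (capLeft_ne_capRight x).symm]

@[simp] theorem ins_partner_skip (i : Fin (2 * n)) :
    (ins x D).partner (skip x i) = skip x (D.partner i) := by
  simp [ins, skip_ne_capLeft, skip_ne_capRight, unskip_skip]

@[simp] theorem ins_dot_capLeft : (ins x D).dot (capLeft x) = false := by
  simp [ins]

@[simp] theorem ins_dot_capRight : (ins x D).dot (capRight x) = false := by
  simp [ins]

@[simp] theorem ins_dot_skip (i : Fin (2 * n)) : (ins x D).dot (skip x i) = D.dot i := by
  simp [ins, skip_ne_capLeft, skip_ne_capRight, unskip_skip]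

theorem ins_injective : Function.Injective (ins x) := by
  intro D E h
  apply TLBDiagram.ext <;> funext i
  · apply skip_injective x
    rw [← ins_partner_skip, h, ins_partner_skip]
  · rw [← ins_dot_skip x, h, ins_dot_skip]

/-- A diagram is determined by its values at an inserted cap and away from it. -/
theorem ext_skip {E F : TLBDiagram (n + 1)} (h1 : E.partner (capLeft x) = F.partner (capLeft x))
    (h2 : E.partner (capRight x) = F.partner (capRight x))
    (h3 : ∀ i, E.partner (skip x i) = F.partner (skip x i))
    (h4 : E.dot (capLeft x) = F.dot (capLeft x)) (h5 : E.dot (capRight x) = F.dot (capRight x))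
    (h6 : ∀ i, E.dot (skip x i) = F.dot (skip x i)) : E = F := by
  apply TLBDiagram.ext <;> funext k <;> rcases eq_cap_or_skip x k with rfl | rfl | ⟨i, rfl⟩ <;>
    simp [*]

/-- The diagram with an innermost cap removed. -/
def del (E : TLBDiagram (n + 1)) (hE : E.partner (capLeft x) = capRight x) : TLBDiagram n :=
  have hE' : E.partner (capRight x) = capLeft x := by rw [← hE, E.partner_partner]
  have hl : ∀ i, E.partner (skip x i) ≠ capLeft x := fun i h =>
    skip_ne_capRight x i (by rw [← hE, ← h, E.partner_partner])
  have hr : ∀ i, E.partner (skip x i) ≠ capRight x := fun i h =>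
    skip_ne_capLeft x i (by rw [← hE', ← h, E.partner_partner])
  { partner := fun i => unskip x (E.partner (skip x i)) (hl i) (hr i)
    dot := fun i => E.dot (skip x i)
    partner_partner := fun i => skip_injective x (by simp [skip_unskip, E.partner_partner])
    partner_ne := fun i h => E.partner_ne (skip x i) (by
      rw [← skip_unskip x _ (hl i) (hr i), h])
    noncrossing := fun i j => by
      simpa only [← skip_lt_skip x, skip_unskip] using E.noncrossing (skip x i) (skip x j)
    dot_partner := fun i => by
      simp only [skip_unskip, E.dot_partner]
    dot_outer := fun i hi j => by
      simpa only [← skip_lt_skip x, skip_unskip] using E.dot_outer (skip x i) hi (skip x j) }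

theorem ins_del (E : TLBDiagram (n + 1)) (hE : E.partner (capLeft x) = capRight x)
    (hd : E.dot (capLeft x) = false) : ins x (del x E hE) = E := by
  have hE' : E.partner (capRight x) = capLeft x := by rw [← hE, E.partner_partner]
  apply ext_skip x <;> simp [hE, hE', hd, del, skip_unskip]
  rw [← hE, E.dot_partner, hd]

/-- The diagram with a dotted cap inserted at the right end of the line. -/
def dotIns (D : TLBDiagram n) : TLBDiagram (n + 1) :=
  (ins (Fin.last (2 * n)) D).addDot (capRight (Fin.last (2 * n))) (by simp [capRight]; omega)

theorem dotIns_partner : (dotIns D).partner = (ins (Fin.last (2 * n)) D).partner := rfl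

@[simp] theorem dotIns_dot_capLeft : (dotIns D).dot (capLeft (Fin.last (2 * n))) = true := by
  simp [dotIns, addDot]

@[simp] theorem dotIns_dot_capRight : (dotIns D).dot (capRight (Fin.last (2 * n))) = true := by
  simp [dotIns, addDot]

@[simp] theorem dotIns_dot_skip (i : Fin (2 * n)) :
    (dotIns D).dot (skip (Fin.last (2 * n)) i) = D.dot i := by
  simp [dotIns, addDot, skip_ne_capLeft, skip_ne_capRight]

theorem dotIns_injective : Function.Injective (dotIns (n := n)) := by
  intro D E h
  apply TLBDiagram.ext <;> funext i
  · apply skip_injective (Fin.last (2 * n))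
    rw [← ins_partner_skip, ← dotIns_partner, h, dotIns_partner, ins_partner_skip]
  · rw [← dotIns_dot_skip, h, dotIns_dot_skip]

theorem dotIns_del (E : TLBDiagram (n + 1))
    (hE : E.partner (capLeft (Fin.last (2 * n))) = capRight (Fin.last (2 * n)))
    (hd : E.dot (capLeft (Fin.last (2 * n))) = true) :
    dotIns (del (Fin.last (2 * n)) E hE) = E := by
  have hE' : E.partner (capRight (Fin.last (2 * n))) = capLeft (Fin.last (2 * n)) := by
    rw [← hE, E.partner_partner]
  apply ext_skip (Fin.last (2 * n)) <;> simp [hE, hE', hd, del, skip_unskip, dotIns_partner]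
  rw [← hE, E.dot_partner, hd]

/-! ### The coefficients of `Q^{(n + 1)}` in terms of those of `Q^{(n)}` -/

theorem identity_succ (n : ℕ) : identity (n + 1) = ins ⟨n, by omega⟩ (identity n) := by
  apply ext_skip ⟨n, by omega⟩
  · rw [ins_partner_capLeft]
    simp only [identity, capLeft, capRight, Fin.ext_iff, Fin.val_rev]
    omega
  · rw [ins_partner_capRight]
    simp only [identity, capLeft, capRight, Fin.ext_iff, Fin.val_rev]
    omega
  · intro i
    rw [ins_partner_skip]
    change Fin.rev (skip _ i) = skip _ (Fin.rev i)
    simp only [skip, Fin.ext_iff, Fin.val_rev]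
    split_ifs <;> omega
  all_goals simp [identity]

theorem join_ins_skip {a b : Fin (2 * n)} (hab : a.val + 1 = b.val)
    (hab' : (skip x a).val + 1 = (skip x b).val) :
    (ins x D).join (skip x a) (skip x b) hab' = ins x (D.join a b hab) := by
  apply ext_skip x <;> intros <;>
    simp [join, joinPartner, joinDot, (skip_injective x).eq_iff, (skip_ne_capLeft x _).symm,
      (skip_ne_capRight x _).symm, apply_ite (skip x)]

theorem joinScalar_ins_skip {K : Type*} [Field K] (q s : K) (a b : Fin (2 * n)) :
    (ins x D).joinScalar q s (skip x a) (skip x b) = D.joinScalar q s a b := by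
  simp [joinScalar, (skip_injective x).eq_iff]

/-- The zigzag relation: the new cap and the inserted cap are straightened. -/
theorem join_ins (y : Fin (2 * n + 1)) (hxy : x.val + 1 = y.val)
    (h : (capLeft y).val + 1 = (capRight y).val) :
    (ins x D).join (capLeft y) (capRight y) h = ins y D := by
  have hy : capLeft y = capRight x := by simp [capLeft, capRight, hxy]
  have hx : x.val < 2 * n := by omega
  have hr : capRight y = skip x ⟨x, hx⟩ := by simp [capRight, skip, ← hxy]
  have hl : capLeft x = skip y ⟨x, hx⟩ := by simp [capLeft, skip, ← hxy]
  have hs : ∀ i : Fin (2 * n), i ≠ ⟨x, hx⟩ → skip y i = skip x i := by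
    intro i hi
    simp only [skip, Fin.ext_iff, ne_eq] at hi ⊢
    split_ifs <;> omega
  have hs' : ∀ i : Fin (2 * n), skip y i =
      if i = ⟨x, hx⟩ then capLeft x else skip x i := by
    intro i
    split_ifs with h
    · rw [h, hl]
    · exact hs i h
  have h1 := D.partner_ne
  have h2 := D.partner_partner
  have h3 := D.dot_partner
  apply ext_skip y
  · simp [join, joinPartner]
  · simp [join, joinPartner, (capLeft_ne_capRight y).symm]
  · intro i
    rw [ins_partner_skip]
    simp only [join, joinPartner, skip_ne_capLeft, skip_ne_capRight, if_false]
    rw [hy, ins_partner_capRight, hr, ins_partner_skip, hs', hs']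
    by_cases h : i = ⟨x, hx⟩
    · simp [h, h1]
    · simp only [h, if_false, skip_ne_capLeft, ins_partner_skip, (skip_injective x).eq_iff]
      grind
  · simp [join, joinDot]
  · simp [join, joinDot]
  · intro i
    rw [ins_dot_skip]
    simp only [join, joinDot, skip_ne_capLeft, skip_ne_capRight, if_false, or_self]
    rw [hy, ins_partner_capRight, hr, ins_partner_skip, hs', ins_dot_capRight, ins_dot_skip]
    by_cases h : i = ⟨x, hx⟩
    · simp [h]
    · simp only [h, if_false, skip_ne_capLeft, ins_dot_skip, (skip_injective x).eq_iff]
      grind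

theorem joinScalar_ins {K : Type*} [Field K] (q s : K) (y : Fin (2 * n + 1))
    (hxy : x.val + 1 = y.val) : (ins x D).joinScalar q s (capLeft y) (capRight y) = 1 := by
  have hy : capLeft y = capRight x := by simp [capLeft, capRight, hxy]
  have : capLeft x ≠ capRight y := by
    simp only [capLeft, capRight, ← hxy, ne_eq, Fin.ext_iff]
    omega
  simp [joinScalar, hy, this]

end TLBDiagram

namespace TLB

open TLBDiagram

variable {K : Type*} [Field K] (q s : K) {n : ℕ}

/-- The generators `e_0, …, e_{n-1}` commute with adding a vertical strand on the right, that is,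
with inserting a cap in the middle of the folded diagram. -/
theorem genSeq_castSucc_single (i : ℕ) (hi : i < n) (D : TLBDiagram n) (c : K) :
    genSeq q s (n + 1) i (Finsupp.single (ins ⟨n, by omega⟩ D) c) =
      Finsupp.mapDomain (ins ⟨n, by omega⟩) (genSeq q s n i (Finsupp.single D c)) := by
  simp only [genSeq, hi, show i < n + 1 by omega, dif_pos, genOp_single, Finsupp.mapDomain_single]
  by_cases h0 : i = 0
  · have h1 : (⟨2 * (n + 1) - 1, by omega⟩ : Fin (2 * (n + 1))) =
        skip ⟨n, by omega⟩ ⟨2 * n - 1, by omega⟩ := by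
      simp only [skip, Fin.ext_iff]; split <;> omega
    simp only [genMul, genScalar, h0, dif_pos, addDotScalar, h1, ins_dot_skip]
    congr 1
    apply ext_skip ⟨n, by omega⟩ <;> intros <;>
      simp [addDot, (skip_injective _).eq_iff, (skip_ne_capLeft _ _).symm,
        (skip_ne_capRight _ _).symm]
  · have h1 : (⟨2 * (n + 1) - 1 - i, by omega⟩ : Fin (2 * (n + 1))) =
        skip ⟨n, by omega⟩ ⟨2 * n - 1 - i, by omega⟩ := by
      simp only [skip, Fin.ext_iff]; split <;> omega
    have h2 : (⟨2 * (n + 1) - i, by omega⟩ : Fin (2 * (n + 1))) =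
        skip ⟨n, by omega⟩ ⟨2 * n - i, by omega⟩ := by
      simp only [skip, Fin.ext_iff]; split <;> omega
    simp only [genMul, genScalar, h0, dif_neg, not_false_eq_true, h1, h2, joinScalar_ins_skip]
    rw [join_ins_skip]

theorem genSeq_castSucc_mapDomain (i : ℕ) (hi : i < n) (v : TLBDiagram n →₀ K) :
    genSeq q s (n + 1) i (Finsupp.mapDomain (ins ⟨n, by omega⟩) v) =
      Finsupp.mapDomain (ins ⟨n, by omega⟩) (genSeq q s n i v) := by
  induction v using Finsupp.induction_linear with
  | zero => simp
  | add v w hv hw => simp only [Finsupp.mapDomain_add, map_add, hv, hw]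
  | single D c => rw [Finsupp.mapDomain_single, genSeq_castSucc_single q s i hi]

theorem clasp_genSeq_castSucc : ∀ m ≤ n, ∀ v : TLBDiagram n →₀ K,
    clasp q s (genSeq q s (n + 1)) m (Finsupp.mapDomain (ins ⟨n, by omega⟩) v) =
      Finsupp.mapDomain (ins ⟨n, by omega⟩) (clasp q s (genSeq q s n) m v)
  | 0, _, v => by simp [clasp]
  | m + 1, hm, v => by
    simp only [clasp, LinearMap.add_apply, LinearMap.smul_apply, Module.End.mul_apply,
      Finsupp.mapDomain_add, Finsupp.mapDomain_smul, clasp_genSeq_castSucc m (Nat.le_of_succ_le hm),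
      genSeq_castSucc_mapDomain q s m hm]

/-- The generator `e_k` moves the cap inserted at the position `2 n - k` one step to the right. -/
theorem genSeq_mapDomain_ins (k : ℕ) (hk : 1 ≤ k) (hkn : k ≤ n) (v : TLBDiagram n →₀ K) :
    genSeq q s (n + 1) k (Finsupp.mapDomain (ins ⟨2 * n - k, by omega⟩) v) =
      Finsupp.mapDomain (ins ⟨2 * n - (k - 1), by omega⟩) v := by
  induction v using Finsupp.induction_linear with
  | zero => simp
  | add v w hv hw => simp only [Finsupp.mapDomain_add, map_add, hv, hw]
  | single D c =>
    have hk0 : k ≠ 0 := by omega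
    have h1 : (⟨2 * (n + 1) - 1 - k, by omega⟩ : Fin (2 * (n + 1))) =
        capLeft ⟨2 * n - (k - 1), by omega⟩ := by
      simp only [capLeft, Fin.ext_iff]; omega
    have h2 : (⟨2 * (n + 1) - k, by omega⟩ : Fin (2 * (n + 1))) =
        capRight ⟨2 * n - (k - 1), by omega⟩ := by
      simp only [capRight, Fin.ext_iff]; omega
    simp only [genSeq, show k < n + 1 by omega, dif_pos, Finsupp.mapDomain_single, genOp_single,
      genMul, genScalar, hk0, dif_neg, not_false_eq_true, h1, h2]
    rw [joinScalar_ins _ _ _ _ _ (by simp only; omega), join_ins _ _ _ (by simp only; omega),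
      mul_one]

/-- The generator `e_0` puts a dot on the cap inserted at the right end. -/
theorem genSeq_zero_mapDomain_ins (v : TLBDiagram n →₀ K) :
    genSeq q s (n + 1) 0 (Finsupp.mapDomain (ins (Fin.last (2 * n))) v) =
      Finsupp.mapDomain dotIns v := by
  induction v using Finsupp.induction_linear with
  | zero => simp
  | add v w hv hw => simp only [Finsupp.mapDomain_add, map_add, hv, hw]
  | single D c =>
    have h1 : (⟨2 * (n + 1) - 1, by omega⟩ : Fin (2 * (n + 1))) = capRight (Fin.last (2 * n)) := by
      simp only [capRight, Fin.ext_iff, Fin.val_last]; omega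
    simp only [genSeq, Nat.zero_lt_succ, dif_pos, Finsupp.mapDomain_single, genOp_single,
      genMul, genScalar, h1, addDotScalar, ins_dot_capRight, dotIns]
    simp

theorem spread_mapDomain_ins (v : TLBDiagram n →₀ K) : ∀ k ≤ n,
    (∀ j, 1 ≤ j → j ≤ k → qIntS q s j ≠ 0) →
    spread q s (genSeq q s (n + 1)) (k + 1)
        (Finsupp.mapDomain (ins ⟨2 * n - k, by omega⟩) v) =
      Finsupp.mapDomain (ins ⟨2 * n - k, by omega⟩) v + (1 / qIntS q s (k + 1)) •
        (Finsupp.mapDomain dotIns v + ∑ j ∈ Finset.range k,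
          qIntS q s (j + 1) • Finsupp.mapDomain (ins ⟨2 * n - j, by omega⟩) v)
  | 0, _, _ => by
    have := genSeq_zero_mapDomain_ins q s v
    simp only [Fin.last] at this
    simp [spread, this, qIntS]
  | k + 1, hk, hne => by
    have h0 := spread_mapDomain_ins v k (by omega) (fun j h h' => hne j h (by omega))
    have h1 := hne (k + 1) (by omega) le_rfl
    rw [spread, LinearMap.add_apply, LinearMap.smul_apply, Module.End.mul_apply,
      genSeq_mapDomain_ins q s (k + 1) (by omega) hk]
    simp only [Nat.add_sub_cancel]
    rw [h0, Module.End.one_apply, Finset.sum_range_succ]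
    congr 1
    simp only [smul_add, smul_smul]
    rw [show qIntS q s (k + 1) / qIntS q s (k + 1 + 1) * (1 / qIntS q s (k + 1)) =
        1 / qIntS q s (k + 1 + 1) by field_simp,
      show 1 / qIntS q s (k + 1 + 1) * qIntS q s (k + 1) =
        qIntS q s (k + 1) / qIntS q s (k + 1 + 1) by ring]
    abel

/-- The recursion for the coefficients of the projections: the diagrams of `Q^{(n + 1)}` arise by
inserting a cap, at the middle or to the right of it, into the diagrams of `Q^{(n)}`. -/
theorem toDiagrams_Q_succ (hq : q ≠ 0) (hs : s ≠ 0)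
    (hqs : ∀ k : ℕ, 1 ≤ k → k ≤ n + 1 → qIntS q s k ≠ 0) :
    toDiagrams q s (Q q s (n + 1)) = (1 / qIntS q s (n + 1)) •
      (Finsupp.mapDomain dotIns (toDiagrams q s (Q q s n)) + ∑ j ∈ Finset.range (n + 1),
        qIntS q s (j + 1) •
          Finsupp.mapDomain (ins ⟨2 * n - j, by omega⟩) (toDiagrams q s (Q q s n))) := by
  have h1 := hqs (n + 1) (by omega) le_rfl
  have h2 := spread_mapDomain_ins q s (toDiagrams q s (Q q s n)) n le_rfl
    (fun j h h' => hqs j h (by omega))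
  have h3 : Finsupp.single (identity (n + 1)) (1 : K) =
      Finsupp.mapDomain (ins ⟨n, by omega⟩) (Finsupp.single (identity n) 1) := by
    rw [Finsupp.mapDomain_single, identity_succ]
  rw [toDiagrams_Q q s (n + 1),
    clasp_succ_eq_spread_mul hq hs (satisfiesTLB_genSeq q s (n + 1)) hqs n (by omega),
    Module.End.mul_apply, h3, clasp_genSeq_castSucc q s n le_rfl, ← toDiagrams_Q]
  simp only [show 2 * n - n = n by omega] at h2
  rw [h2, Finset.sum_range_succ]
  simp only [smul_add, smul_smul, show 2 * n - n = n by omega]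
  rw [one_div_mul_cancel h1, one_smul]
  abel

end TLB

/-! ### Left and right ends of arcs -/

namespace TLBDiagram

variable {n : ℕ} (D : TLBDiagram n)

/-- The number of left ends of arcs among the first `x` positions. -/
def ups (x : ℕ) : ℕ := (Finset.univ.filter fun t : Fin (2 * n) => t.val < x ∧ t < D.partner t).card

/-- The number of right ends of arcs among the first `x` positions. -/
def downs (x : ℕ) : ℕ :=
  (Finset.univ.filter fun t : Fin (2 * n) => t.val < x ∧ D.partner t < t).card

theorem lt_partner_or_partner_lt (i : Fin (2 * n)) : i < D.partner i ∨ D.partner i < i :=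
  (D.partner_ne i).lt_or_gt.symm

theorem ups_zero : D.ups 0 = 0 := by simp [ups]

theorem downs_zero : D.downs 0 = 0 := by simp [downs]

theorem ups_mono {x y : ℕ} (h : x ≤ y) : D.ups x ≤ D.ups y := by
  refine Finset.card_le_card fun t ht => ?_
  simp only [Finset.mem_filter, Finset.mem_univ, true_and] at ht ⊢
  exact ⟨by omega, ht.2⟩

theorem ups_succ_of_lt {i : Fin (2 * n)} (h : i < D.partner i) :
    D.ups (i + 1) = D.ups i + 1 := by
  rw [ups, ups, ← Finset.card_insert_of_notMem (a := i) (by simp)]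
  congr 1
  ext t
  simp only [Finset.mem_filter, Finset.mem_univ, true_and, Finset.mem_insert, Fin.ext_iff]
  refine ⟨fun ⟨h1, h2⟩ => ?_, fun h1 => ?_⟩
  · by_cases hti : t.val = i.val
    · exact Or.inl hti
    · exact Or.inr ⟨by omega, h2⟩
  · rcases h1 with h1 | ⟨h1, h2⟩
    · exact ⟨by omega, by rwa [Fin.ext h1]⟩
    · exact ⟨by omega, h2⟩

theorem ups_succ_of_gt {i : Fin (2 * n)} (h : D.partner i < i) : D.ups (i + 1) = D.ups i := by
  rw [ups, ups]
  congr 1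
  ext t
  simp only [Finset.mem_filter, Finset.mem_univ, true_and]
  refine ⟨fun ⟨h1, h2⟩ => ⟨?_, h2⟩, fun ⟨h1, h2⟩ => ⟨by omega, h2⟩⟩
  by_contra hti
  rw [Fin.ext (by omega : t.val = i.val)] at h2
  exact lt_asymm h h2

theorem downs_succ_of_gt {i : Fin (2 * n)} (h : D.partner i < i) :
    D.downs (i + 1) = D.downs i + 1 := by
  rw [downs, downs, ← Finset.card_insert_of_notMem (a := i) (by simp)]
  congr 1
  ext t
  simp only [Finset.mem_filter, Finset.mem_univ, true_and, Finset.mem_insert, Fin.ext_iff]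
  refine ⟨fun ⟨h1, h2⟩ => ?_, fun h1 => ?_⟩
  · by_cases hti : t.val = i.val
    · exact Or.inl hti
    · exact Or.inr ⟨by omega, h2⟩
  · rcases h1 with h1 | ⟨h1, h2⟩
    · exact ⟨by omega, by rwa [Fin.ext h1]⟩
    · exact ⟨by omega, h2⟩

theorem downs_succ_of_lt {i : Fin (2 * n)} (h : i < D.partner i) :
    D.downs (i + 1) = D.downs i := by
  rw [downs, downs]
  congr 1
  ext t
  simp only [Finset.mem_filter, Finset.mem_univ, true_and]
  refine ⟨fun ⟨h1, h2⟩ => ⟨?_, h2⟩, fun ⟨h1, h2⟩ => ⟨by omega, h2⟩⟩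
  by_contra hti
  rw [Fin.ext (by omega : t.val = i.val)] at h2
  exact lt_asymm h h2

theorem ups_add_downs : ∀ x ≤ 2 * n, D.ups x + D.downs x = x
  | 0, _ => by simp [ups_zero, downs_zero]
  | x + 1, hx => by
    have ih := ups_add_downs x (by omega)
    rcases D.lt_partner_or_partner_lt ⟨x, hx⟩ with h | h
    · have h1 := D.ups_succ_of_lt h
      have h2 := D.downs_succ_of_lt h
      simp only at h1 h2
      omega
    · have h1 := D.ups_succ_of_gt h
      have h2 := D.downs_succ_of_gt h
      simp only at h1 h2
      omega

/-- A set of positions that is a union of arcs has as many left ends as right ends. -/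
theorem card_left_eq_card_right (P : Fin (2 * n) → Prop) [DecidablePred P]
    (hP : ∀ t, P t → P (D.partner t)) :
    (Finset.univ.filter fun t => P t ∧ t < D.partner t).card =
      (Finset.univ.filter fun t => P t ∧ D.partner t < t).card := by
  refine Finset.card_nbij' D.partner D.partner ?_ ?_ ?_ ?_
  · intro t ht
    simp only [Finset.coe_filter, Finset.mem_univ, true_and, Set.mem_ofPred_eq] at ht ⊢
    exact ⟨hP t ht.1, by rw [D.partner_partner]; exact ht.2⟩
  · intro t ht
    simp only [Finset.coe_filter, Finset.mem_univ, true_and, Set.mem_ofPred_eq] at ht ⊢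
    exact ⟨hP t ht.1, by rw [D.partner_partner]; exact ht.2⟩
  · exact fun t _ => D.partner_partner t
  · exact fun t _ => D.partner_partner t

theorem ups_two_mul : D.ups (2 * n) = n := by
  have h1 : D.ups (2 * n) = D.downs (2 * n) :=
    D.card_left_eq_card_right (fun t => t.val < 2 * n) (fun t _ => (D.partner t).isLt)
  have h2 := D.ups_add_downs _ le_rfl
  omega

theorem ups_le (x : ℕ) : D.ups x ≤ n := by
  refine le_of_le_of_eq ?_ D.ups_two_mul
  refine Finset.card_le_card fun t ht => ?_
  simp only [Finset.mem_filter, Finset.mem_univ, true_and] at ht ⊢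
  exact ⟨t.isLt, ht.2⟩

theorem downs_le_ups (x : ℕ) : D.downs x ≤ D.ups x := by
  refine Finset.card_le_card_of_injOn D.partner ?_ ?_
  · intro t ht
    simp only [Finset.coe_filter, Finset.mem_univ, true_and, Set.mem_ofPred_eq] at ht ⊢
    refine ⟨?_, by rw [D.partner_partner]; exact ht.2⟩
    have := Fin.lt_def.1 ht.2
    omega
  · intro t _ u _ h
    rw [← D.partner_partner t, h, D.partner_partner]

/-- The Dyck path has the same height at both ends of an arc. -/
theorem ups_partner_add_downs {i : Fin (2 * n)} (h : i < D.partner i) :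
    D.ups (D.partner i + 1) + D.downs i = D.downs (D.partner i + 1) + D.ups i := by
  have h1 := D.card_left_eq_card_right (fun t => i ≤ t ∧ t ≤ D.partner i) (fun t ht => by
    have := D.noncrossing i t
    have := D.noncrossing (D.partner t) i
    have := D.partner_partner
    grind)
  have key : ∀ P : Fin (2 * n) → Prop, ∀ _ : DecidablePred P,
      (Finset.univ.filter fun t : Fin (2 * n) => t.val < D.partner i + 1 ∧ P t).card =
        (Finset.univ.filter fun t : Fin (2 * n) => t.val < i ∧ P t).card +
        (Finset.univ.filter fun t : Fin (2 * n) => (i ≤ t ∧ t ≤ D.partner i) ∧ P t).card := by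
    intro P _
    rw [← Finset.card_union_of_disjoint]
    · congr 1
      ext t
      simp only [Finset.mem_filter, Finset.mem_univ, true_and, Finset.mem_union, Fin.lt_def,
        Fin.le_def] at h ⊢
      constructor
      · rintro ⟨h1, h2⟩
        by_cases hti : t.val < i.val
        · exact Or.inl ⟨hti, h2⟩
        · exact Or.inr ⟨by omega, h2⟩
      · rintro (⟨h1, h2⟩ | ⟨h1, h2⟩) <;> exact ⟨by omega, h2⟩
    · rw [Finset.disjoint_left]
      intro t h1 h2
      simp only [Finset.mem_filter, Finset.mem_univ, true_and, Fin.le_def] at h1 h2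
      omega
  have h2 := key (fun t => t < D.partner t) inferInstance
  have h3 := key (fun t => D.partner t < t) inferInstance
  simp only [ups, downs]
  omega

/-- The left end of an outer-most arc is at height `0`. -/
theorem ups_eq_downs_of_dot {i : Fin (2 * n)} (hi : D.dot i = true) (h : i < D.partner i) :
    D.ups i = D.downs i := by
  refine D.card_left_eq_card_right (fun t => t.val < i) (fun t ht => ?_)
  have h1 := D.dot_outer i hi t
  have h2 := D.noncrossing t i
  have h3 := D.partner_partner
  rw [← Fin.lt_def] at ht ⊢
  grind

theorem partner_eq_of_adjacent {i k : Fin (2 * n)} (hik : i.val + 1 = k.val)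
    (hi : i < D.partner i) (hk : D.partner k < k) : D.partner i = k := by
  have h1 := D.noncrossing (D.partner k) i
  have h2 := D.partner_partner
  rw [Fin.lt_def] at *
  simp only [Fin.lt_def, h2, not_and] at h1
  by_contra hne
  have h3 : (D.partner i).val ≠ k.val := fun h => hne (Fin.ext h)
  have h4 : (D.partner k).val ≠ i.val := fun h => hne (by rw [← Fin.ext h, h2])
  omega

section ins

variable (x : Fin (2 * n + 1))

theorem ups_ins (y : ℕ) : (ins x D).ups y = (if x.val < y then 1 else 0) +
    (Finset.univ.filter fun i : Fin (2 * n) => (skip x i).val < y ∧ i < D.partner i).card := by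
  rw [ups, Finset.card_filter, sum_eq_cap_add_sum_skip x, Finset.card_filter]
  simp only [ins_partner_capLeft, ins_partner_capRight, ins_partner_skip, skip_lt_skip,
    capLeft_lt_capRight, not_lt_of_gt, and_true, and_false, if_false, add_zero]
  rfl

theorem downs_ins (y : ℕ) : (ins x D).downs y = (if x.val + 1 < y then 1 else 0) +
    (Finset.univ.filter fun i : Fin (2 * n) => (skip x i).val < y ∧ D.partner i < i).card := by
  rw [downs, Finset.card_filter, sum_eq_cap_add_sum_skip x, Finset.card_filter]
  simp only [ins_partner_capLeft, ins_partner_capRight, ins_partner_skip, skip_lt_skip,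
    capLeft_lt_capRight, not_lt_of_gt, and_true, and_false, if_false, zero_add]
  rfl

theorem skip_val_lt_of_le {y : ℕ} (hy : y ≤ x + 1) (i : Fin (2 * n)) :
    (skip x i).val < y ↔ i.val < y ∧ i.val < x.val := by
  simp only [skip]
  split_ifs <;> omega

theorem skip_val_lt_add_two {y : ℕ} (hy : x.val ≤ y) (i : Fin (2 * n)) :
    (skip x i).val < y + 2 ↔ i.val < y := by
  simp only [skip]
  split_ifs <;> omega

theorem ups_ins_of_le {y : ℕ} (hy : y ≤ x.val) : (ins x D).ups y = D.ups y := by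
  rw [ups_ins, if_neg (by omega), zero_add, ups]
  congr 1
  ext i
  simp only [skip_val_lt_of_le x (show y ≤ x + 1 by omega), Finset.mem_filter, Finset.mem_univ,
    true_and]
  refine and_congr_left fun _ => ⟨fun h => h.1, fun h => ⟨h, by omega⟩⟩

theorem downs_ins_of_le {y : ℕ} (hy : y ≤ x.val) : (ins x D).downs y = D.downs y := by
  rw [downs_ins, if_neg (by omega), zero_add, downs]
  congr 1
  ext i
  simp only [skip_val_lt_of_le x (show y ≤ x + 1 by omega), Finset.mem_filter, Finset.mem_univ,
    true_and]
  refine and_congr_left fun _ => ⟨fun h => h.1, fun h => ⟨h, by omega⟩⟩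

theorem ups_ins_add_two {y : ℕ} (hy : x.val ≤ y) : (ins x D).ups (y + 2) = D.ups y + 1 := by
  rw [ups_ins, if_pos (by omega), add_comm, ups]
  simp only [skip_val_lt_add_two x hy]

theorem downs_ins_add_two {y : ℕ} (hy : x.val ≤ y) :
    (ins x D).downs (y + 2) = D.downs y + 1 := by
  rw [downs_ins, if_pos (by omega), add_comm, downs]
  simp only [skip_val_lt_add_two x hy]

theorem ups_ins_add_one : (ins x D).ups (x + 1) = D.ups x + 1 := by
  have := (ins x D).ups_succ_of_lt (i := capLeft x) (by simp [capLeft_lt_capRight])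
  rw [← ups_ins_of_le D x le_rfl]
  exact this

theorem downs_ins_add_one : (ins x D).downs (x + 1) = D.downs x := by
  have := (ins x D).downs_succ_of_lt (i := capLeft x) (by simp [capLeft_lt_capRight])
  rw [← downs_ins_of_le D x le_rfl]
  exact this

end ins

/-! ### Labelings of the arcs -/

/-- `f` is a labeling of the arcs of `D`, as a function on the positions: it takes the same value at
both ends of an arc, decreases weakly from an arc to the arcs around it, and is bounded by the
number of boxes that lie above the Dyck path at the ends of a step. -/
structure IsLabeling (f : Fin (2 * n) → ℕ) : Prop where
  partner : ∀ i, f (D.partner i) = f i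
  nested : ∀ i t, i < t → t < D.partner i → f i ≤ f t
  le_downs : ∀ i, f i ≤ D.downs i
  add_ups_le : ∀ i, f i + D.ups (i + 1) ≤ n

open Classical in
/-- The labelings of the arcs of `D` that vanish on the dotted arcs. -/
noncomputable def labelings : Finset (Fin (2 * n) → ℕ) :=
  (Fintype.piFinset fun _ => Finset.range (n + 1)).filter fun f =>
    D.IsLabeling f ∧ ∀ i, D.dot i = true → f i = 0

theorem mem_labelings {f : Fin (2 * n) → ℕ} :
    f ∈ D.labelings ↔ D.IsLabeling f ∧ ∀ i, D.dot i = true → f i = 0 := by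
  simp only [labelings, Finset.mem_filter, Fintype.mem_piFinset, Finset.mem_range,
    and_iff_right_iff_imp]
  intro h i
  have := h.1.add_ups_le i
  omega

variable {K : Type*} [Field K] (q s : K)

/-- The weight of a labeling: the product of `[b + 1 + 2 f]_s` over the arcs without dot, where `b`
is the height of the Dyck path at the ends of the arc and `f` the label. -/
def labelingWeight (f : Fin (2 * n) → ℕ) : K :=
  ∏ i, if i < D.partner i then
    (if D.dot i = true then 1 else qIntS q s (D.ups i - D.downs i + 1 + 2 * f i)) else 1

/-- The generating function of the labelings of the arcs of `D`. -/
noncomputable def labelingSum : K := ∑ f ∈ D.labelings, D.labelingWeight q s f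

/-- There is an innermost arc at the positions `x`, `x + 1`, and its label is as large as the part
of the diagram to the right permits. -/
def IsFull (E : TLBDiagram (n + 1)) (f : Fin (2 * (n + 1)) → ℕ) (x : Fin (2 * n + 1)) : Prop :=
  E.partner (capLeft x) = capRight x ∧ f (capLeft x) + E.ups (x + 1) = n + 1

/-- The left-most full innermost arc whose peak is not left of the middle. -/
structure IsFirstFull (E : TLBDiagram (n + 1)) (f : Fin (2 * (n + 1)) → ℕ)
    (x : Fin (2 * n + 1)) : Prop where
  middle_le : n ≤ x.val
  isFull : E.IsFull f x
  not_isFull : ∀ y < x, n ≤ y.val → ¬ E.IsFull f y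

/-- The right-most innermost arc is always full. -/
theorem exists_isFull (E : TLBDiagram (n + 1)) {f : Fin (2 * (n + 1)) → ℕ} (hf : E.IsLabeling f) :
    ∃ x : Fin (2 * n + 1), n ≤ x.val ∧ E.IsFull f x := by
  -- The last left end of an arc is at the position before the first `y` with `ups y = n + 1`.
  have hex : ∃ y, E.ups y = n + 1 := ⟨_, E.ups_two_mul⟩
  classical
  have h1 := Nat.find_spec hex
  have h2 : ∀ m < Nat.find hex, ¬ E.ups m = n + 1 := fun m hm => Nat.find_min hex hm
  have h3 : Nat.find hex ≤ 2 * (n + 1) := Nat.find_min' hex E.ups_two_mul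
  generalize Nat.find hex = y at h1 h2 h3
  rcases y with _ | t
  · rw [ups_zero] at h1; omega
  have h4 := E.ups_add_downs t (by omega)
  have h4' := E.ups_add_downs (t + 1) (by omega)
  have h5 : (⟨t, h3⟩ : Fin (2 * (n + 1))) < E.partner ⟨t, h3⟩ := by
    rcases E.lt_partner_or_partner_lt ⟨t, h3⟩ with h | h
    · exact h
    · exact absurd ((E.ups_succ_of_gt h).symm.trans h1) (h2 t (by omega))
  have h6 : t < 2 * n + 1 := by
    have h6 : t < (E.partner ⟨t, h3⟩).val := h5
    have := (E.partner ⟨t, h3⟩).isLt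
    omega
  have h7 : E.partner ⟨t + 1, by omega⟩ < (⟨t + 1, by omega⟩ : Fin (2 * (n + 1))) := by
    rcases E.lt_partner_or_partner_lt ⟨t + 1, by omega⟩ with h | h
    · have := E.ups_succ_of_lt h
      have := E.ups_le (t + 1 + 1)
      simp only at *
      omega
    · exact h
  refine ⟨⟨t, h6⟩, by simp only; omega, ?_, ?_⟩
  · exact E.partner_eq_of_adjacent rfl h5 h7
  · have := hf.add_ups_le ⟨t, h3⟩
    simp only [capLeft] at this ⊢
    omega

theorem exists_isFirstFull (E : TLBDiagram (n + 1)) {f : Fin (2 * (n + 1)) → ℕ}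
    (hf : E.IsLabeling f) : ∃ x, E.IsFirstFull f x := by
  classical
  obtain ⟨x, hx⟩ := E.exists_isFull hf
  let S := Finset.univ.filter fun y : Fin (2 * n + 1) => n ≤ y.val ∧ E.IsFull f y
  have hS : S.Nonempty := ⟨x, by simpa [S] using hx⟩
  have hm := Finset.min'_mem S hS
  simp only [S, Finset.mem_filter, Finset.mem_univ, true_and] at hm
  refine ⟨S.min' hS, hm.1, hm.2, fun y hy h1 h2 => ?_⟩
  exact absurd (Finset.min'_le S y (by simpa [S] using ⟨h1, h2⟩)) (not_le.2 hy)

theorem IsFirstFull.unique {E : TLBDiagram (n + 1)} {f : Fin (2 * (n + 1)) → ℕ}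
    {x y : Fin (2 * n + 1)} (hx : E.IsFirstFull f x) (hy : E.IsFirstFull f y) : x = y := by
  rcases lt_trichotomy x y with h | h | h
  · exact absurd hx.isFull (hy.not_isFull x h hx.middle_le)
  · exact h
  · exact absurd hy.isFull (hx.not_isFull y h hy.middle_le)

/-- To the left of the first full arc, the bound coming from the right is never attained. -/
theorem IsFirstFull.add_ups_le {E : TLBDiagram (n + 1)} {f : Fin (2 * (n + 1)) → ℕ}
    {x : Fin (2 * n + 1)} (hx : E.IsFirstFull f x) (hf : E.IsLabeling f)
    (k : Fin (2 * (n + 1))) (hk : k.val < x.val) : f k + E.ups (k + 1) ≤ n := by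
  have h2 := E.partner_partner
  -- The right ends of arcs are treated from left to right: the bound passes from a right end to a
  -- right end next to it, and an innermost arc is either not full or left of the middle.
  have closer : ∀ m : ℕ, ∀ k : Fin (2 * (n + 1)), k.val = m → k.val < x.val →
      E.partner k < k → f k + E.ups (k + 1) ≤ n := by
    intro m
    induction m with
    | zero => intro k hk _ h; rw [Fin.lt_def] at h; omega
    | succ m ih =>
      intro k hkm hk h
      have hm : m < 2 * (n + 1) := by omega
      have h3 := E.ups_succ_of_gt h
      rcases E.lt_partner_or_partner_lt ⟨m, hm⟩ with h4 | h4
      · have h5 := E.partner_eq_of_adjacent (by simp only; omega) h4 h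
        have h6 : f k = f ⟨m, hm⟩ := by rw [← h5, hf.partner]
        by_cases hnm : n ≤ m
        · have h7 := hx.not_isFull ⟨m, by omega⟩ (by rw [Fin.lt_def]; simp only; omega) hnm
          have h8 := hf.add_ups_le ⟨m, hm⟩
          have h9 : f ⟨m, hm⟩ + E.ups (m + 1) ≠ n + 1 := fun h9 =>
            h7 ⟨by simp only [capLeft, capRight, h5, Fin.ext_iff, hkm], h9⟩
          simp only [hkm] at *
          omega
        · have h7 := hf.le_downs ⟨m, hm⟩
          have h8 := E.ups_succ_of_lt h4
          have h9 := E.ups_add_downs m hm.le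
          simp only [hkm] at *
          omega
      · have h5 := ih ⟨m, hm⟩ rfl (by simp only; omega) h4
        have h6 : (E.partner k).val ≠ m := by
          intro h6
          rw [← Fin.ext (show (E.partner k).val = (⟨m, hm⟩ : Fin (2 * (n + 1))).val from h6),
            h2] at h4
          exact lt_asymm h h4
        have h7 := hf.nested (E.partner k) ⟨m, hm⟩
          (by rw [Fin.lt_def] at *; simp only; omega) (by rw [h2, Fin.lt_def]; simp only; omega)
        rw [hf.partner] at h7
        simp only [hkm] at *
        omega
  rcases E.lt_partner_or_partner_lt k with h | h
  · rw [← hf.partner k]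
    rw [Fin.lt_def] at h
    by_cases hj : (E.partner k).val < x.val
    · have := closer _ (E.partner k) rfl hj (by rw [h2, Fin.lt_def]; exact h)
      have := E.ups_mono (show k.val + 1 ≤ (E.partner k).val + 1 by omega)
      omega
    · have h3 := hf.add_ups_le (E.partner k)
      have h4 := E.ups_succ_of_lt (i := capLeft x) (by
        rw [hx.isFull.1]; exact capLeft_lt_capRight x)
      have h5 : (E.partner k).val ≠ x.val := by
        intro h5
        have : E.partner k = capLeft x := Fin.ext h5
        have h6 : k = capRight x := by rw [← h2 k, this, hx.isFull.1]
        simp [h6, capRight] at hk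
      have h6 := E.ups_mono (show (capLeft x).val + 1 ≤ (E.partner k).val + 1 by
        simp only [capLeft]; omega)
      have h7 := E.ups_mono (show k.val + 1 ≤ (capLeft x).val by
        simp only [capLeft]; omega)
      omega
  · exact closer _ k rfl hk h

/-- The extension of a labeling to an inserted innermost arc that makes this arc full. -/
def extendLabeling (x : Fin (2 * n + 1)) (g : Fin (2 * n) → ℕ) (k : Fin (2 * (n + 1))) : ℕ :=
  if hl : k = capLeft x then n - D.ups x else if hr : k = capRight x then n - D.ups x
  else g (unskip x k hl hr)

section extend

variable (x : Fin (2 * n + 1)) (g : Fin (2 * n) → ℕ)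

@[simp] theorem extendLabeling_capLeft : D.extendLabeling x g (capLeft x) = n - D.ups x := by
  simp [extendLabeling]

@[simp] theorem extendLabeling_capRight : D.extendLabeling x g (capRight x) = n - D.ups x := by
  simp [extendLabeling]

@[simp] theorem extendLabeling_skip (i : Fin (2 * n)) :
    D.extendLabeling x g (skip x i) = g i := by
  simp [extendLabeling, skip_ne_capLeft, skip_ne_capRight, unskip_skip]

variable {D x g} {E : TLBDiagram (n + 1)} (hE : E.partner = (ins x D).partner)
include hE

theorem ups_eq_of_partner_eq (y : ℕ) : E.ups y = (ins x D).ups y := by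
  simp [ups, hE]

theorem downs_eq_of_partner_eq (y : ℕ) : E.downs y = (ins x D).downs y := by
  simp [downs, hE]

theorem IsLabeling.restrict {f : Fin (2 * (n + 1)) → ℕ} (hf : E.IsLabeling f)
    (hx : E.IsFirstFull f x) : D.IsLabeling fun i => f (skip x i) := by
  have hm := hx.middle_le
  refine ⟨fun i => ?_, fun i t hit hti => ?_, fun i => ?_, fun i => ?_⟩
  · rw [← hf.partner (skip x i), hE, ins_partner_skip]
  · refine hf.nested _ _ ((skip_lt_skip x).2 hit) ?_
    rw [hE, ins_partner_skip, skip_lt_skip]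
    exact hti
  · by_cases hi : i.val < x.val
    · have h1 := hf.le_downs (skip x i)
      rw [downs_eq_of_partner_eq hE] at h1
      rwa [show (skip x i).val = i.val by simp [skip, hi], downs_ins_of_le D x hi.le] at h1
    · have h1 := hf.add_ups_le (skip x i)
      rw [ups_eq_of_partner_eq hE, show (skip x i).val + 1 = i.val + 1 + 2 by simp [skip, hi],
        ups_ins_add_two D x (by omega)] at h1
      have h2 := D.ups_add_downs (i + 1) (by omega)
      have h3 : D.downs (i + 1) ≤ D.downs i + 1 := by
        rcases D.lt_partner_or_partner_lt i with h | h
        · rw [D.downs_succ_of_lt h]; omega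
        · rw [D.downs_succ_of_gt h]
      omega
  · by_cases hi : i.val < x.val
    · have hv : (skip x i).val = i.val := by simp [skip, hi]
      have h1 := hx.add_ups_le hf (skip x i) (by omega)
      rwa [ups_eq_of_partner_eq hE, hv, ups_ins_of_le D x (by omega)] at h1
    · have h1 := hf.add_ups_le (skip x i)
      rw [ups_eq_of_partner_eq hE, show (skip x i).val + 1 = i.val + 1 + 2 by simp [skip, hi],
        ups_ins_add_two D x (by omega)] at h1
      omega

theorem IsLabeling.extend (hg : D.IsLabeling g) (hx : n ≤ x.val) :
    E.IsLabeling (D.extendLabeling x g) := by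
  have hU := D.ups_le x
  have hUV := D.ups_add_downs x (by omega)
  refine ⟨fun k => ?_, fun k l hkl hlk => ?_, fun k => ?_, fun k => ?_⟩
  · rcases eq_cap_or_skip x k with rfl | rfl | ⟨i, rfl⟩ <;> simp [hE, hg.partner]
  · rw [hE] at hlk
    rcases eq_cap_or_skip x k with rfl | rfl | ⟨i, rfl⟩
    · rw [ins_partner_capLeft] at hlk
      rw [Fin.lt_def] at hkl hlk
      simp only [capLeft, capRight] at hkl hlk
      omega
    · rw [ins_partner_capRight] at hlk
      exact absurd (hkl.trans hlk) (capLeft_lt_capRight x).not_gt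
    · rw [ins_partner_skip] at hlk
      -- An arc around the inserted one ends to the right of it, which bounds its label.
      have h1 : i.val < x.val → x.val ≤ (D.partner i).val → g i ≤ n - D.ups x := by
        intro h1 h2
        have h3 := hg.add_ups_le (D.partner i)
        have h4 := D.ups_mono (show x.val ≤ (D.partner i).val + 1 by omega)
        rw [hg.partner] at h3
        omega
      rcases eq_cap_or_skip x l with rfl | rfl | ⟨j, rfl⟩
      · rw [skip_lt_capLeft] at hkl
        rw [capLeft_lt_skip] at hlk
        simpa using h1 hkl hlk
      · rw [skip_lt_capRight] at hkl
        rw [capRight_lt_skip] at hlk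
        simpa using h1 hkl hlk
      · rw [skip_lt_skip] at hkl hlk
        simpa using hg.nested i j hkl hlk
  · rw [downs_eq_of_partner_eq hE]
    rcases eq_cap_or_skip x k with rfl | rfl | ⟨i, rfl⟩
    · rw [extendLabeling_capLeft, show (capLeft x).val = x.val from rfl,
        downs_ins_of_le D x le_rfl]
      omega
    · rw [extendLabeling_capRight, show (capRight x).val = x.val + 1 from rfl,
        downs_ins_add_one D x]
      omega
    · have h1 := hg.le_downs i
      rw [extendLabeling_skip]
      by_cases hi : i.val < x.val
      · rwa [show (skip x i).val = i.val by simp [skip, hi], downs_ins_of_le D x hi.le]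
      · rw [show (skip x i).val = i.val + 2 by simp [skip, hi], downs_ins_add_two D x (by omega)]
        omega
  · rw [ups_eq_of_partner_eq hE]
    rcases eq_cap_or_skip x k with rfl | rfl | ⟨i, rfl⟩
    · rw [extendLabeling_capLeft, show (capLeft x).val = x.val from rfl, ups_ins_add_one D x]
      omega
    · rw [extendLabeling_capRight, show (capRight x).val + 1 = x.val + 2 from rfl,
        ups_ins_add_two D x le_rfl]
      omega
    · have h1 := hg.add_ups_le i
      rw [extendLabeling_skip]
      by_cases hi : i.val < x.val
      · rw [show (skip x i).val = i.val by simp [skip, hi], ups_ins_of_le D x (by omega)]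
        omega
      · rw [show (skip x i).val + 1 = i.val + 1 + 2 by simp [skip, hi],
          ups_ins_add_two D x (by omega)]
        omega

theorem IsLabeling.isFirstFull_extend (hg : D.IsLabeling g) (hx : n ≤ x.val) :
    E.IsFirstFull (D.extendLabeling x g) x := by
  have hU := D.ups_le x
  refine ⟨hx, ⟨by rw [hE, ins_partner_capLeft], ?_⟩, fun y hy _ hfull => ?_⟩
  · rw [extendLabeling_capLeft, ups_eq_of_partner_eq hE, ups_ins_add_one D x]
    omega
  · rw [Fin.lt_def] at hy
    have h1 : capLeft y = skip x ⟨y, by omega⟩ := by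
      simp [capLeft, skip, hy]
    have h2 := hg.add_ups_le ⟨y, by omega⟩
    have h3 := hfull.2
    rw [h1, extendLabeling_skip, ups_eq_of_partner_eq hE, ups_ins_of_le D x (by omega)] at h3
    simp only at h2
    omega

/-- The labelings of `E` whose first full arc is the inserted one are the labelings of `D`; the
full arc contributes a factor that depends on its position only. -/
theorem sum_isFirstFull (hx : n ≤ x.val) (hd : ∀ i, E.dot (skip x i) = D.dot i)
    (hlast : E.dot (capLeft x) = true → x = Fin.last (2 * n)) [DecidablePred (E.IsFirstFull · x)] :
    ∑ f ∈ E.labelings with E.IsFirstFull f x, E.labelingWeight q s f =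
      (if E.dot (capLeft x) = true then 1 else qIntS q s (2 * n + 1 - x)) *
        D.labelingSum q s := by
  have hUV := D.ups_add_downs x (by omega)
  have hVU := D.downs_le_ups x
  have hU := D.ups_le x
  have hr : E.dot (capRight x) = E.dot (capLeft x) := by
    rw [← E.dot_partner (capLeft x), hE, ins_partner_capLeft]
  have hw : ∀ g, E.labelingWeight q s (D.extendLabeling x g) =
      (if E.dot (capLeft x) = true then 1 else qIntS q s (2 * n + 1 - x)) *
        D.labelingWeight q s g := by
    intro g
    rw [labelingWeight, prod_eq_cap_mul_prod_skip x, labelingWeight]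
    simp only [hE, ins_partner_capLeft, ins_partner_capRight, ins_partner_skip, skip_lt_skip,
      capLeft_lt_capRight, (capLeft_lt_capRight x).not_gt, if_true, if_false, mul_one, hd,
      extendLabeling_capLeft, extendLabeling_skip, ups_eq_of_partner_eq hE,
      downs_eq_of_partner_eq hE]
    congr 1
    · rw [show (capLeft x).val = x.val from rfl, ups_ins_of_le D x le_rfl,
        downs_ins_of_le D x le_rfl]
      congr 2
      omega
    · refine Finset.prod_congr rfl fun i _ => ?_
      by_cases hi : i.val < x.val
      · rw [show (skip x i).val = i.val by simp [skip, hi], ups_ins_of_le D x hi.le,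
          downs_ins_of_le D x hi.le]
      · rw [show (skip x i).val = i.val + 2 by simp [skip, hi], ups_ins_add_two D x (by omega),
          downs_ins_add_two D x (by omega), Nat.add_sub_add_right]
  have hext : ∀ f : Fin (2 * (n + 1)) → ℕ, E.IsLabeling f → E.IsFirstFull f x →
      D.extendLabeling x (fun i => f (skip x i)) = f := by
    intro f hf hfx
    have h1 := hfx.isFull.2
    rw [ups_eq_of_partner_eq hE, ups_ins_add_one D x] at h1
    have h2 : f (capRight x) = f (capLeft x) := by
      rw [← hf.partner (capLeft x), hE, ins_partner_capLeft]
    funext k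
    rcases eq_cap_or_skip x k with rfl | rfl | ⟨i, rfl⟩
    · rw [extendLabeling_capLeft]; omega
    · rw [extendLabeling_capRight]; omega
    · rw [extendLabeling_skip]
  rw [labelingSum, Finset.mul_sum]
  refine Finset.sum_nbij' (fun f i => f (skip x i)) (fun g => D.extendLabeling x g) ?_ ?_ ?_ ?_ ?_
  · intro f hf
    rw [Finset.mem_filter, mem_labelings] at hf
    rw [mem_labelings]
    exact ⟨hf.1.1.restrict hE hf.2, fun i hi => hf.1.2 _ (by rw [hd, hi])⟩
  · intro g hg
    rw [mem_labelings] at hg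
    rw [Finset.mem_filter, mem_labelings]
    refine ⟨⟨hg.1.extend hE hx, fun k hk => ?_⟩, hg.1.isFirstFull_extend hE hx⟩
    -- A dotted inserted arc is at the right end, where a full arc has label `0`.
    have h0 : E.dot (capLeft x) = true → n - D.ups x = 0 := by
      intro h
      rw [hlast h, Fin.val_last, ups_two_mul, Nat.sub_self]
    rcases eq_cap_or_skip x k with rfl | rfl | ⟨i, rfl⟩
    · rw [extendLabeling_capLeft, h0 hk]
    · rw [extendLabeling_capRight, h0 (hr ▸ hk)]
    · rw [extendLabeling_skip, hg.2 i (by rw [← hd, hk])]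
  · intro f hf
    rw [Finset.mem_filter, mem_labelings] at hf
    exact hext f hf.1.1 hf.2
  · intro g _
    funext i
    rw [extendLabeling_skip]
  · intro f hf
    rw [Finset.mem_filter, mem_labelings] at hf
    rw [← hw, hext f hf.1.1 hf.2]

end extend

/-- The generating function of the labelings satisfies the recursion of the coefficients of the
projections. -/
theorem labelingSum_succ (E : TLBDiagram (n + 1)) (c : K) (v : TLBDiagram n →₀ K)
    (hv : ∀ D, v D = c * D.labelingSum q s) :
    c * E.labelingSum q s = Finsupp.mapDomain dotIns v E + ∑ j ∈ Finset.range (n + 1),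
      qIntS q s (j + 1) * Finsupp.mapDomain (ins ⟨2 * n - j, by omega⟩) v E := by
  classical
  have hsum : E.labelingSum q s = ∑ j ∈ Finset.range (n + 1),
      ∑ f ∈ E.labelings with E.IsFirstFull f ⟨2 * n - j, by omega⟩, E.labelingWeight q s f := by
    simp only [Finset.sum_filter]
    rw [Finset.sum_comm, labelingSum]
    refine Finset.sum_congr rfl fun f hf => ?_
    obtain ⟨x, hx⟩ := E.exists_isFirstFull (E.mem_labelings.1 hf).1
    have hm := hx.middle_le
    have h0 : (⟨2 * n - (2 * n - x.val), by omega⟩ : Fin (2 * n + 1)) = x :=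
      Fin.ext (by simp only; omega)
    rw [Finset.sum_eq_single (2 * n - x.val), if_pos (by rwa [h0])]
    · intro j hj hne
      rw [if_neg]
      intro h
      have := congrArg Fin.val (h.unique hx)
      rw [Finset.mem_range] at hj
      simp only at this
      omega
    · intro h
      rw [Finset.mem_range] at h
      omega
  have key : ∀ j ∈ Finset.range (n + 1),
      c * (∑ f ∈ E.labelings with E.IsFirstFull f ⟨2 * n - j, by omega⟩,
        E.labelingWeight q s f) =
      (if j = 0 then Finsupp.mapDomain dotIns v E else 0) +
        qIntS q s (j + 1) * Finsupp.mapDomain (ins ⟨2 * n - j, by omega⟩) v E := by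
    intro j hj
    rw [Finset.mem_range] at hj
    have hjx : j = 0 → (⟨2 * n - j, by omega⟩ : Fin (2 * n + 1)) = Fin.last (2 * n) := by
      rintro rfl; rfl
    have hxj : 2 * n - (2 * n - j) = j := by omega
    have hxn : n ≤ (⟨2 * n - j, by omega⟩ : Fin (2 * n + 1)).val := by simp only; omega
    have hval : (⟨2 * n - j, by omega⟩ : Fin (2 * n + 1)).val = 2 * n - j := rfl
    generalize (⟨2 * n - j, by omega⟩ : Fin (2 * n + 1)) = x at *
    by_cases hp : E.partner (capLeft x) = capRight x
    · cases hdot : E.dot (capLeft x) with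
      | false =>
        have h1 : (if j = 0 then Finsupp.mapDomain dotIns v E else 0) = 0 := by
          split_ifs with h0
          · refine Finsupp.mapDomain_of_notMem_range _ _ ?_
            rintro ⟨D, rfl⟩
            rw [hjx h0, dotIns_dot_capLeft] at hdot
            exact absurd hdot (by simp)
          · rfl
        have h2 := ins_del x E hp hdot
        rw [sum_isFirstFull q s (D := del x E hp) (by rw [h2]) hxn (fun i => rfl)
          (by simp [hdot]), h1, zero_add]
        conv_rhs => rw [← h2, Finsupp.mapDomain_apply (ins_injective x), hv]
        simp only [hdot, Bool.false_eq_true, if_false, show 2 * n + 1 - x.val = j + 1 by omega]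
        ring
      | true =>
        have h1 : Finsupp.mapDomain (ins x) v E = 0 := by
          refine Finsupp.mapDomain_of_notMem_range _ _ ?_
          rintro ⟨D, rfl⟩
          simp at hdot
        rw [h1, mul_zero, add_zero]
        by_cases h0 : j = 0
        · have hx := hjx h0
          subst hx
          have h2 := dotIns_del E hp hdot
          rw [sum_isFirstFull q s (D := del _ E hp) (by rw [← dotIns_partner, h2]) hxn
            (fun i => rfl) (fun _ => rfl), if_pos h0]
          conv_rhs => rw [← h2, Finsupp.mapDomain_apply dotIns_injective, hv]
          simp only [hdot, if_true]
          ring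
        · -- A dotted arc has label `0`, so it is full at the right end of the diagram only.
          rw [if_neg h0, Finset.filter_false_of_mem, Finset.sum_empty, mul_zero]
          intro f hf hfull
          have h3 := (E.mem_labelings.1 hf).2 _ hdot
          have h4 := hfull.isFull.2
          have h5 : capLeft x < E.partner (capLeft x) := by
            rw [hp]; exact capLeft_lt_capRight x
          have h6 := E.ups_eq_downs_of_dot hdot h5
          have h7 := E.ups_succ_of_lt h5
          have h8 := E.ups_add_downs (capLeft x) (by omega)
          simp only [capLeft] at *
          omega
    · have h1 : Finsupp.mapDomain (ins x) v E = 0 := by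
        refine Finsupp.mapDomain_of_notMem_range _ _ ?_
        rintro ⟨D, rfl⟩
        simp at hp
      have h2 : (if j = 0 then Finsupp.mapDomain dotIns v E else 0) = 0 := by
        split_ifs with h0
        · refine Finsupp.mapDomain_of_notMem_range _ _ ?_
          rintro ⟨D, rfl⟩
          rw [hjx h0, dotIns_partner] at hp
          simp at hp
        · rfl
      rw [Finset.filter_false_of_mem, h1, h2]
      · simp
      · exact fun f _ h => hp h.isFull.1
  rw [hsum, Finset.mul_sum, Finset.sum_congr rfl key, Finset.sum_add_distrib,
    Finset.sum_ite_eq' (Finset.range (n + 1)) 0]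
  simp

end TLBDiagram

/-- The coefficient of a diagram in the projection is the generating function of its labelings,
divided by `[1]_s ⋯ [n]_s`. -/
theorem TLB.coeffB_eq_labelingSum {K : Type*} [Field K] {q s : K} (hq : q ≠ 0) (hs : s ≠ 0) :
    ∀ {n : ℕ}, (∀ k : ℕ, 1 ≤ k → k ≤ n → qIntS q s k ≠ 0) → ∀ D : TLBDiagram n,
      TLB.coeffB q s D = (∏ k ∈ Finset.range n, 1 / qIntS q s (k + 1)) * D.labelingSum q s
  | 0, _, D => by
    have h1 : TLBDiagram.identity 0 = D := by
      apply TLBDiagram.ext <;> funext i <;> exact i.elim0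
    have h2 : D.labelings = {fun i => i.elim0} := by
      ext f
      rw [D.mem_labelings, Finset.mem_singleton]
      refine ⟨fun _ => funext fun i => i.elim0, fun _ => ⟨⟨?_, ?_, ?_, ?_⟩, ?_⟩⟩ <;>
        exact fun i => i.elim0
    simp [TLB.coeffB, TLB.toDiagrams_Q, clasp, h1, TLBDiagram.labelingSum, h2,
      TLBDiagram.labelingWeight]
  | n + 1, hqs, D => by
    have ih := TLB.coeffB_eq_labelingSum hq hs (n := n) (fun k h h' => hqs k h (by omega))
    have h1 := TLBDiagram.labelingSum_succ q s D _ (TLB.toDiagrams q s (TLB.Q q s n)) ih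
    rw [Finset.prod_range_succ, mul_comm (∏ k ∈ Finset.range n, _), mul_assoc, h1, TLB.coeffB,
      TLB.toDiagrams_Q_succ q s hq hs hqs]
    simp [mul_add]

/-! ### The region above the Dyck path -/

namespace TLBDiagram

variable {n : ℕ} (D : TLBDiagram n)

/-- The height of the Dyck path of `D` after `x` steps. -/
def height (x : ℕ) : ℕ := D.ups x - D.downs x

theorem height_succ_of_lt {i : Fin (2 * n)} (h : i < D.partner i) :
    D.height (i + 1) = D.height i + 1 := by
  have := D.downs_le_ups i
  rw [height, height, D.ups_succ_of_lt h, D.downs_succ_of_lt h]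
  omega

theorem height_succ_of_gt {i : Fin (2 * n)} (h : D.partner i < i) :
    D.height (i + 1) + 1 = D.height i := by
  have := D.downs_le_ups (i + 1)
  rw [D.ups_succ_of_gt h, D.downs_succ_of_gt h] at this
  rw [height, height, D.ups_succ_of_gt h, D.downs_succ_of_gt h]
  omega

theorem height_partner_succ {i : Fin (2 * n)} (h : i < D.partner i) :
    D.height (D.partner i + 1) = D.height i := by
  have := D.ups_partner_add_downs h
  have := D.downs_le_ups i
  have := D.downs_le_ups (D.partner i + 1)
  rw [height, height]
  omega

theorem height_partner {i : Fin (2 * n)} (h : D.partner i < i) :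
    D.height (D.partner i) = D.height (i + 1) := by
  have := D.height_partner_succ (i := D.partner i) (by rwa [D.partner_partner])
  rw [D.partner_partner] at this
  exact this.symm

/-- The Dyck path stays above the level of an arc between the ends of the arc. -/
theorem height_lt_height {i : Fin (2 * n)} (h : i < D.partner i) : ∀ y : ℕ, i.val < y →
    y ≤ (D.partner i).val → D.height i < D.height y := by
  intro y
  induction y using Nat.strong_induction_on with
  | _ y ih =>
    intro h1 h2
    rcases Nat.lt_or_ge (i.val + 1) y with h3 | h3
    · obtain ⟨t, rfl⟩ : ∃ t, y = t + 1 := ⟨y - 1, by omega⟩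
      have ht : t < 2 * n := by omega
      rcases D.lt_partner_or_partner_lt ⟨t, ht⟩ with h4 | h4
      · have h5 := D.height_succ_of_lt h4
        have h6 := ih t (by omega) (by omega) (by omega)
        simp only at h5
        omega
      · have h5 := D.height_partner h4
        have h6 := D.noncrossing (D.partner ⟨t, ht⟩) i
        have h7 := D.noncrossing (D.partner i) ⟨t, ht⟩
        have h8 : D.partner ⟨t, ht⟩ ≠ i := by
          intro h8
          have := congrArg Fin.val (D.partner_partner ⟨t, ht⟩)
          rw [h8] at this
          simp only at this
          omega
        rw [D.partner_partner] at h6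
        simp only [Fin.lt_def, ne_eq, Fin.ext_iff] at h4 h6 h8
        have h9 := ih (D.partner ⟨t, ht⟩).val (by omega) (by omega) (by omega)
        simp only at h5
        omega
    · rw [show y = i.val + 1 by omega, D.height_succ_of_lt h]
      omega

theorem count_take_U (k : ℕ) : (D.dyckPath.toList.take k).count DyckStep.U = D.ups k := by
  rw [show D.dyckPath.toList = List.ofFn D.step from rfl, count_take_step, ups]
  congr 1
  ext t
  rw [Finset.mem_filter, Finset.mem_filter, step]
  simp only [Finset.mem_univ, true_and]
  split_ifs with h <;> simp [h]

theorem count_take_D (k : ℕ) : (D.dyckPath.toList.take k).count DyckStep.D = D.downs k := by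
  rw [show D.dyckPath.toList = List.ofFn D.step from rfl, count_take_step, downs]
  congr 1
  ext t
  rw [Finset.mem_filter, Finset.mem_filter, step]
  simp only [Finset.mem_univ, true_and]
  have := D.lt_partner_or_partner_lt t
  split_ifs with h
  · simp [h.le]
  · simp [this.resolve_left h]

theorem heightAt_dyckPath (k : ℕ) : D.dyckPath.heightAt k = D.height k := by
  have := D.downs_le_ups k
  rw [DyckWord.heightAt, count_take_U, count_take_D, height]
  omega

/-- The centre of the `l`-th box, counted from `0`, above the Dyck path at the abscissa `x`. -/
def box (x l : ℕ) : ℤ × ℤ := ((x : ℤ), ((D.height x + 1 + 2 * l : ℕ) : ℤ))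

theorem box_inj {x y l m : ℕ} : D.box x l = D.box y m ↔ x = y ∧ l = m := by
  simp only [box, Prod.mk.injEq, Nat.cast_inj]
  refine ⟨fun ⟨h1, h2⟩ => ?_, fun ⟨h1, h2⟩ => by simp [h1, h2]⟩
  subst h1
  omega

/-- The `l`-th box above the Dyck path at the abscissa `x` lies below the path `U^n R^n`. -/
def InRegion (x l : ℕ) : Prop := l < D.downs x ∧ l + D.ups x < n

theorem InRegion.le_two_mul {D : TLBDiagram n} {x l : ℕ} (h : D.InRegion x l) : x ≤ 2 * n := by
  by_contra hx
  have h1 := D.ups_mono (show 2 * n ≤ x by omega)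
  rw [ups_two_mul] at h1
  have := h.2
  omega

theorem mem_dyckRegion {b : ℤ × ℤ} :
    b ∈ dyckRegion n D.dyckPath ↔ ∃ x l, D.InRegion x l ∧ b = D.box x l := by
  obtain ⟨X, Y⟩ := b
  simp only [dyckRegion, Finset.mem_filter, Finset.mem_product, Finset.mem_Icc, heightAt_dyckPath,
    box, Prod.mk.injEq, InRegion]
  constructor
  · rintro ⟨⟨⟨h1, h2⟩, h3, h4⟩, ⟨r, h5⟩, h6, h7⟩
    lift X to ℕ using h1
    rw [Int.toNat_natCast] at h6
    have h8 := D.ups_add_downs X (by omega)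
    have h9 := D.downs_le_ups X
    rw [height] at h6
    refine ⟨X, ((Y - 1 - D.height X) / 2).toNat, ?_, rfl, ?_⟩ <;> rw [height] <;> omega
  · rintro ⟨x, l, ⟨h1, h2⟩, rfl, rfl⟩
    have h0 : x ≤ 2 * n := InRegion.le_two_mul (D := D) ⟨h1, h2⟩
    have h8 := D.ups_add_downs x h0
    have h9 := D.downs_le_ups x
    rw [Int.toNat_natCast, height]
    refine ⟨⟨⟨by omega, by omega⟩, by omega, by omega⟩, ⟨D.ups x - D.downs x + D.downs x + l, ?_⟩,
      by omega, by omega⟩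
    omega

/-- The boxes at level `l` above a part of the Dyck path of `D` that is itself a translated Dyck
path form a Dyck tile. -/
theorem isDyckTile_image_box {a b : ℕ} (l : ℕ) (hab : a ≤ b) (hb : b ≤ 2 * n)
    (h : D.height b = D.height a) (hmin : ∀ y, a ≤ y → y ≤ b → D.height a ≤ D.height y) :
    IsDyckTile ((b - a) / 2) ((Finset.Icc a b).image fun y => D.box y l) := by
  have hcount : ∀ (c : DyckStep) (k : ℕ), k ≤ b - a →
      (((D.dyckPath.toList.drop a).take (b - a)).take k).count c +
        (D.dyckPath.toList.take a).count c = (D.dyckPath.toList.take (a + k)).count c := by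
    intro c k hk
    rw [List.take_take, min_eq_left hk, List.take_add, List.count_append, add_comm]
  have hU : ∀ k ≤ b - a,
      (((D.dyckPath.toList.drop a).take (b - a)).take k).count DyckStep.U + D.ups a =
        D.ups (a + k) := fun k hk => by
    rw [← count_take_U, ← count_take_U, hcount _ k hk]
  have hD : ∀ k ≤ b - a,
      (((D.dyckPath.toList.drop a).take (b - a)).take k).count DyckStep.D + D.downs a =
        D.downs (a + k) := fun k hk => by
    rw [← count_take_D, ← count_take_D, hcount _ k hk]
  have hlen : ((D.dyckPath.toList.drop a).take (b - a)).take (b - a) =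
      (D.dyckPath.toList.drop a).take (b - a) := by rw [List.take_take, min_self]
  have h1 := hU (b - a) le_rfl
  have h2 := hD (b - a) le_rfl
  rw [hlen, show a + (b - a) = b by omega] at h1 h2
  have h3 := D.ups_add_downs a (by omega)
  have h4 := D.ups_add_downs b hb
  have h5 := D.downs_le_ups a
  have h6 := D.downs_le_ups b
  simp only [height] at h hmin
  let w : DyckWord :=
    { toList := (D.dyckPath.toList.drop a).take (b - a)
      count_U_eq_count_D := by omega
      count_D_le_count_U := fun k => by
        rcases le_total k (b - a) with hk | hk
        · have h7 := hU k hk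
          have h8 := hD k hk
          have h9 := D.downs_le_ups (a + k)
          have := hmin (a + k) (by omega) (by omega)
          omega
        · rw [List.take_of_length_le (by rw [List.length_take]; omega)]
          omega }
  have hw : ∀ k ≤ b - a, w.heightAt k = (D.height (a + k) : ℤ) - D.height a := by
    intro k hk
    have h7 := hU k hk
    have h8 := hD k hk
    have h9 := D.downs_le_ups (a + k)
    simp only [DyckWord.heightAt, height, w]
    omega
  refine ⟨w, a, ((D.height a + 1 + 2 * l : ℕ) : ℤ), ?_, ?_⟩
  · simp only [DyckWord.semilength, w]
    omega
  · ext p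
    simp only [Finset.mem_image, Finset.mem_Icc, Finset.mem_range, box]
    constructor
    · rintro ⟨y, ⟨h7, h8⟩, rfl⟩
      refine ⟨y - a, by omega, ?_⟩
      rw [hw _ (by omega), show a + (y - a) = y by omega, Prod.mk.injEq]
      constructor <;> omega
    · rintro ⟨k, h7, rfl⟩
      refine ⟨a + k, ⟨by omega, by omega⟩, ?_⟩
      rw [hw _ (by omega), Prod.mk.injEq]
      constructor <;> omega

/-- The boxes of a Dyck tile of size `m` lie above `2 * m + 1` consecutive abscissas, and the two
outer ones are at the minimal height. -/
theorem _root_.IsDyckTile.exists_path {m : ℕ} {d : Finset (ℤ × ℤ)} (h : IsDyckTile m d) :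
    ∃ (x y : ℤ) (g : ℕ → ℤ), g 0 = 0 ∧ g (2 * m) = 0 ∧ (∀ k, 0 ≤ g k) ∧
      ∀ b, b ∈ d ↔ ∃ k ≤ 2 * m, b = (x + (k : ℤ), y + g k) := by
  obtain ⟨w, x, y, rfl, rfl⟩ := h
  refine ⟨x, y, w.heightAt, by simp [DyckWord.heightAt], ?_, fun k => ?_, fun b => ?_⟩
  · have h1 : w.toList.length = 2 * w.semilength := w.two_mul_semilength_eq_length.symm
    rw [DyckWord.heightAt, List.take_of_length_le h1.le, w.count_U_eq_count_D, sub_self]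
  · have := w.count_D_le_count_U k
    rw [DyckWord.heightAt]
    omega
  · simp only [Finset.mem_image, Finset.mem_range, Nat.lt_succ_iff, eq_comm (a := b)]

end TLBDiagram

/-! ### From labelings to tilings -/

namespace TLBDiagram

variable {n : ℕ} {D : TLBDiagram n}

/-- The steps from the abscissa `x` to the abscissa `y` are joined at level `l`: their labels
exceed `l`. -/
def Run (f : Fin (2 * n) → ℕ) (l x y : ℕ) : Prop :=
  ∀ i : Fin (2 * n), x ≤ i.val → i.val < y → l < f i

theorem Run.mono {f : Fin (2 * n) → ℕ} {l x y x' y' l' : ℕ} (h : Run f l x y) (hx : x ≤ x')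
    (hy : y' ≤ y) (hl : l' ≤ l) : Run f l' x' y' :=
  fun i h1 h2 => lt_of_le_of_lt hl (h i (by omega) (by omega))

theorem InRegion.lt {x l : ℕ} (h : D.InRegion x l) : l < n := by
  have := h.2
  omega

theorem InRegion.of_le {x l m : ℕ} (h : D.InRegion x l) (hm : m ≤ l) : D.InRegion x m :=
  ⟨hm.trans_lt h.1, by have := h.2; omega⟩

namespace IsLabeling

variable {f : Fin (2 * n) → ℕ} (hf : D.IsLabeling f)
include hf

theorem inRegion {i : Fin (2 * n)} {l : ℕ} (h : l < f i) : D.InRegion i l := by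
  have h1 := hf.le_downs i
  have h2 := hf.add_ups_le i
  have h3 := D.ups_mono (Nat.le_succ i.val)
  rw [Nat.succ_eq_add_one] at h3
  exact ⟨by omega, by omega⟩

theorem inRegion_succ {i : Fin (2 * n)} {l : ℕ} (h : l < f i) : D.InRegion (i + 1) l := by
  have h1 := hf.le_downs i
  have h2 := hf.add_ups_le i
  have h3 : D.downs i ≤ D.downs (i + 1) := by
    rcases D.lt_partner_or_partner_lt i with h | h
    · rw [D.downs_succ_of_lt h]
    · rw [D.downs_succ_of_gt h]; omega
  exact ⟨by omega, by omega⟩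

theorem inRegion_of_run {l x y : ℕ} (h : Run f l x y) (hx : D.InRegion x l) (hxy : x ≤ y)
    (hy : y ≤ 2 * n) : D.InRegion y l := by
  rcases hxy.eq_or_lt with rfl | h1
  · exact hx
  · have := hf.inRegion_succ (h ⟨y - 1, by omega⟩ (by simp only; omega) (by simp only; omega))
    rwa [show ((⟨y - 1, by omega⟩ : Fin (2 * n)).val + 1) = y by simp only; omega] at this

/-- A maximal run of joined steps does not go below its left end: a right end of an arc in the run
is joined to the corresponding left end. -/
theorem height_le_of_run {l a : ℕ} (ha : ∀ i : Fin (2 * n), i.val + 1 = a → f i ≤ l) :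
    ∀ y : ℕ, a ≤ y → y ≤ 2 * n → Run f l a y → D.height a ≤ D.height y := by
  intro y
  induction y using Nat.strong_induction_on with
  | _ y ih =>
    intro h1 h2 h3
    rcases h1.eq_or_lt with rfl | h4
    · exact le_rfl
    obtain ⟨t, rfl⟩ : ∃ t, y = t + 1 := ⟨y - 1, by omega⟩
    have h5 : l < f ⟨t, h2⟩ := h3 ⟨t, h2⟩ (by simp only; omega) (Nat.lt_succ_self t)
    rcases D.lt_partner_or_partner_lt ⟨t, h2⟩ with h6 | h6
    · have h7 := D.height_succ_of_lt h6
      have h8 := ih t (by omega) (by omega) (by omega) (h3.mono le_rfl (by omega) le_rfl)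
      simp only at h7
      omega
    · have h7 := D.height_partner h6
      rw [Fin.lt_def] at h6
      by_cases h8 : a ≤ (D.partner ⟨t, h2⟩).val
      · rw [← h7]
        simp only at h6
        exact ih _ (by omega) h8 (by omega) (h3.mono le_rfl (by omega) le_rfl)
      · exfalso
        have h9 := ha ⟨a - 1, by omega⟩ (by simp only; omega)
        rw [← hf.partner] at h5
        by_cases h10 : (D.partner ⟨t, h2⟩).val = a - 1
        · rw [show D.partner ⟨t, h2⟩ = ⟨a - 1, by omega⟩ from Fin.ext h10] at h5
          omega
        · have := hf.nested (D.partner ⟨t, h2⟩) ⟨a - 1, by omega⟩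
            (by rw [Fin.lt_def]; simp only; omega)
            (by rw [Fin.lt_def, D.partner_partner]; simp only; omega)
          omega

/-- A maximal run of joined steps does not go below its right end. -/
theorem height_le_of_run' {l b : ℕ} (hb : ∀ i : Fin (2 * n), i.val = b → f i ≤ l)
    (hbn : b ≤ 2 * n) : ∀ k y : ℕ, y + k = b → Run f l y b → D.height b ≤ D.height y := by
  intro k
  induction k using Nat.strong_induction_on with
  | _ k ih =>
    intro y h1 h3
    rcases Nat.eq_zero_or_pos k with rfl | h4
    · rw [show y = b by omega]
    have h2 : y < 2 * n := by omega
    have h5 : l < f ⟨y, h2⟩ := h3 ⟨y, h2⟩ le_rfl (by simp only; omega)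
    rcases D.lt_partner_or_partner_lt ⟨y, h2⟩ with h6 | h6
    · have h7 := D.height_partner_succ h6
      rw [Fin.lt_def] at h6
      by_cases h8 : (D.partner ⟨y, h2⟩).val < b
      · rw [← h7]
        simp only at h6
        exact ih (b - ((D.partner ⟨y, h2⟩).val + 1)) (by omega) _ (by omega)
          (h3.mono (by omega) le_rfl le_rfl)
      · exfalso
        have h11 := (D.partner ⟨y, h2⟩).isLt
        have h9 := hb ⟨b, by omega⟩ rfl
        by_cases h10 : (D.partner ⟨y, h2⟩).val = b
        · rw [← hf.partner, show D.partner ⟨y, h2⟩ = ⟨b, by omega⟩ from Fin.ext h10] at h5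
          omega
        · have := hf.nested ⟨y, h2⟩ ⟨b, by omega⟩
            (by rw [Fin.lt_def]; simp only; omega) (by rw [Fin.lt_def]; simp only; omega)
          omega
    · have h7 := D.height_succ_of_gt h6
      have h8 := ih (k - 1) (by omega) (y + 1) (by omega) (h3.mono (by omega) le_rfl le_rfl)
      simp only at h7
      omega

end IsLabeling

variable (D)

open Classical in
/-- The positions `(x, l)` of the left-most boxes of the tiles of the tiling of a labeling. -/
noncomputable def starts (f : Fin (2 * n) → ℕ) : Finset (ℕ × ℕ) :=
  (Finset.range (2 * n + 1) ×ˢ Finset.range n).filter fun p =>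
    D.InRegion p.1 p.2 ∧ ∀ i : Fin (2 * n), i.val + 1 = p.1 → f i ≤ p.2

open Classical in
/-- The tile of a labeling that starts at the box at level `p.2` above the abscissa `p.1`: the boxes
at this level that are joined to the first one. -/
noncomputable def tile (f : Fin (2 * n) → ℕ) (p : ℕ × ℕ) : Finset (ℤ × ℤ) :=
  ((Finset.range (2 * n + 1)).filter fun y => p.1 ≤ y ∧ Run f p.2 p.1 y).image fun y => D.box y p.2

/-- The Dyck tiling of a labeling: the label of an arc is the number of levels at which the steps
of the Dyck path under this arc belong to one tile. -/
noncomputable def tiling (f : Fin (2 * n) → ℕ) : Finset (Finset (ℤ × ℤ)) :=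
  (D.starts f).image (D.tile f)

variable {D} {f : Fin (2 * n) → ℕ}

theorem mem_starts {p : ℕ × ℕ} :
    p ∈ D.starts f ↔ D.InRegion p.1 p.2 ∧ ∀ i : Fin (2 * n), i.val + 1 = p.1 → f i ≤ p.2 := by
  simp only [starts, Finset.mem_filter, Finset.mem_product, Finset.mem_range,
    and_iff_right_iff_imp]
  rintro ⟨h, _⟩
  exact ⟨Nat.lt_succ_of_le h.le_two_mul, h.lt⟩

theorem mem_tile {p : ℕ × ℕ} {b : ℤ × ℤ} :
    b ∈ D.tile f p ↔ ∃ y ≤ 2 * n, p.1 ≤ y ∧ Run f p.2 p.1 y ∧ b = D.box y p.2 := by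
  simp only [tile, Finset.mem_image, Finset.mem_filter, Finset.mem_range, Nat.lt_succ_iff,
    eq_comm (a := b), and_assoc]

theorem box_mem_tile {p : ℕ × ℕ} {y l : ℕ} :
    D.box y l ∈ D.tile f p ↔ y ≤ 2 * n ∧ l = p.2 ∧ p.1 ≤ y ∧ Run f p.2 p.1 y := by
  rw [mem_tile]
  constructor
  · rintro ⟨z, h1, h2, h3, h4⟩
    rw [box_inj] at h4
    obtain ⟨rfl, rfl⟩ := h4
    exact ⟨h1, rfl, h2, h3⟩
  · rintro ⟨h1, rfl, h2, h3⟩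
    exact ⟨y, h1, h2, h3, rfl⟩

theorem mem_tiling {d : Finset (ℤ × ℤ)} : d ∈ D.tiling f ↔ ∃ p ∈ D.starts f, D.tile f p = d := by
  simp only [tiling, Finset.mem_image]

/-- Two tiles with a common box start at the same box. -/
theorem eq_of_mem_tile {p p' : ℕ × ℕ} (hp : p ∈ D.starts f) (hp' : p' ∈ D.starts f) {b : ℤ × ℤ}
    (h : b ∈ D.tile f p) (h' : b ∈ D.tile f p') : p = p' := by
  obtain ⟨y, h1, h2, h3, rfl⟩ := mem_tile.1 h
  obtain ⟨-, h4, h5, h6⟩ := box_mem_tile.1 h'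
  have key : ∀ p p' : ℕ × ℕ, p' ∈ D.starts f → p.2 = p'.2 → p'.1 ≤ y → Run f p.2 p.1 y →
      p'.1 ≤ p.1 := by
    intro p p' hp' h4 h5 h3
    by_contra hlt
    have h7 := (mem_starts.1 hp').2 ⟨p'.1 - 1, by omega⟩ (by simp only; omega)
    have h8 := h3 ⟨p'.1 - 1, by omega⟩ (by simp only; omega) (by simp only; omega)
    omega
  exact Prod.ext (le_antisymm (key p' p hp h4.symm h2 h6) (key p p' hp' h4 h5 h3)) h4

theorem IsLabeling.exists_start (hf : D.IsLabeling f) {y l : ℕ} (h : D.InRegion y l) :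
    ∃ x, (x, l) ∈ D.starts f ∧ x ≤ y ∧ Run f l x y := by
  classical
  have hex : ∃ x, x ≤ y ∧ Run f l x y := ⟨y, le_rfl, fun i h1 h2 => absurd h1 (by omega)⟩
  have h1 := Nat.find_spec hex
  have h2 : ∀ m < Nat.find hex, ¬ (m ≤ y ∧ Run f l m y) := fun m hm => Nat.find_min hex hm
  generalize Nat.find hex = x at h1 h2
  refine ⟨x, mem_starts.2 ⟨?_, ?_⟩, h1⟩
  · rcases h1.1.eq_or_lt with rfl | h3
    · exact h
    · have h4 := h.le_two_mul
      exact hf.inRegion (h1.2 ⟨x, by omega⟩ le_rfl h3)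
  · intro i hi
    by_contra hlt
    simp only at hi
    refine h2 i.val (by omega) ⟨by omega, fun j h3 h4 => ?_⟩
    by_cases h5 : j = i
    · subst h5; omega
    · have : j.val ≠ i.val := fun h => h5 (Fin.ext h)
      exact h1.2 j (by omega) h4

/-- The tile that starts at a given box ends at the same height. -/
theorem IsLabeling.exists_tile_eq (hf : D.IsLabeling f) {p : ℕ × ℕ} (hp : p ∈ D.starts f) :
    ∃ b, p.1 ≤ b ∧ b ≤ 2 * n ∧ D.height b = D.height p.1 ∧
      (∀ y, p.1 ≤ y → y ≤ b → D.height p.1 ≤ D.height y) ∧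
      D.tile f p = (Finset.Icc p.1 b).image fun y => D.box y p.2 := by
  classical
  have hp' := mem_starts.1 hp
  have h0 := hp'.1.le_two_mul
  let S := (Finset.range (2 * n + 1)).filter fun y => p.1 ≤ y ∧ Run f p.2 p.1 y
  have hS : S.Nonempty := ⟨p.1, by
    simp only [S, Finset.mem_filter, Finset.mem_range]
    exact ⟨by omega, le_rfl, fun i h1 h2 => absurd h1 (by omega)⟩⟩
  have h1 := Finset.max'_mem S hS
  have h2 : ∀ y ∈ S, y ≤ S.max' hS := fun y hy => Finset.le_max' S y hy
  have h3 : D.tile f p = S.image fun y => D.box y p.2 := rfl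
  generalize S.max' hS = b at h1 h2
  simp only [S, Finset.mem_filter, Finset.mem_range] at h1
  have hb : ∀ i : Fin (2 * n), i.val = b → f i ≤ p.2 := by
    intro i hi
    by_contra hlt
    have := h2 (b + 1) (by
      simp only [S, Finset.mem_filter, Finset.mem_range]
      refine ⟨by omega, by omega, fun j h4 h5 => ?_⟩
      by_cases h6 : j = i
      · subst h6; omega
      · have : j.val ≠ i.val := fun h => h6 (Fin.ext h)
        exact h1.2.2 j h4 (by omega))
    omega
  have hmin : ∀ y, p.1 ≤ y → y ≤ b → D.height p.1 ≤ D.height y := fun y h4 h5 =>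
    hf.height_le_of_run hp'.2 y h4 (by omega) (h1.2.2.mono le_rfl h5 le_rfl)
  refine ⟨b, h1.2.1, by omega, le_antisymm ?_ (hmin b h1.2.1 le_rfl), hmin, ?_⟩
  · exact hf.height_le_of_run' hb (by omega) (b - p.1) p.1 (by omega) h1.2.2
  · rw [h3]
    congr 1
    ext y
    rw [Finset.mem_Icc]
    constructor
    · intro hy
      have h4 := h2 y hy
      simp only [S, Finset.mem_filter, Finset.mem_range] at hy
      exact ⟨hy.2.1, h4⟩
    · rintro ⟨h4, h5⟩
      simp only [S, Finset.mem_filter, Finset.mem_range]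
      exact ⟨by omega, h4, h1.2.2.mono le_rfl h5 le_rfl⟩

theorem IsLabeling.tileHeight_tile (hf : D.IsLabeling f) {p : ℕ × ℕ} (hp : p ∈ D.starts f) :
    tileHeight (D.tile f p) = D.height p.1 + 1 + 2 * p.2 := by
  obtain ⟨b, h1, h2, h3, h4, h5⟩ := hf.exists_tile_eq hp
  rw [tileHeight, h5]
  apply le_antisymm
  · refine Nat.sInf_le ⟨D.box p.1 p.2, ?_, rfl⟩
    exact Finset.mem_image_of_mem _ (Finset.mem_Icc.2 ⟨le_rfl, h1⟩)
  · refine le_csInf ⟨_, D.box p.1 p.2, ?_, rfl⟩ ?_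
    · exact Finset.mem_image_of_mem _ (Finset.mem_Icc.2 ⟨le_rfl, h1⟩)
    · rintro h ⟨c, hc, hch⟩
      obtain ⟨y, hy, rfl⟩ := Finset.mem_image.1 hc
      rw [Finset.mem_Icc] at hy
      have := h4 y hy.1 hy.2
      simp only [box, Nat.cast_inj] at hch
      omega

/-- The tiling of a labeling is a cover-inclusive Dyck tiling. -/
theorem IsLabeling.isCoverInclusive_tiling (hf : D.IsLabeling f) :
    IsCoverInclusiveDyckTiling n D.dyckPath (D.tiling f) := by
  refine ⟨fun d hd => ?_, fun d hd d' hd' hne => ?_, fun b => ?_, fun d hd => ?_⟩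
  · obtain ⟨p, hp, rfl⟩ := mem_tiling.1 hd
    obtain ⟨b, h1, h2, h3, h4, h5⟩ := hf.exists_tile_eq hp
    rw [h5]
    exact ⟨_, D.isDyckTile_image_box p.2 h1 h2 h3 h4⟩
  · obtain ⟨p, hp, rfl⟩ := mem_tiling.1 hd
    obtain ⟨p', hp', rfl⟩ := mem_tiling.1 hd'
    rw [Finset.disjoint_left]
    intro b hb hb'
    exact hne (by rw [eq_of_mem_tile hp hp' hb hb'])
  · rw [mem_dyckRegion]
    constructor
    · rintro ⟨y, l, h, rfl⟩
      obtain ⟨x, h1, h2, h3⟩ := hf.exists_start h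
      exact ⟨_, mem_tiling.2 ⟨_, h1, rfl⟩, box_mem_tile.2 ⟨h.le_two_mul, rfl, h2, h3⟩⟩
    · rintro ⟨d, hd, hb⟩
      obtain ⟨p, hp, rfl⟩ := mem_tiling.1 hd
      obtain ⟨y, h1, h2, h3, rfl⟩ := mem_tile.1 hb
      exact ⟨y, p.2, hf.inRegion_of_run h3 (mem_starts.1 hp).1 h2 h1, rfl⟩
  · obtain ⟨⟨x, l⟩, hp, rfl⟩ := mem_tiling.1 hd
    have hx := (mem_starts.1 hp).1
    rcases l with _ | l
    · left
      intro b hb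
      obtain ⟨c, hc, rfl⟩ := Finset.mem_image.1 hb
      obtain ⟨y, h1, h2, h3, rfl⟩ := mem_tile.1 hc
      simp only [box, Int.toNat_natCast, heightAt_dyckPath]
      omega
    · right
      obtain ⟨x', h1, h2, h3⟩ := hf.exists_start (hx.of_le (Nat.le_succ l))
      refine ⟨_, mem_tiling.2 ⟨_, h1, rfl⟩, fun b hb => ?_⟩
      obtain ⟨c, hc, rfl⟩ := Finset.mem_image.1 hb
      obtain ⟨y, h4, h5, h6, rfl⟩ := mem_tile.1 hc
      simp only at h5 h6
      refine mem_tile.2 ⟨y, h4, by simp only; omega, fun i h7 h8 => ?_, ?_⟩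
      · by_cases h9 : x ≤ i.val
        · exact (Nat.lt_succ_self l).trans (h6 i h9 h8)
        · exact h3 i h7 (by omega)
      · simp only [box, Prod.mk.injEq, true_and]
        omega

/-! ### From tilings to labelings -/

/-- The step at position `i` is joined at level `l` in a set of tiles: the boxes at this level
above its two ends belong to the same tile. -/
def Joined (D : TLBDiagram n) (T : Finset (Finset (ℤ × ℤ))) (l i : ℕ) : Prop :=
  ∃ d ∈ T, D.box i l ∈ d ∧ D.box (i + 1) l ∈ d

/-- A labeling can be read off from its tiling. -/
theorem IsLabeling.joined_tiling (hf : D.IsLabeling f) (i : Fin (2 * n)) (l : ℕ) :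
    D.Joined (D.tiling f) l i ↔ l < f i := by
  constructor
  · rintro ⟨d, hd, h1, h2⟩
    obtain ⟨p, hp, rfl⟩ := mem_tiling.1 hd
    obtain ⟨-, h3, h4, -⟩ := box_mem_tile.1 h1
    obtain ⟨-, -, -, h5⟩ := box_mem_tile.1 h2
    rw [h3]
    exact h5 i h4 (Nat.lt_succ_self _)
  · intro h
    obtain ⟨x, h1, h2, h3⟩ := hf.exists_start (hf.inRegion h)
    refine ⟨_, mem_tiling.2 ⟨_, h1, rfl⟩, box_mem_tile.2 ⟨i.isLt.le, rfl, h2, h3⟩,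
      box_mem_tile.2 ⟨i.isLt, rfl, by simp only; omega, fun j h4 h5 => ?_⟩⟩
    by_cases h6 : j = i
    · rwa [h6]
    · have : j.val ≠ i.val := fun h => h6 (Fin.ext h)
      exact h3 j h4 (by omega)

theorem IsLabeling.tiling_injective {g : Fin (2 * n) → ℕ} (hf : D.IsLabeling f)
    (hg : D.IsLabeling g) (h : D.tiling f = D.tiling g) : f = g := by
  funext i
  have : ∀ l, l < f i ↔ l < g i := fun l => by
    rw [← hf.joined_tiling, h, hg.joined_tiling]
  exact le_antisymm (not_lt.1 fun h => lt_irrefl _ ((this _).1 h))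
    (not_lt.1 fun h => lt_irrefl _ ((this _).2 h))

end TLBDiagram

namespace IsCoverInclusiveDyckTiling

open TLBDiagram

variable {n : ℕ} {D : TLBDiagram n} {T : Finset (Finset (ℤ × ℤ))}
  (hT : IsCoverInclusiveDyckTiling n D.dyckPath T)
include hT

theorem inRegion {d : Finset (ℤ × ℤ)} (hd : d ∈ T) {x l : ℕ} (h : D.box x l ∈ d) :
    D.InRegion x l := by
  obtain ⟨y, m, h1, h2⟩ := D.mem_dyckRegion.1 ((hT.cover _).2 ⟨d, hd, h⟩)
  rw [box_inj] at h2
  rwa [h2.1, h2.2]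

theorem exists_box {d : Finset (ℤ × ℤ)} (hd : d ∈ T) {b : ℤ × ℤ} (h : b ∈ d) :
    ∃ x l, b = D.box x l := by
  obtain ⟨y, m, h1, h2⟩ := D.mem_dyckRegion.1 ((hT.cover _).2 ⟨d, hd, h⟩)
  exact ⟨y, m, h2⟩

theorem eq_of_mem {d d' : Finset (ℤ × ℤ)} (hd : d ∈ T) (hd' : d' ∈ T) {b : ℤ × ℤ} (h : b ∈ d)
    (h' : b ∈ d') : d = d' := by
  by_contra hne
  exact Finset.disjoint_left.1 (hT.disjoint d hd d' hd' hne) h h'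

/-- A tile that is not at the lowest level lies over another tile. -/
theorem exists_below {d : Finset (ℤ × ℤ)} (hd : d ∈ T) {x l : ℕ} (h : D.box x (l + 1) ∈ d) :
    ∃ d' ∈ T, ∀ y m, D.box y (m + 1) ∈ d → D.box y m ∈ d' := by
  have key : ∀ y m, D.box y (m + 1) ∈ d → D.box y m ∈ tileDown d := by
    intro y m hy
    refine Finset.mem_image.2 ⟨_, hy, ?_⟩
    simp only [box, Prod.mk.injEq, true_and]
    omega
  rcases hT.coverInclusive d hd with h1 | ⟨d', hd', h1⟩
  · have := h1 _ (key x l h)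
    simp only [box, Int.toNat_natCast, heightAt_dyckPath] at this
    omega
  · exact ⟨d', hd', fun y m hy => h1 (key y m hy)⟩

theorem level_eq_zero {d : Finset (ℤ × ℤ)} (hd : d ∈ T) {x y m : ℕ} (hx : D.box x 0 ∈ d)
    (hy : D.box y m ∈ d) : m = 0 := by
  rcases hT.coverInclusive d hd with h1 | ⟨d', hd', h1⟩
  · have := h1 _ (Finset.mem_image_of_mem _ hy)
    simp only [box, Int.toNat_natCast, heightAt_dyckPath] at this
    omega
  · obtain ⟨z, k, h2⟩ := hT.exists_box hd' (h1 (Finset.mem_image_of_mem _ hx))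
    simp only [box, Prod.mk.injEq, Nat.cast_inj] at h2
    obtain ⟨rfl, h2⟩ := h2
    omega

/-- All boxes of a tile are at the same level above the Dyck path. -/
theorem level_eq : ∀ {l : ℕ} {d : Finset (ℤ × ℤ)}, d ∈ T → ∀ {x : ℕ}, D.box x l ∈ d →
    ∀ {y m : ℕ}, D.box y m ∈ d → m = l
  | 0, _, hd, _, hx, _, _, hy => hT.level_eq_zero hd hx hy
  | _ + 1, _, hd, _, hx, _, 0, hy => (hT.level_eq_zero hd hy hx).symm
  | _ + 1, _, hd, _, hx, _, _ + 1, hy => by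
    obtain ⟨d', hd', h1⟩ := hT.exists_below hd hx
    rw [level_eq hd' (h1 _ _ hx) (h1 _ _ hy)]

/-- Every tile is a translate of a part of the Dyck path of `D` that is itself a translated Dyck
path. -/
theorem exists_eq_image {d : Finset (ℤ × ℤ)} (hd : d ∈ T) :
    ∃ a b l : ℕ, a ≤ b ∧ D.height b = D.height a ∧
      (∀ y, a ≤ y → y ≤ b → D.height a ≤ D.height y) ∧
      ∀ c, c ∈ d ↔ ∃ y, a ≤ y ∧ y ≤ b ∧ c = D.box y l := by
  obtain ⟨m, hm⟩ := hT.isDyckTile d hd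
  obtain ⟨x, y, g, h0, h1, h2, h3⟩ := hm.exists_path
  have h4 : (x, y) ∈ d := (h3 _).2 ⟨0, by omega, by simp [h0]⟩
  obtain ⟨a, l, h5⟩ := hT.exists_box hd h4
  rw [h5] at h4
  have h6 : ∀ k ≤ 2 * m, (x + (k : ℤ), y + g k) = D.box (a + k) l := by
    intro k hk
    have h7 := (h3 _).2 ⟨k, hk, rfl⟩
    obtain ⟨z, r, h8⟩ := hT.exists_box hd h7
    rw [h8] at h7
    rw [hT.level_eq hd h4 h7] at h8
    rw [h8]
    congr 1
    simp only [box, Prod.mk.injEq] at h5 h8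
    omega
  have h7 : ∀ k ≤ 2 * m, (D.height (a + k) : ℤ) = D.height a + g k := by
    intro k hk
    have h8 := h6 k hk
    have h9 := h6 0 (by omega)
    simp only [box, Prod.mk.injEq, h0, add_zero] at h8 h9
    omega
  refine ⟨a, a + 2 * m, l, by omega, ?_, fun z h8 h9 => ?_, fun c => ?_⟩
  · have := h7 (2 * m) le_rfl
    omega
  · have := h7 (z - a) (by omega)
    have := h2 (z - a)
    rw [show a + (z - a) = z by omega] at *
    omega
  · rw [h3]
    constructor
    · rintro ⟨k, hk, rfl⟩
      exact ⟨a + k, by omega, by omega, h6 k hk⟩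
    · rintro ⟨z, h8, h9, rfl⟩
      refine ⟨z - a, by omega, ?_⟩
      rw [h6 _ (by omega), show a + (z - a) = z by omega]

theorem joined_of_succ {l i : ℕ} (h : D.Joined T (l + 1) i) : D.Joined T l i := by
  obtain ⟨d, hd, h1, h2⟩ := h
  obtain ⟨d', hd', h3⟩ := hT.exists_below hd h1
  exact ⟨d', hd', h3 _ _ h1, h3 _ _ h2⟩

/-- A tile that contains one step of an arc contains the whole part of the path under this arc. -/
theorem exists_of_joined {l : ℕ} {i j : Fin (2 * n)} (hij : i < D.partner i)
    (hj : j = i ∨ j = D.partner i) (h : D.Joined T l j) :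
    ∃ d ∈ T, ∀ y, i.val ≤ y → y ≤ (D.partner i).val + 1 → D.box y l ∈ d := by
  obtain ⟨d, hd, h1, h2⟩ := h
  obtain ⟨a, b, m, hab, h3, h4, h5⟩ := hT.exists_eq_image hd
  obtain ⟨y1, h6, h7, h8⟩ := (h5 _).1 h1
  obtain ⟨y2, h9, h10, h11⟩ := (h5 _).1 h2
  rw [box_inj] at h8 h11
  obtain ⟨rfl, rfl⟩ := h8
  obtain ⟨rfl, -⟩ := h11
  have h12 := D.height_lt_height hij
  have h13 := D.height_partner_succ hij
  have h14 := Fin.lt_def.1 hij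
  have ha : a ≤ i.val := by
    by_contra hlt
    rcases hj with rfl | rfl
    · omega
    · have := h12 a (by omega) h6
      have := h4 _ h9 h10
      omega
  have hb : (D.partner i).val + 1 ≤ b := by
    by_contra hlt
    rcases hj with rfl | rfl
    · have := h12 b (by omega) (by omega)
      have := h4 _ h6 h7
      omega
    · omega
  exact ⟨d, hd, fun y h15 h16 => (h5 _).2 ⟨y, by omega, by omega, rfl⟩⟩

/-- Every cover-inclusive Dyck tiling is the tiling of a labeling. -/
theorem exists_labeling : ∃ f, D.IsLabeling f ∧ D.tiling f = T := by
  classical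
  have hex : ∀ i : ℕ, ∃ l, ¬ D.Joined T l i := fun i =>
    ⟨n, fun ⟨d, hd, h, _⟩ => lt_irrefl _ (hT.inRegion hd h).lt⟩
  let f : Fin (2 * n) → ℕ := fun i => Nat.find (hex i)
  have hle : ∀ i l m, m ≤ l → D.Joined T l i → D.Joined T m i := by
    intro i l m hml
    induction hml with
    | refl => exact id
    | step _ ih => exact fun h => ih (hT.joined_of_succ h)
  have hlt : ∀ (i : Fin (2 * n)) (l : ℕ), l < f i ↔ D.Joined T l i := fun i l => by
    simp only [f, Nat.lt_find_iff, not_not]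
    exact ⟨fun h => h l le_rfl, fun h m hm => hle _ _ _ hm h⟩
  have hmono : ∀ i t : Fin (2 * n), (∀ l, D.Joined T l i → D.Joined T l t) → f i ≤ f t := by
    intro i t h
    by_contra hlt'
    exact lt_irrefl _ ((hlt t _).2 (h _ ((hlt i _).1 (not_le.1 hlt'))))
  have hf : D.IsLabeling f := by
    refine ⟨fun i => ?_, fun i t hit hti => ?_, fun i => ?_, fun i => ?_⟩
    · have key : ∀ i : Fin (2 * n), i < D.partner i → f (D.partner i) = f i := by
        intro i hi
        refine le_antisymm (hmono _ _ fun l h => ?_) (hmono _ _ fun l h => ?_)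
        · obtain ⟨d, hd, h1⟩ := hT.exists_of_joined hi (Or.inr rfl) h
          rw [Fin.lt_def] at hi
          exact ⟨d, hd, h1 _ (by omega) (by omega), h1 _ (by omega) (by omega)⟩
        · obtain ⟨d, hd, h1⟩ := hT.exists_of_joined hi (Or.inl rfl) h
          rw [Fin.lt_def] at hi
          exact ⟨d, hd, h1 _ (by omega) (by omega), h1 _ (by omega) (by omega)⟩
      rcases D.lt_partner_or_partner_lt i with h | h
      · exact key i h
      · have := key (D.partner i) (by rwa [D.partner_partner])
        rw [D.partner_partner] at this
        exact this.symm
    · refine hmono _ _ fun l h => ?_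
      obtain ⟨d, hd, h1⟩ := hT.exists_of_joined (hit.trans hti) (Or.inl rfl) h
      rw [Fin.lt_def] at hit hti
      exact ⟨d, hd, h1 _ (by omega) (by omega), h1 _ (by omega) (by omega)⟩
    · by_contra h
      obtain ⟨d, hd, h1, -⟩ := (hlt i _).1 (not_le.1 h)
      exact lt_irrefl _ (hT.inRegion hd h1).1
    · by_contra h
      have h0 := D.ups_le (i + 1)
      obtain ⟨d, hd, -, h1⟩ := (hlt i (n - D.ups (i + 1))).1 (by omega)
      have := (hT.inRegion hd h1).2
      omega
  -- A tile of `T` is the tile of `f` with the same left-most box.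
  have key : ∀ d ∈ T, ∀ a b l : ℕ, a ≤ b → (∀ c, c ∈ d ↔ ∃ y, a ≤ y ∧ y ≤ b ∧ c = D.box y l) →
      D.tile f (a, l) = d := by
    intro d hd a b l hab h5
    ext c
    rw [mem_tile, h5]
    constructor
    · rintro ⟨y, h6, h7, h8, rfl⟩
      refine ⟨y, h7, ?_, rfl⟩
      have h9 : ∀ k, a + k ≤ y → a + k ≤ b := by
        intro k
        induction k with
        | zero => exact fun _ => hab
        | succ k ih =>
          intro hk
          have h10 := ih (by omega)
          obtain ⟨d', hd', h11, h12⟩ :=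
            (hlt _ _).1 (h8 ⟨a + k, by omega⟩ (by simp only; omega) (by simp only; omega))
          rw [hT.eq_of_mem hd' hd h11 ((h5 _).2 ⟨a + k, by omega, h10, rfl⟩), h5] at h12
          obtain ⟨z, h13, h14, h15⟩ := h12
          rw [box_inj] at h15
          simp only at h15
          omega
      have := h9 (y - a) (by omega)
      simp only at h7
      omega
    · rintro ⟨y, h6, h7, rfl⟩
      refine ⟨y, (hT.inRegion hd ((h5 _).2 ⟨y, h6, h7, rfl⟩)).le_two_mul, h6, fun i h8 h9 => ?_,
        rfl⟩
      exact (hlt i l).2 ⟨d, hd, (h5 _).2 ⟨i, h8, by omega, rfl⟩,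
        (h5 _).2 ⟨i + 1, by simp only at h8; omega, by omega, rfl⟩⟩
  refine ⟨f, hf, Finset.Subset.antisymm (fun d hd => ?_) (fun d hd => ?_)⟩
  · obtain ⟨⟨x, l⟩, hp, rfl⟩ := mem_tiling.1 hd
    obtain ⟨h1, h2⟩ := mem_starts.1 hp
    clear hd
    obtain ⟨d, hd, h3⟩ := (hT.cover (D.box x l)).1 (D.mem_dyckRegion.2 ⟨x, l, h1, rfl⟩)
    obtain ⟨a, b, m, hab, -, -, h5⟩ := hT.exists_eq_image hd
    obtain ⟨y, h6, h7, h8⟩ := (h5 _).1 h3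
    rw [box_inj] at h8
    obtain ⟨rfl, rfl⟩ := h8
    have hax : a = x := by
      by_contra hne
      have hx := h1.le_two_mul
      simp only at hx
      have h9 := h2 ⟨x - 1, by omega⟩ (by simp only; omega)
      have h10 : l < f ⟨x - 1, by omega⟩ := (hlt _ _).2 ⟨d, hd,
        (h5 _).2 ⟨x - 1, by omega, by omega, rfl⟩,
        (h5 _).2 ⟨x, h6, h7, by rw [box_inj]; exact ⟨by simp only; omega, rfl⟩⟩⟩
      simp only at h9
      omega
    subst hax
    rwa [key d hd a b l hab h5]
  · obtain ⟨a, b, l, hab, -, -, h5⟩ := hT.exists_eq_image hd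
    have h6 : D.box a l ∈ d := (h5 _).2 ⟨a, le_rfl, hab, rfl⟩
    refine mem_tiling.2 ⟨(a, l), mem_starts.2 ⟨hT.inRegion hd h6, fun i hi => ?_⟩,
      key d hd a b l hab h5⟩
    by_contra hlt'
    obtain ⟨d', hd', h7, h8⟩ := (hlt i l).1 (not_le.1 hlt')
    simp only at hi
    rw [hi] at h8
    rw [hT.eq_of_mem hd' hd h8 h6, h5] at h7
    obtain ⟨y, h9, h10, h11⟩ := h7
    rw [box_inj] at h11
    omega

end IsCoverInclusiveDyckTiling

namespace TLBDiagram

variable {n : ℕ} {D : TLBDiagram n} {f : Fin (2 * n) → ℕ}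

theorem mem_dyckTilings {T : Finset (Finset (ℤ × ℤ))} :
    T ∈ dyckTilings n D.dyckPath ↔ IsCoverInclusiveDyckTiling n D.dyckPath T := by
  simp only [dyckTilings, Finset.mem_filter, Finset.mem_powerset, and_iff_right_iff_imp]
  exact fun hT d hd => Finset.mem_powerset.2 fun b hb => (hT.cover b).2 ⟨d, hd, hb⟩

/-- The restriction on the tilings says that dotted arcs have label `0`. -/
theorem IsLabeling.admissible_tiling (hf : D.IsLabeling f) :
    D.Admissible (D.tiling f) ↔ ∀ i, D.dot i = true → f i = 0 := by
  have hcaps : ∀ i, i ∈ D.dottedCaps ↔ D.dot i = true ∧ i < D.partner i := fun i => by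
    simp [dottedCaps]
  constructor
  · intro h
    have key : ∀ i, D.dot i = true → i < D.partner i → f i = 0 := by
      intro i hi hlt
      by_contra hne
      have hpos : 0 < f i := Nat.pos_of_ne_zero hne
      obtain ⟨d, hd, h1⟩ := hf.isCoverInclusive_tiling.exists_of_joined hlt (Or.inl rfl)
        ((hf.joined_tiling i 0).2 hpos)
      have h2 := hf.isCoverInclusive_tiling
      have h3 := Fin.lt_def.1 hlt
      refine h i ((hcaps i).2 ⟨hi, hlt⟩) d hd
        ((Finset.Icc i.val ((D.partner i).val + 1)).image fun y => D.box y 0) (fun b => ?_) ?_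
      · rw [Finset.mem_image]
        constructor
        · rintro ⟨y, hy, rfl⟩
          rw [Finset.mem_Icc] at hy
          refine ⟨h1 y hy.1 hy.2, ?_, ?_⟩ <;> simp only [box] <;> omega
        · rintro ⟨hb, hb1, hb2⟩
          obtain ⟨y, m, rfl⟩ := h2.exists_box hd hb
          simp only [box] at hb1 hb2
          rw [h2.level_eq hd (h1 i le_rfl (by omega)) hb]
          exact ⟨y, Finset.mem_Icc.2 ⟨by omega, by omega⟩, rfl⟩
      · have h4 := D.height_partner_succ hlt
        have h5 := D.isDyckTile_image_box (a := i.val) (b := (D.partner i).val + 1) 0 (by omega)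
          (D.partner i).isLt h4 (fun y h5 h6 => by
            rcases h5.eq_or_lt with rfl | h5
            · exact le_rfl
            rcases h6.eq_or_lt with rfl | h6
            · exact h4.ge
            exact (D.height_lt_height hlt y h5 (by omega)).le)
        rwa [show ((D.partner i).val + 1 - i.val) / 2 = D.capSize i by
          rw [capSize]; congr 1; omega] at h5
    intro i hi
    rcases D.lt_partner_or_partner_lt i with h1 | h1
    · exact key i hi h1
    · rw [← hf.partner]
      exact key _ (by rw [D.dot_partner, hi]) (by rwa [D.partner_partner])
  · intro h i hi d hd e he htile
    obtain ⟨hdot, hlt⟩ := (hcaps i).1 hi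
    have h0 := h i hdot
    have hT := hf.isCoverInclusive_tiling
    obtain ⟨x, y, g, -, -, -, h3⟩ := htile.exists_path
    have h4 := Fin.lt_def.1 hlt
    -- The arc has an even number of positions, so the part of the tile starts where the arc does.
    have h5 : 2 * D.capSize i = (D.partner i).val - i.val + 1 := by
      have h5 := D.height_partner_succ hlt
      have h6 := D.ups_add_downs i i.isLt.le
      have h7 := D.ups_add_downs ((D.partner i).val + 1) (D.partner i).isLt
      have h8 := D.downs_le_ups i
      have h9 := D.downs_le_ups ((D.partner i).val + 1)
      simp only [height] at h5
      rw [capSize]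
      omega
    have h6 := (he _).1 ((h3 _).2 ⟨0, by omega, rfl⟩)
    have h7 := (he _).1 ((h3 _).2 ⟨2 * D.capSize i, le_rfl, rfl⟩)
    have h8 := (he _).1 ((h3 _).2 ⟨1, by omega, rfl⟩)
    obtain ⟨z, l, h9⟩ := hT.exists_box hd h6.1
    obtain ⟨z', l', h10⟩ := hT.exists_box hd h8.1
    have h11 := h6.1
    have h12 := h8.1
    rw [h9] at h11
    rw [h10] at h12
    rw [hT.level_eq hd h11 h12] at h10 h12
    have h13 := h6.2.1
    have h14 := h7.2.2
    simp only [box, Prod.mk.injEq] at h9 h10 h13 h14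
    have hz : z = i.val := by omega
    have hz' : z' = i.val + 1 := by omega
    rw [hz] at h11
    rw [hz'] at h12
    have := (hf.joined_tiling i l).1 ⟨d, hd, h11, h12⟩
    omega

end TLBDiagram

/-! ### The weight of a tiling -/

section Telescope

variable {K : Type*} [Field K] {q s : K}

/-- The weight `[h]_s / [h + 1]_s` of a tile, or of a single box, at height `h`. -/
def boxWeight (q s : K) (h : ℕ) : K := qIntS q s h / qIntS q s (h + 1)

theorem prod_boxWeight_pairs (a : ℕ) : ∀ k : ℕ, (∀ j ≤ 2 * k, qIntS q s (a + j) ≠ 0) →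
    ∏ l ∈ Finset.range k, boxWeight q s (a + 2 * l) * boxWeight q s (a + 1 + 2 * l) =
      qIntS q s a / qIntS q s (a + 2 * k)
  | 0, h => by simpa using (div_self (h 0 le_rfl)).symm
  | k + 1, h => by
    have h0 := h (2 * k) (by omega)
    have h1 := h (2 * k + 1) (by omega)
    have h2 := h (2 * k + 2) (by omega)
    rw [Finset.prod_range_succ, prod_boxWeight_pairs a k fun j hj => h j (by omega), boxWeight,
      boxWeight, show a + 2 * k + 1 = a + (2 * k + 1) by omega,
      show a + 1 + 2 * k = a + (2 * k + 1) by omega,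
      show a + (2 * k + 1) + 1 = a + (2 * k + 2) by omega,
      show a + 2 * (k + 1) = a + (2 * k + 2) by omega]
    field_simp

theorem prod_boxWeight_even (a k : ℕ) (h : ∀ j ≤ 2 * k, qIntS q s (a + j) ≠ 0) :
    (∏ l ∈ Finset.range k, boxWeight q s (a + 2 * l)) *
      ∏ l ∈ Finset.range k, boxWeight q s (a + 1 + 2 * l) =
      qIntS q s a / qIntS q s (a + 2 * k) := by
  rw [← Finset.prod_mul_distrib, prod_boxWeight_pairs a k h]

theorem prod_boxWeight_odd (a k : ℕ) (h : ∀ j ≤ 2 * k, qIntS q s (a + j) ≠ 0) :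
    (∏ l ∈ Finset.range (k + 1), boxWeight q s (a + 2 * l)) *
      ∏ l ∈ Finset.range k, boxWeight q s (a + 1 + 2 * l) =
      qIntS q s a / qIntS q s (a + 2 * k + 1) := by
  have h1 := h (2 * k) le_rfl
  rw [Finset.prod_range_succ, mul_right_comm, prod_boxWeight_even a k h, boxWeight]
  field_simp

end Telescope

namespace TLBDiagram

variable {n : ℕ} (D : TLBDiagram n)

/-- A product over all positions is a product over the arcs. -/
theorem prod_eq_prod_arcs {M : Type*} [CommMonoid M] (F : Fin (2 * n) → M) :
    ∏ i, F i = ∏ i, if i < D.partner i then F i * F (D.partner i) else 1 := by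
  have h : ∏ i, F i = ∏ i, (if i < D.partner i then F i else 1) *
      (if D.partner i < i then F i else 1) := by
    refine Finset.prod_congr rfl fun i _ => ?_
    rcases D.lt_partner_or_partner_lt i with h | h <;> simp [h, h.not_gt]
  have h2 : ∏ i, (if D.partner i < i then F i else 1) =
      ∏ i, (if i < D.partner i then F (D.partner i) else 1) := by
    refine Finset.prod_nbij' D.partner D.partner (fun _ _ => Finset.mem_univ _)
      (fun _ _ => Finset.mem_univ _) (fun i _ => D.partner_partner i)
      (fun i _ => D.partner_partner i) fun i _ => ?_
    rw [D.partner_partner]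
  rw [h, Finset.prod_mul_distrib, h2, ← Finset.prod_mul_distrib]
  refine Finset.prod_congr rfl fun i _ => ?_
  split_ifs <;> simp

theorem even_partner_iff (i : Fin (2 * n)) : Even (D.partner i).val ↔ ¬ Even i.val := by
  have key : ∀ i : Fin (2 * n), i < D.partner i → (Even (D.partner i).val ↔ ¬ Even i.val) := by
    intro i hi
    have h5 := D.height_partner_succ hi
    have h6 := D.ups_add_downs i i.isLt.le
    have h7 := D.ups_add_downs ((D.partner i).val + 1) (D.partner i).isLt
    have h8 := D.downs_le_ups i
    have h9 := D.downs_le_ups ((D.partner i).val + 1)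
    simp only [height] at h5
    rw [Nat.even_iff, Nat.even_iff]
    omega
  rcases D.lt_partner_or_partner_lt i with h | h
  · exact key i h
  · have := key (D.partner i) (by rwa [D.partner_partner])
    rw [D.partner_partner] at this
    tauto

/-- Every arc has exactly one end at an even position. -/
theorem prod_even_eq_prod_arcs {M : Type*} [CommMonoid M] (g : Fin (2 * n) → M)
    (hg : ∀ i, g (D.partner i) = g i) :
    ∏ i, (if Even i.val then g i else 1) = ∏ i, if i < D.partner i then g i else 1 := by
  rw [D.prod_eq_prod_arcs]
  refine Finset.prod_congr rfl fun i _ => ?_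
  have := D.even_partner_iff i
  split_ifs <;> simp_all

/-- The number of boxes of the region at the abscissa `x`. -/
def column (x : ℕ) : ℕ := min (D.downs x) (n - D.ups x)

theorem lt_column {x l : ℕ} : l < D.column x ↔ D.InRegion x l := by
  rw [column, InRegion]
  omega

variable {K : Type*} [Field K] {q s : K}

/-- The boxes at two neighbouring abscissas have heights that form an interval, so the product of
their weights telescopes. -/
theorem prod_column_mul_prod_column (hqs : ∀ k : ℕ, 1 ≤ k → k ≤ n → qIntS q s k ≠ 0)
    (i : Fin (2 * n)) :
    (∏ l ∈ Finset.range (D.column i), boxWeight q s (D.height i + 1 + 2 * l)) *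
      (∏ l ∈ Finset.range (D.column (i + 1)), boxWeight q s (D.height (i + 1) + 1 + 2 * l)) =
    qIntS q s (min (D.height i) (D.height (i + 1)) + 1) /
      qIntS q s (if i.val < n then i.val + 1 else 2 * n - i.val) := by
  have h1 := D.ups_add_downs i i.isLt.le
  have h2 := D.downs_le_ups i
  have h2' := D.downs_le_ups (i + 1)
  have h4 := D.ups_le i
  have h4' := D.ups_le (i + 1)
  have h5 := i.isLt
  rcases D.lt_partner_or_partner_lt i with h | h
  · have h6 := D.ups_succ_of_lt h
    have h7 := D.downs_succ_of_lt h
    have h8 : D.height (i + 1) = D.height i + 1 := D.height_succ_of_lt h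
    have h9 : min (D.height i) (D.height (i + 1)) = D.height i := by omega
    have h10 : D.height i = D.ups i - D.downs i := rfl
    rw [h9, h8]
    split_ifs with hi
    · have hc : D.column i = D.downs i := by rw [column]; omega
      have hc' : D.column (i + 1) = D.downs i := by rw [column]; omega
      rw [hc, hc', prod_boxWeight_even _ _ fun j hj => hqs _ (by omega) (by omega)]
      congr 2
      omega
    · have hc : D.column i = n - D.ups (i + 1) + 1 := by rw [column]; omega
      have hc' : D.column (i + 1) = n - D.ups (i + 1) := by rw [column]; omega
      rw [hc, hc', prod_boxWeight_odd _ _ fun j hj => hqs _ (by omega) (by omega)]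
      congr 2
      omega
  · have h6 := D.ups_succ_of_gt h
    have h7 := D.downs_succ_of_gt h
    have h8 : D.height (i + 1) + 1 = D.height i := D.height_succ_of_gt h
    have h9 : min (D.height i) (D.height (i + 1)) = D.height (i + 1) := by omega
    have h10 : D.height i = D.ups i - D.downs i := rfl
    rw [h9, ← h8, mul_comm]
    split_ifs with hi
    · have hc : D.column i = D.downs i := by rw [column]; omega
      have hc' : D.column (i + 1) = D.downs i + 1 := by rw [column]; omega
      rw [hc, hc', prod_boxWeight_odd _ _ fun j hj => hqs _ (by omega) (by omega)]
      congr 2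
      omega
    · have hc : D.column i = n - D.ups i := by rw [column]; omega
      have hc' : D.column (i + 1) = n - D.ups i := by rw [column]; omega
      rw [hc, hc', prod_boxWeight_even _ _ fun j hj => hqs _ (by omega) (by omega)]
      congr 2
      omega

theorem prod_range_two_mul {M : Type*} [CommMonoid M] (g : ℕ → M) : ∀ m : ℕ,
    ∏ x ∈ Finset.range (2 * m), g x = ∏ k ∈ Finset.range m, g (2 * k) * g (2 * k + 1)
  | 0 => by simp
  | m + 1 => by
    rw [show 2 * (m + 1) = 2 * m + 1 + 1 by omega, Finset.prod_range_succ, Finset.prod_range_succ,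
      prod_range_two_mul g m, Finset.prod_range_succ, mul_assoc]

/-- The product of the weights of all boxes of the region. The boxes are grouped by pairs of
neighbouring abscissas `2 k`, `2 k + 1`, which correspond to the arcs. -/
theorem prod_region (hqs : ∀ k : ℕ, 1 ≤ k → k ≤ n → qIntS q s k ≠ 0) :
    ∏ x ∈ Finset.range (2 * n + 1),
      ∏ l ∈ Finset.range (D.column x), boxWeight q s (D.height x + 1 + 2 * l) =
    (∏ i, if i < D.partner i then qIntS q s (D.height i + 1) else 1) *
      ∏ k ∈ Finset.range n, 1 / qIntS q s (k + 1) := by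
  have hlast : D.column (2 * n) = 0 := by
    rw [column, ups_two_mul]
    omega
  let g : Fin (2 * n) → K := fun i => qIntS q s (min (D.height i) (D.height (i + 1)) + 1)
  have hg0 : ∀ i, i < D.partner i → g i = qIntS q s (D.height i + 1) := fun i h => by
    have := D.height_succ_of_lt h
    simp only [g]
    congr 2
    omega
  have hg : ∀ i, g (D.partner i) = g i := by
    have key : ∀ i, i < D.partner i → g (D.partner i) = g i := by
      intro i h
      have h1 := D.height_partner_succ h
      have h2 := D.height_succ_of_gt (i := D.partner i) (by rwa [D.partner_partner])
      rw [hg0 i h]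
      simp only [g]
      congr 2
      omega
    intro i
    rcases D.lt_partner_or_partner_lt i with h | h
    · exact key i h
    · have := key (D.partner i) (by rwa [D.partner_partner])
      rw [D.partner_partner] at this
      exact this.symm
  have h1 : ∏ i, (if i < D.partner i then qIntS q s (D.height i + 1) else 1) =
      ∏ k ∈ Finset.range n,
        qIntS q s (min (D.height (2 * k)) (D.height (2 * k + 1)) + 1) := by
    trans ∏ i, if Even i.val then g i else 1
    · rw [D.prod_even_eq_prod_arcs g hg]
      refine Finset.prod_congr rfl fun i _ => ?_
      split_ifs with h
      · exact (hg0 i h).symm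
      · rfl
    · rw [← Finset.prod_range (fun x => if Even x then
        qIntS q s (min (D.height x) (D.height (x + 1)) + 1) else 1), prod_range_two_mul]
      refine Finset.prod_congr rfl fun k _ => ?_
      rw [if_pos (even_two_mul k), if_neg (by simp), mul_one]
  have h2 : ∏ k ∈ Finset.range n, 1 / qIntS q s (k + 1) =
      ∏ k ∈ Finset.range n, 1 / qIntS q s (if 2 * k < n then 2 * k + 1 else 2 * n - 2 * k) := by
    -- The odd factors come from the left half of the region, the even ones from the right half.
    refine Finset.prod_nbij' (fun k => if k % 2 = 0 then k / 2 else n - (k + 1) / 2)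
      (fun k => if 2 * k < n then 2 * k else 2 * n - 2 * k - 1) ?_ ?_ ?_ ?_ ?_
    all_goals
      intro k hk
      rw [Finset.mem_range] at hk
    · rw [Finset.mem_range]; split_ifs <;> omega
    · rw [Finset.mem_range]; split_ifs <;> omega
    · split_ifs <;> omega
    · split_ifs <;> omega
    · congr 2; split_ifs <;> omega
  rw [Finset.prod_range_succ, hlast, Finset.prod_range_zero, mul_one, prod_range_two_mul, h1, h2,
    ← Finset.prod_mul_distrib]
  refine Finset.prod_congr rfl fun k hk => ?_
  rw [Finset.mem_range] at hk
  have := D.prod_column_mul_prod_column hqs ⟨2 * k, by omega⟩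
  simp only at this
  rw [this]
  ring

variable {D} {f : Fin (2 * n) → ℕ}

/-- The box weights split into those of the left-most boxes of the tiles and those of the boxes
that are joined to their left neighbour. -/
theorem IsLabeling.prod_starts_mul (hf : D.IsLabeling f) :
    (∏ p ∈ D.starts f, boxWeight q s (D.height p.1 + 1 + 2 * p.2)) *
      ∏ i : Fin (2 * n), ∏ l ∈ Finset.range (f i),
        boxWeight q s (D.height (i + 1) + 1 + 2 * l) =
    ∏ x ∈ Finset.range (2 * n + 1),
      ∏ l ∈ Finset.range (D.column x), boxWeight q s (D.height x + 1 + 2 * l) := by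
  classical
  have h0 : D.column 0 = 0 := by rw [column, downs_zero]; omega
  have h1 : ∏ p ∈ D.starts f, boxWeight q s (D.height p.1 + 1 + 2 * p.2) =
      ∏ x ∈ Finset.range (2 * n + 1), ∏ l ∈ (Finset.range (D.column x)).filter
        (fun l => ∀ i : Fin (2 * n), i.val + 1 = x → f i ≤ l),
        boxWeight q s (D.height x + 1 + 2 * l) := by
    rw [Finset.prod_sigma']
    refine Finset.prod_nbij' (fun p => ⟨p.1, p.2⟩) (fun p => (p.1, p.2)) ?_ ?_ ?_ ?_ ?_
    · intro p hp
      have h2 := mem_starts.1 hp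
      simp only [Finset.mem_sigma, Finset.mem_filter, Finset.mem_range, lt_column]
      exact ⟨Nat.lt_succ_of_le h2.1.le_two_mul, h2⟩
    · intro p hp
      simp only [Finset.mem_sigma, Finset.mem_filter, Finset.mem_range, lt_column] at hp
      exact mem_starts.2 hp.2
    · exact fun _ _ => rfl
    · exact fun _ _ => rfl
    · exact fun _ _ => rfl
  rw [h1, Finset.prod_range_succ', Finset.prod_range_succ', h0]
  simp only [Finset.range_zero, Finset.filter_empty, Finset.prod_empty, mul_one]
  rw [Finset.prod_range, Finset.prod_range, ← Finset.prod_mul_distrib]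
  refine Finset.prod_congr rfl fun i _ => ?_
  rw [← Finset.prod_filter_mul_prod_filter_not (Finset.range (D.column (i + 1)))
    (fun l => f i ≤ l)]
  congr 1
  · refine Finset.prod_congr ?_ fun _ _ => rfl
    refine Finset.filter_congr fun l _ => ⟨fun h => h i rfl, fun h j hj => ?_⟩
    rwa [show j = i from Fin.ext (by omega)]
  · refine Finset.prod_congr ?_ fun _ _ => rfl
    ext l
    rw [Finset.mem_filter, Finset.mem_range, Finset.mem_range, not_le, lt_column]
    exact ⟨fun h => ⟨hf.inRegion_succ h, h⟩, fun h => h.2⟩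

/-- The weight of a tiling is the product of `[b + 1 + 2 f]_s` over all arcs, up to a constant. -/
theorem IsLabeling.prod_tiling (hf : D.IsLabeling f)
    (hqs : ∀ k : ℕ, 1 ≤ k → k ≤ n → qIntS q s k ≠ 0) :
    ∏ d ∈ D.tiling f, qIntS q s (tileHeight d) / qIntS q s (tileHeight d + 1) =
      (∏ k ∈ Finset.range n, 1 / qIntS q s (k + 1)) *
        ∏ i, if i < D.partner i then qIntS q s (D.height i + 1 + 2 * f i) else 1 := by
  have hle : ∀ i : Fin (2 * n), i < D.partner i → D.height i + 1 + 2 * f i ≤ n := by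
    intro i hi
    have h1 := hf.le_downs i
    have h2 := hf.add_ups_le i
    have h3 := D.downs_le_ups i
    rw [D.ups_succ_of_lt hi] at h2
    rw [height]
    omega
  have h1 : ∏ d ∈ D.tiling f, qIntS q s (tileHeight d) / qIntS q s (tileHeight d + 1) =
      ∏ p ∈ D.starts f, boxWeight q s (D.height p.1 + 1 + 2 * p.2) := by
    rw [tiling, Finset.prod_image]
    · exact Finset.prod_congr rfl fun p hp => by rw [hf.tileHeight_tile hp, boxWeight]
    · intro p hp p' hp' h
      refine eq_of_mem_tile hp hp' (b := D.box p.1 p.2) ?_ ?_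
      · exact box_mem_tile.2 ⟨(mem_starts.1 hp).1.le_two_mul, rfl, le_rfl,
          fun i h1 h2 => absurd h1 (by omega)⟩
      · rw [← h]
        exact box_mem_tile.2 ⟨(mem_starts.1 hp).1.le_two_mul, rfl, le_rfl,
          fun i h1 h2 => absurd h1 (by omega)⟩
  have h2 : ∏ i : Fin (2 * n), ∏ l ∈ Finset.range (f i),
        boxWeight q s (D.height (i + 1) + 1 + 2 * l) =
      ∏ i, if i < D.partner i then
        qIntS q s (D.height i + 1) / qIntS q s (D.height i + 1 + 2 * f i) else 1 := by
    rw [D.prod_eq_prod_arcs]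
    refine Finset.prod_congr rfl fun i _ => ?_
    split_ifs with h
    · rw [hf.partner, D.height_partner_succ h, D.height_succ_of_lt h, mul_comm,
        prod_boxWeight_even]
      intro j hj
      exact hqs _ (by omega) ((by omega : D.height i + 1 + j ≤ _).trans (hle i h))
    · rfl
  have h3 := hf.prod_starts_mul (q := q) (s := s)
  rw [h2, D.prod_region hqs] at h3
  have h4 : ∏ i, (if i < D.partner i then
        qIntS q s (D.height i + 1) / qIntS q s (D.height i + 1 + 2 * f i) else 1) *
      (if i < D.partner i then qIntS q s (D.height i + 1 + 2 * f i) else 1) =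
      ∏ i, if i < D.partner i then qIntS q s (D.height i + 1) else 1 := by
    refine Finset.prod_congr rfl fun i _ => ?_
    split_ifs with h
    · exact div_mul_cancel₀ _ (hqs _ (by omega) (hle i h))
    · exact mul_one 1
  have h5 : ∏ i, (if i < D.partner i then qIntS q s (D.height i + 1) else 1) ≠ 0 := by
    refine Finset.prod_ne_zero_iff.2 fun i _ => ?_
    split_ifs with h
    · have := hle i h
      exact hqs _ (by omega) (by omega)
    · exact one_ne_zero
  rw [h1]
  rw [Finset.prod_mul_distrib] at h4
  refine mul_right_cancel₀ h5 ?_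
  rw [← h4] at h3 ⊢
  linear_combination
    (∏ i, if i < D.partner i then qIntS q s (D.height i + 1 + 2 * f i) else 1) * h3

/-- On the labelings that vanish on the dotted arcs, every dotted arc contributes `[1]_s` to the
weight of the tiling. -/
theorem prod_arcs_eq (hf : ∀ i, D.dot i = true → f i = 0) :
    (∏ i, if i < D.partner i then qIntS q s (D.height i + 1 + 2 * f i) else 1) =
      qIntS q s 1 ^ D.dottedCaps.card * D.labelingWeight q s f := by
  rw [dottedCaps, ← Finset.prod_const, Finset.prod_filter, labelingWeight,
    ← Finset.prod_mul_distrib]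
  refine Finset.prod_congr rfl fun i _ => ?_
  by_cases h : i < D.partner i
  · by_cases hd : D.dot i = true
    · simp [h, hd, hf i hd, height, D.ups_eq_downs_of_dot hd h]
    · simp [h, hd, height]
  · simp [h]

theorem ZB_eq_labelingSum (D : TLBDiagram n)
    (hqs : ∀ k : ℕ, 1 ≤ k → k ≤ n → qIntS q s k ≠ 0) :
    D.ZB q s = (∏ k ∈ Finset.range n, 1 / qIntS q s (k + 1)) * D.labelingSum q s := by
  classical
  have h1 : ∀ f ∈ D.labelings, D.tiling f ∈ (dyckTilings n D.dyckPath).filter D.Admissible := by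
    intro f hf
    obtain ⟨h2, h3⟩ := D.mem_labelings.1 hf
    exact Finset.mem_filter.2 ⟨mem_dyckTilings.2 h2.isCoverInclusive_tiling,
      h2.admissible_tiling.2 h3⟩
  have h2 : (1 / qIntS q s 1) ^ D.dottedCaps.card * qIntS q s 1 ^ D.dottedCaps.card = 1 := by
    rcases Nat.eq_zero_or_pos n with rfl | hn
    · have : D.dottedCaps = ∅ := Finset.eq_empty_of_forall_notMem fun i => i.elim0
      simp [this]
    · rw [← mul_pow, one_div_mul_cancel (hqs 1 le_rfl hn), one_pow]
  rw [ZB, labelingSum, Finset.mul_sum, Finset.mul_sum]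
  symm
  refine Finset.sum_bij (fun f _ => D.tiling f) ?_ ?_ ?_ ?_
  · intro f hf
    convert h1 f hf
  · intro f hf g hg h
    exact (D.mem_labelings.1 hf).1.tiling_injective (D.mem_labelings.1 hg).1 h
  · intro T hT
    rw [Finset.mem_filter] at hT
    obtain ⟨f, hf, rfl⟩ := (mem_dyckTilings.1 hT.1).exists_labeling
    exact ⟨f, D.mem_labelings.2 ⟨hf, hf.admissible_tiling.1 hT.2⟩, rfl⟩
  · intro f hf
    obtain ⟨h3, h4⟩ := D.mem_labelings.1 hf
    rw [h3.prod_tiling hqs, prod_arcs_eq h4]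
    linear_combination -(∏ k ∈ Finset.range n, 1 / qIntS q s (k + 1)) *
      D.labelingWeight q s f * h2

end TLBDiagram

theorem mainTheorem2 {K : Type*} [Field K] (q s : K) (hq : q ≠ 0) (hs : s ≠ 0) (n : ℕ)
    (hqs : ∀ k : ℕ, 1 ≤ k → k ≤ n → qIntS q s k ≠ 0) (D : TLBDiagram n) :
    TLB.coeffB q s D = TLBDiagram.ZB q s D := by
  rw [TLB.coeffB_eq_labelingSum hq hs hqs, D.ZB_eq_labelingSum hqs]
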